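/- Let $r\ge 2$ be a fixed integer. A hypergraph $H=(V,\mathcal E)$ consists of a finite vertex set $V$ and a set $\mathcal E$ of subsets of $V$ (edges). An edge $e$ separates two vertices $x,y$ if $|\{x,y\}\cap e|=1$, and a set $\mathcal T\subseteq\mathcal E$ is a test cover if every pair of distinct vertices of $V$ is separated by an edge of $\mathcal T$. An instance of Subset-Test-$r$-Cover$(m-k)$ consists of a hypergraph $(V,\mathcal E)$ with $m=|\mathcal E|$ such that every edge has at most $r$ vertices and $\mathcal E$ is a test cover, a set $\mathcal B\subseteq\mathcal E$, and a nonnegative integer $k$ (the parameter). It is a Yes-instance if there is a test cover $\mathcal T$ with $\mathcal B\subseteq\mathcal T\subseteq\mathcal E$ and $|\mathcal T|\le m-k$. Test-$r$-Cover$(m-k)$ is the same problem without $\mathcal B$: it asks for a test cover $\mathcal T\subseteq\mathcal E$ with $|\mathcal T|\le m-k$. A kernelization of a parameterized problem is an algorithm that maps every instance $(I,k)$, in time polynomial in $|I|+k$, to an instance $(I',k')$ of the same problem (the kernel) such that $(I,k)$ is a Yes-instance if and only if $(I',k')$ is, and such that $|I'|+k'\le g(k)$ for a function $g$ of $k$ only.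 The kernel is polynomial if $g$ can be taken to be a polynomial. Theorem. For every fixed $r\ge 2$: (1) Subset-Test-$r$-Cover$(m-k)$ has a polynomial kernel in which the hypergraph $(V',\mathcal E')$ satisfies $$|V'|\le (k-1)k^5r^{16}+1,\qquad |\mathcal E'|\le (k-1)k^5r^{16}+k;$$ (2) Test-$r$-Cover$(m-k)$ has a polynomial kernel in which the hypergraph $(V',\mathcal E')$ satisfies $$|V'|\le 5(k-1)k^5r^{16}+4k+1,\qquad |\mathcal E'|\le 3(k-1)k^5r^{16}+3k,$$ where $k$ is the parameter of the given instance. -/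

import Mathlib

namespace TestCoverKernel

/-! ### Test covers -/

/-- The edge `e` separates `x` and `y`: exactly one of them lies in `e`. -/
def Separates {V : Type*} [DecidableEq V] (e : Finset V) (x y : V) : Prop :=
  (({x, y} : Finset V) ∩ e).card = 1

/-- A collection of edges is a test cover if it separates every pair of distinct vertices. -/
def IsTestCover {V : Type*} [DecidableEq V] (T : Finset (Finset V)) : Prop :=
  ∀ x y : V, x ≠ y → ∃ e ∈ T, Separates e x y

/-- An instance of Test-`r`-Cover(`m - k`): a hypergraph on the vertex set `{0, …, n - 1}` with
a set of edges of size at most `r`, which is itself a test cover, and a parameter `k`. -/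
structure TestInstance (r : ℕ) where
  n : ℕ
  edges : Finset (Finset (Fin n))
  k : ℕ
  card_le : ∀ e ∈ edges, e.card ≤ r
  isTestCover : IsTestCover edges

/-- Yes-instances: there is a test cover with at most `m - k` edges (`m - k` an integer). -/
def TestInstance.Yes {r : ℕ} (I : TestInstance r) : Prop :=
  ∃ T ⊆ I.edges, IsTestCover T ∧ T.card + I.k ≤ I.edges.card

/-- An instance of Subset-Test-`r`-Cover(`m - k`): additionally a set of black edges is given. -/
structure SubsetInstance (r : ℕ) where
  n : ℕ
  edges : Finset (Finset (Fin n))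
  black : Finset (Finset (Fin n))
  k : ℕ
  card_le : ∀ e ∈ edges, e.card ≤ r
  isTestCover : IsTestCover edges
  black_subset : black ⊆ edges

/-- Yes-instances: there is a test cover with at most `m - k` edges that contains all the
black edges. -/
def SubsetInstance.Yes {r : ℕ} (I : SubsetInstance r) : Prop :=
  ∃ T ⊆ I.edges, I.black ⊆ T ∧ IsTestCover T ∧ T.card + I.k ≤ I.edges.card

/-! ### A machine model with a cost measure

The WHILE language over finite binary trees. Every executed instruction is charged the full size of
the tree it is applied to, so that the cost of a run bounds the size of every tree that occurs
in it, and each instruction can be carried out by a Turing machine in time polynomial in its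
charge; polynomial cost is the same as polynomial time on Turing machines. -/

/-- The data: finite binary trees. -/
inductive Data : Type
  | nil : Data
  | node : Data → Data → Data

/-- The number of constructors of a tree. -/
def Data.size : Data → ℕ
  | .nil => 1
  | .node a b => 1 + a.size + b.size

def Data.head : Data → Data
  | .nil => .nil
  | .node a _ => a

def Data.tail : Data → Data
  | .nil => .nil
  | .node _ b => b

/-- Programs; each of them turns one tree (the current state) into another. -/
inductive Prog : Type
  /-- do nothing -/
  | skip : Prog
  /-- replace the state by `nil` -/
  | nil : Prog
  /-- replace the state by its left subtree -/
  | head : Prog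
  /-- replace the state by its right subtree -/
  | tail : Prog
  /-- run both programs on the state and combine the results -/
  | pair : Prog → Prog → Prog
  /-- run the first program, then the second one -/
  | seq : Prog → Prog → Prog
  /-- `ite c p q`: run `p` if the result of the test `c` is not `nil`, and `q` otherwise -/
  | ite : Prog → Prog → Prog → Prog
  /-- `loop c p`: as long as the result of the test `c` is not `nil`, run `p` -/
  | loop : Prog → Prog → Prog

/-- `Runs p x y t`: the program `p`, started on `x`, halts with result `y` at total cost `t`. -/
inductive Runs : Prog → Data → Data → ℕ → Prop
  | skip (x : Data) : Runs .skip x x x.size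
  | nil (x : Data) : Runs .nil x .nil x.size
  | head (x : Data) : Runs .head x x.head x.size
  | tail (x : Data) : Runs .tail x x.tail x.size
  | pair {p q : Prog} {x y z : Data} {s t : ℕ} :
      Runs p x y s → Runs q x z t → Runs (.pair p q) x (.node y z) (x.size + s + t)
  | seq {p q : Prog} {x y z : Data} {s t : ℕ} :
      Runs p x y s → Runs q y z t → Runs (.seq p q) x z (x.size + s + t)
  | ite_true {c p q : Prog} {x b y : Data} {s t : ℕ} :
      Runs c x b s → b ≠ .nil → Runs p x y t → Runs (.ite c p q) x y (x.size + s + t)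
  | ite_false {c p q : Prog} {x y : Data} {s t : ℕ} :
      Runs c x .nil s → Runs q x y t → Runs (.ite c p q) x y (x.size + s + t)
  | loop_stop {c p : Prog} {x : Data} {s : ℕ} :
      Runs c x .nil s → Runs (.loop c p) x x (x.size + s)
  | loop_step {c p : Prog} {x b y z : Data} {s t u : ℕ} :
      Runs c x b s → b ≠ .nil → Runs p x y t → Runs (.loop c p) y z u →
      Runs (.loop c p) x z (x.size + s + t + u)

/-! ### Encoding of instances as data -/

/-- A natural number in unary. -/
def encNat : ℕ → Data
  | 0 => .nil
  | m + 1 => .node .nil (encNat m)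

/-- A list of trees. -/
def encList : List Data → Data
  | [] => .nil
  | a :: l => .node a (encList l)

/-- `d` is a list of the members of `E`, each of them listed once (in any order) and given as a
list of its vertices, each of them listed once (in any order). -/
def EncodesEdges {n : ℕ} (E : Finset (Finset (Fin n))) (d : Data) : Prop :=
  ∃ L : List (List (Fin n)),
    (∀ l ∈ L, l.Nodup) ∧ (L.map List.toFinset).Nodup ∧ (∀ e, e ∈ E ↔ e ∈ L.map List.toFinset) ∧
      d = encList (L.map fun l => encList (l.map fun v => encNat v.val))

/-- `d` encodes `(n, k, edges)`. -/
def TestInstance.Encodes {r : ℕ} (I : TestInstance r) (d : Data) : Prop :=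
  ∃ dE, EncodesEdges I.edges dE ∧ d = .node (encNat I.n) (.node (encNat I.k) dE)

/-- `d` encodes `(n, k, edges, black)`. -/
def SubsetInstance.Encodes {r : ℕ} (I : SubsetInstance r) (d : Data) : Prop :=
  ∃ dE dB, EncodesEdges I.edges dE ∧ EncodesEdges I.black dB ∧
    d = .node (encNat I.n) (.node (encNat I.k) (.node dE dB))

/-! ### Kernels -/

/-- A parameterized problem, with the encodings of its instances. -/
structure ParamProblem where
  Inst : Type
  param : Inst → ℕ
  Yes : Inst → Prop
  Encodes : Inst → Data → Prop

/-- The problem Test-`r`-Cover(`m - k`). -/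
abbrev testCover (r : ℕ) : ParamProblem where
  Inst := TestInstance r
  param := TestInstance.k
  Yes := TestInstance.Yes
  Encodes := TestInstance.Encodes

/-- The problem Subset-Test-`r`-Cover(`m - k`). -/
abbrev subsetTestCover (r : ℕ) : ParamProblem where
  Inst := SubsetInstance r
  param := SubsetInstance.k
  Yes := SubsetInstance.Yes
  Encodes := SubsetInstance.Encodes

/-- The problem `Q` has a polynomial kernel: there is a polynomial-time algorithm that maps every
instance `I` to an equivalent instance `I'` of `Q` whose size plus parameter is bounded by a
polynomial in the parameter `k` of `I`, and moreover `Bound k I'` holds. -/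
def HasPolyKernel (Q : ParamProblem) (Bound : ℕ → Q.Inst → Prop) : Prop :=
  ∃ (p : Prog) (time g : Polynomial ℕ), ∀ (I : Q.Inst) (d : Data), Q.Encodes I d →
    ∃ (I' : Q.Inst) (d' : Data) (t : ℕ),
      Runs p d d' t ∧ t ≤ time.eval d.size ∧ Q.Encodes I' d' ∧
      (Q.Yes I ↔ Q.Yes I') ∧
      d'.size + Q.param I' ≤ g.eval (Q.param I) ∧
      Bound (Q.param I) I'

end TestCoverKernel

namespace TestCoverKernel

/-! ### Polynomial-time functions between encoded types -/

/-! Call an edge removable (`white`) if it is not black and the other edges still form a test cover.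
An edge left out of a solution is removable, so a solution amounts to a set of at least `k`
removable edges that can be deleted together (`solvable_iff`).

Many removable edges force a solution. A vertex has at most `(s + 1) * r` neighbours separated from
it by at most `s` edges (`exists_bounded_neighbourhood`), so each edge conflicts with boundedly many
others and a greedy choice gives `k` pairwise conflict-free edges. For removable edges without a
pendant vertex these can be deleted together, which bounds their number when there is no solution
(`card_innerWhite_le`). A removable edge with a pendant vertex is either far, or can be traced back
to one without, through an adjacent pair with few separators (`card_white_le_of_not_far`). If a far
one exists, it can be deleted in addition to any solution that keeps all vertices covered. An
isolated vertex enforces such covering, so it is added and `k` drops by one (`solvable_insert_iff`);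
afterwards no removable edge has a pendant vertex. Hence either the answer is yes or there are at
most `whiteBound r k` removable edges (`solvable_of_whiteBound_lt`).

The unremovable edges `P` matter only through the classes of vertices they do not separate. Classes
disjoint from all removable edges are dropped, apart from the class of vertices in no edge of `P`.
Every other remaining class lies inside an edge of `P`, so it has at most `r` vertices and can
itself become a black edge, with a small gadget attached if there is room (`coversOn_red_iff`,
`solvable_red_iff`). A class has at most one vertex outside the removable edges, so the new instance
has size linear in `r` times the number of removable edges (`card_redVertices_le`,
`card_redEdges_le`).

Without black edges in the input the same construction works, because every new black edge is the
only separator of some pair and so lies in every solution (`not_coversOn_erase_redBlack`,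
`solvable_empty_iff`). For `r = 2` this needs an isolated vertex, which the first stage guarantees
whenever a gadget occurs (`exists_far_of_graph`).

The algorithm is a function on lists built from operations closed under `PolyTime`, all recursion
being folding (`PolyTime.foldl_aux`); its output is renamed to vertices `0, …, n - 1`. -/

theorem polynomial_eval_mono (P : Polynomial ℕ) : Monotone fun x : ℕ => P.eval x := by
  intro a b h
  simp only [Polynomial.eval_eq_sum_range]
  exact Finset.sum_le_sum fun i _ => Nat.mul_le_mul_left _ (Nat.pow_le_pow_left h i)

theorem Data.size_pos (d : Data) : 1 ≤ d.size := by
  cases d <;> simp [Data.size]; omega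

/-- Bounding the result by the cost is what makes polynomial time closed under composition. -/
theorem Runs.size_le {p : Prog} {x y : Data} {t : ℕ} (h : Runs p x y t) : y.size ≤ t := by
  induction h with
  | skip => exact le_rfl
  | nil x => exact x.size_pos
  | head x => cases x <;> simp [Data.head, Data.size]; omega
  | tail x => cases x <;> simp [Data.tail, Data.size]
  | pair _ _ h₁ h₂ => rename_i x _ _ _ _ _ _; have := x.size_pos; simp only [Data.size]; omega
  | seq => omega
  | ite_true => omega
  | ite_false => omega
  | loop_stop => omega
  | loop_step => omega

/-- Types whose members are encoded as data. -/
class Enc (α : Type) where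
  enc : α → Data

open Enc

instance : Enc Unit := ⟨fun _ => .nil⟩
instance : Enc Bool := ⟨fun b => if b then .node .nil .nil else .nil⟩
instance : Enc ℕ := ⟨encNat⟩
instance {α β : Type} [Enc α] [Enc β] : Enc (α × β) := ⟨fun p => .node (enc p.1) (enc p.2)⟩
instance {α : Type} [Enc α] : Enc (List α) := ⟨fun l => encList (l.map enc)⟩

/-- The size of the encoding. -/
def encSize {α : Type} [Enc α] (a : α) : ℕ := (enc a).size

section

variable {α β γ δ : Type} [Enc α] [Enc β] [Enc γ] [Enc δ]

theorem encSize_pos (a : α) : 1 ≤ encSize a := Data.size_pos _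

@[simp] theorem encSize_prod (p : α × β) : encSize p = 1 + encSize p.1 + encSize p.2 := rfl

@[simp] theorem encSize_nil : encSize ([] : List α) = 1 := rfl

@[simp] theorem encSize_cons (a : α) (l : List α) :
    encSize (a :: l) = 1 + encSize a + encSize l := rfl

theorem encSize_append (l m : List α) : encSize (l ++ m) + 1 = encSize l + encSize m := by
  induction l with
  | nil => simp; omega
  | cons a l ih => simp only [List.cons_append, encSize_cons]; omega

theorem length_lt_encSize (l : List α) : l.length < encSize l := by
  induction l with
  | nil => simp
  | cons b l ih => simp; omega

theorem encSize_nat (n : ℕ) : encSize n = 2 * n + 1 := by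
  induction n with
  | zero => rfl
  | succ n ih =>
    change 1 + 1 + encSize n = _
    omega

theorem encSize_bool (b : Bool) : encSize b ≤ 3 := by
  cases b <;> decide

/-- `f` is computed by a program in polynomial time. -/
def PolyTime (f : α → β) : Prop :=
  ∃ (p : Prog) (T : Polynomial ℕ), ∀ a, ∃ t ≤ T.eval (encSize a), Runs p (enc a) (enc (f a)) t

theorem PolyTime.size_le {f : α → β} (hf : PolyTime f) :
    ∃ T : Polynomial ℕ, ∀ a, encSize (f a) ≤ T.eval (encSize a) := by
  obtain ⟨p, T, h⟩ := hf
  refine ⟨T, fun a => ?_⟩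
  obtain ⟨t, ht, hr⟩ := h a
  exact hr.size_le.trans ht

theorem PolyTime.of_eq {f g : α → β} (hf : PolyTime f) (h : ∀ a, f a = g a) : PolyTime g :=
  funext h ▸ hf

theorem PolyTime.id : PolyTime (fun a : α => a) :=
  ⟨.skip, Polynomial.X, fun a => ⟨_, by simp [encSize], .skip _⟩⟩

theorem PolyTime.comp {g : β → γ} {f : α → β} (hg : PolyTime g) (hf : PolyTime f) :
    PolyTime (fun a => g (f a)) := by
  obtain ⟨p, T, hp⟩ := hf
  obtain ⟨q, U, hq⟩ := hg
  refine ⟨.seq p q, Polynomial.X + T + U.comp T, fun a => ?_⟩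
  obtain ⟨t, ht, hr⟩ := hp a
  obtain ⟨u, hu, hs⟩ := hq (f a)
  refine ⟨_, ?_, hr.seq hs⟩
  have := polynomial_eval_mono U (hr.size_le.trans ht)
  simp only [Polynomial.eval_add, Polynomial.eval_X, Polynomial.eval_comp]
  change _ ≤ _ at this
  simp only [encSize] at *
  omega

theorem PolyTime.of_enc_eq {f : α → β} (h : ∀ a, enc (f a) = enc a) : PolyTime f :=
  ⟨.skip, Polynomial.X, fun a => ⟨(enc a).size, le_of_eq (by simp [encSize]), by rw [h]; exact .skip _⟩⟩

theorem PolyTime.of_enc_head {f : α → β} (h : ∀ a, enc (f a) = (enc a).head) : PolyTime f :=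
  ⟨.head, Polynomial.X, fun a => ⟨(enc a).size, le_of_eq (by simp [encSize]), by rw [h]; exact .head _⟩⟩

theorem PolyTime.of_enc_tail {f : α → β} (h : ∀ a, enc (f a) = (enc a).tail) : PolyTime f :=
  ⟨.tail, Polynomial.X, fun a => ⟨(enc a).size, le_of_eq (by simp [encSize]), by rw [h]; exact .tail _⟩⟩

/-- Pairs, `::` and successor are all encoded by `Data.node`, so this one rule covers them. -/
theorem PolyTime.of_enc_node {h : α → β} {f : α → γ} {g : α → δ} (hf : PolyTime f)
    (hg : PolyTime g) (hh : ∀ a, enc (h a) = .node (enc (f a)) (enc (g a))) : PolyTime h := by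
  obtain ⟨p, T, hp⟩ := hf
  obtain ⟨q, U, hq⟩ := hg
  refine ⟨.pair p q, Polynomial.X + T + U, fun a => ?_⟩
  obtain ⟨t, ht, hr⟩ := hp a
  obtain ⟨u, hu, hs⟩ := hq a
  refine ⟨_, ?_, by rw [hh]; exact hr.pair hs⟩
  simp only [Polynomial.eval_add, Polynomial.eval_X]
  simp only [encSize] at *
  omega

theorem exists_const_prog (d : Data) : ∃ (p : Prog) (T : Polynomial ℕ), ∀ x : Data,
    ∃ t ≤ T.eval x.size, Runs p x d t := by
  induction d with
  | nil => exact ⟨.nil, Polynomial.X, fun x => ⟨_, by simp, .nil x⟩⟩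
  | node a b iha ihb =>
    obtain ⟨p, T, hp⟩ := iha
    obtain ⟨q, U, hq⟩ := ihb
    refine ⟨.pair p q, Polynomial.X + T + U, fun x => ?_⟩
    obtain ⟨t, ht, hr⟩ := hp x
    obtain ⟨u, hu, hs⟩ := hq x
    refine ⟨_, ?_, hr.pair hs⟩
    simp only [Polynomial.eval_add, Polynomial.eval_X]
    omega

theorem PolyTime.const (b : β) : PolyTime (fun _ : α => b) := by
  obtain ⟨p, T, h⟩ := exists_const_prog (enc b)
  exact ⟨p, T, fun a => h _⟩

theorem PolyTime.pair {f : α → β} {g : α → γ} (hf : PolyTime f) (hg : PolyTime g) :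
    PolyTime (fun a => (f a, g a)) := hf.of_enc_node hg fun _ => rfl

theorem PolyTime.fst {f : α → β × γ} (hf : PolyTime f) : PolyTime (fun a => (f a).1) :=
  (PolyTime.of_enc_head (f := (Prod.fst : β × γ → β)) fun _ => rfl).comp hf

theorem PolyTime.snd {f : α → β × γ} (hf : PolyTime f) : PolyTime (fun a => (f a).2) :=
  (PolyTime.of_enc_tail (f := (Prod.snd : β × γ → γ)) fun _ => rfl).comp hf

theorem PolyTime.cons {f : α → β} {g : α → List β} (hf : PolyTime f) (hg : PolyTime g) :
    PolyTime (fun a => f a :: g a) := hf.of_enc_node hg fun _ => rfl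

theorem PolyTime.succ {f : α → ℕ} (hf : PolyTime f) : PolyTime (fun a => f a + 1) :=
  (PolyTime.const ()).of_enc_node hf fun _ => rfl

theorem PolyTime.pred {f : α → ℕ} (hf : PolyTime f) : PolyTime (fun a => f a - 1) :=
  (PolyTime.of_enc_tail (f := fun n : ℕ => n - 1) fun n => by cases n <;> rfl).comp hf

/-- A unary number and a list of units have the same encoding; arithmetic below is list manipulation
through this identification. -/
theorem PolyTime.replicate {f : α → ℕ} (hf : PolyTime f) :
    PolyTime (fun a => List.replicate (f a) ()) :=
  (PolyTime.of_enc_eq (f := fun n : ℕ => List.replicate n ()) fun n => by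
    induction n with
    | zero => rfl
    | succ n ih => exact congrArg (Data.node .nil) ih).comp hf

theorem PolyTime.cond {b : α → Bool} {f g : α → β} (hb : PolyTime b) (hf : PolyTime f)
    (hg : PolyTime g) : PolyTime (fun a => if b a then f a else g a) := by
  obtain ⟨c, S, hc⟩ := hb
  obtain ⟨p, T, hp⟩ := hf
  obtain ⟨q, U, hq⟩ := hg
  refine ⟨.ite c p q, Polynomial.X + S + T + U, fun a => ?_⟩
  obtain ⟨s, hs, hcr⟩ := hc a
  obtain ⟨t, ht, hr⟩ := hp a
  obtain ⟨u, hu, hqr⟩ := hq a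
  simp only [Polynomial.eval_add, Polynomial.eval_X]
  cases h : b a
  · rw [h] at hcr
    refine ⟨_, ?_, .ite_false hcr hqr⟩
    simp only [encSize] at *
    omega
  · rw [h] at hcr
    refine ⟨_, ?_, .ite_true hcr (by simp [enc]) hr⟩
    simp only [encSize] at *
    omega

theorem PolyTime.not {b : α → Bool} (hb : PolyTime b) : PolyTime (fun a => !b a) := by
  refine (hb.cond (PolyTime.const false) (PolyTime.const true)).of_eq fun a => ?_
  cases b a <;> rfl

theorem PolyTime.and {b c : α → Bool} (hb : PolyTime b) (hc : PolyTime c) :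
    PolyTime (fun a => b a && c a) := by
  refine (hb.cond hc (PolyTime.const false)).of_eq fun a => ?_
  cases b a <;> rfl

theorem PolyTime.or {b c : α → Bool} (hb : PolyTime b) (hc : PolyTime c) :
    PolyTime (fun a => b a || c a) := by
  refine (hb.cond (PolyTime.const true) hc).of_eq fun a => ?_
  cases b a <;> rfl

theorem PolyTime.beqBool {b c : α → Bool} (hb : PolyTime b) (hc : PolyTime c) :
    PolyTime (fun a => b a == c a) := by
  refine (hb.cond hc hc.not).of_eq fun a => ?_
  cases b a <;> cases c a <;> rfl

theorem PolyTime.ne_zero {f : α → ℕ} (hf : PolyTime f) : PolyTime (fun a => f a != 0) := by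
  have h : PolyTime (fun d : ℕ => d != 0) := by
    -- The input size is charged once for `ite`, once for the test and up to three times for the
    -- pair.
    refine ⟨.ite .skip (.pair .nil .nil) .nil, Polynomial.C 5 * Polynomial.X, fun n => ?_⟩
    have h0 := encSize_pos n
    simp only [Polynomial.eval_mul, Polynomial.eval_C, Polynomial.eval_X]
    cases n with
    | zero => exact ⟨_, by simp only [encSize]; omega, .ite_false (.skip _) (.nil _)⟩
    | succ n =>
      exact ⟨_, by simp only [encSize]; omega,
        .ite_true (.skip _) (by simp [enc, encNat]) ((Runs.nil _).pair (.nil _))⟩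
  exact h.comp hf

/-- Folding over a list is polynomial-time if the step is and the size of the result is
polynomially bounded. -/
theorem PolyTime.foldl_aux {s : γ × α × β → β} (hs : PolyTime s)
    (hb : ∃ B : Polynomial ℕ, ∀ (c : γ) (l : List α) (b : β),
      encSize (l.foldl (fun b a => s (c, a, b)) b) ≤ B.eval (encSize (c, l, b))) :
    PolyTime (fun x : γ × List α × β => x.2.1.foldl (fun b a => s (x.1, a, b)) x.2.2) := by
  -- A nonempty list `a :: l` is encoded like the pair `(a, l)`, so the loop body takes its input in
  -- that form.
  have hbody : PolyTime (fun d : γ × (α × List α) × β =>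
      (d.1, d.2.1.2, s (d.1, d.2.1.1, d.2.2))) := by
    refine .pair (.fst .id) (.pair (.snd (.fst (.snd .id))) (hs.comp ?_))
    exact .pair (.fst .id) (.pair (.fst (.fst (.snd .id))) (.snd (.snd .id)))
  obtain ⟨p, T, hp⟩ := hbody
  obtain ⟨B, hB⟩ := hb
  -- `Y` bounds the size of every loop state and `D` the cost of an iteration; the factor 10 leaves
  -- slack for the tests.
  let Y : Polynomial ℕ := Polynomial.C 3 * Polynomial.X + B
  let D : Polynomial ℕ := Polynomial.C 10 * Y + T.comp Y
  -- The state is `(c, remaining list, accumulator)`: `tail` then `head` reads the remaining list,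
  -- whose encoding is `nil` exactly when it is empty, and the final two `tail`s extract the
  -- accumulator.
  refine ⟨.seq (.loop (.seq .tail .head) p) (.seq .tail .tail),
    Polynomial.C 10 * Y + (Polynomial.X + Polynomial.C 1) * D, ?_⟩
  rintro ⟨c, l₀, b₀⟩
  set X := encSize (c, l₀, b₀) with hX
  -- Invariant: the accumulator is the fold over the consumed prefix `pre`, so `hB` applied to `pre`
  -- bounds every intermediate state.
  have key : ∀ (l : List α) (b : β) (pre : List α), l₀ = pre ++ l →
      b = pre.foldl (fun b a => s (c, a, b)) b₀ →
      ∃ t ≤ (l.length + 1) * D.eval X, Runs (.loop (.seq .tail .head) p) (enc (c, l, b))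
        (enc (c, ([] : List α), l₀.foldl (fun b a => s (c, a, b)) b₀)) t := by
    intro l
    induction l with
    | nil =>
      intro b pre h₁ h₂
      have h₃ : b = l₀.foldl (fun b a => s (c, a, b)) b₀ := by simp [h₁, h₂]
      rw [← h₃]
      have h₄ := hB c l₀ b₀
      rw [← h₃, ← hX] at h₄
      refine ⟨_, ?_, Runs.loop_stop (.seq (.tail _) (.head _))⟩
      have h₅ : encSize (c, ([] : List α), b) ≤ Y.eval X := by
        have : X = 1 + encSize c + (1 + encSize l₀ + encSize b₀) := by simp [hX]
        simp only [Y, Polynomial.eval_add, Polynomial.eval_mul, Polynomial.eval_C,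
          Polynomial.eval_X, encSize_prod, encSize_nil]
        omega
      have h₆ : ((enc (c, ([] : List α), b)).tail).size ≤ encSize (c, ([] : List α), b) := by
        change encSize (([] : List α), b) ≤ _
        simp
      simp only [D, Polynomial.eval_add, Polynomial.eval_mul, Polynomial.eval_C, encSize] at *
      simp only [List.length_nil]
      omega
    | cons a l ih =>
      intro b pre h₁ h₂
      obtain ⟨u, hu, hr⟩ := ih (s (c, a, b)) (pre ++ [a]) (by simp [h₁]) (by simp [h₂])
      obtain ⟨t, ht, hr'⟩ := hp (c, (a, l), b)
      have h₄ := hB c pre b₀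
      have h₄' : encSize (c, pre, b₀) ≤ X := by
        have := encSize_append pre (a :: l)
        have := encSize_pos (a :: l)
        simp only [hX, encSize_prod, h₁]
        omega
      replace h₄ := h₄.trans (polynomial_eval_mono B h₄')
      rw [← h₂] at h₄
      have h₅ : encSize (c, a :: l, b) ≤ Y.eval X := by
        have := encSize_append pre (a :: l)
        have := encSize_pos pre
        have : X = 1 + encSize c + (1 + encSize l₀ + encSize b₀) := by simp [hX]
        rw [h₁] at this
        simp only [Y, Polynomial.eval_add, Polynomial.eval_mul, Polynomial.eval_C,
          Polynomial.eval_X, encSize_prod] at h₄ ⊢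
        omega
      have h₆ := ht.trans (polynomial_eval_mono T h₅)
      refine ⟨_, ?_, .loop_step (.seq (.tail _) (.head _)) ?_ hr' hr⟩
      · have h₆' : ((enc (c, (a :: l : List α), b)).tail).size ≤ encSize (c, a :: l, b) := by
          change encSize ((a :: l : List α), b) ≤ _
          simp
        change encSize (c, a :: l, b) + (encSize (c, a :: l, b) + encSize (c, a :: l, b) +
          ((enc (c, (a :: l : List α), b)).tail).size) + t + u ≤ _
        have : D.eval X = 10 * Y.eval X + T.eval (Y.eval X) := by simp [D]
        simp only [List.length_cons]
        rw [add_mul _ 1 (D.eval X), one_mul]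
        change t ≤ T.eval (Y.eval X) at h₆
        omega
      · change encList _ ≠ _
        simp [encList]
  obtain ⟨t, ht, hr⟩ := key l₀ b₀ [] (by simp) (by simp)
  refine ⟨_, ?_, hr.seq ((Runs.tail _).seq (.tail _))⟩
  have h₇ : encSize (c, ([] : List α), l₀.foldl (fun b a => s (c, a, b)) b₀) ≤ Y.eval X := by
    have h₀ := hB c l₀ b₀
    rw [← hX] at h₀
    have : X = 1 + encSize c + (1 + encSize l₀ + encSize b₀) := by simp [hX]
    simp only [Y, Polynomial.eval_add, Polynomial.eval_mul, Polynomial.eval_C,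
      Polynomial.eval_X, encSize_prod, encSize_nil]
    omega
  have h₈ : ((enc (c, ([] : List α), l₀.foldl (fun b a => s (c, a, b)) b₀)).tail).size ≤
      encSize (c, ([] : List α), l₀.foldl (fun b a => s (c, a, b)) b₀) := by
    change encSize (([] : List α), l₀.foldl (fun b a => s (c, a, b)) b₀) ≤ _
    simp
  have h₉ : t ≤ (X + 1) * D.eval X := by
    refine ht.trans (Nat.mul_le_mul_right _ ?_)
    have := length_lt_encSize l₀
    have : X = 1 + encSize c + (1 + encSize l₀ + encSize b₀) := by simp [hX]
    omega
  have h₀ : X ≤ Y.eval X := by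
    simp only [Y, Polynomial.eval_add, Polynomial.eval_mul, Polynomial.eval_C, Polynomial.eval_X]
    omega
  change (enc (c, l₀, b₀)).size + t + _ ≤ _
  have hX' : (enc (c, l₀, b₀)).size = X := rfl
  simp only [Polynomial.eval_add, Polynomial.eval_mul, Polynomial.eval_C, Polynomial.eval_X]
  change encSize _ ≤ _ at h₇
  simp only [encSize] at *
  omega

/-- Folding over a list is polynomial-time if the step is and enlarges the accumulator by an
amount that does not depend on the accumulator. -/
theorem PolyTime.foldl {s : γ × α × β → β} {c : δ → γ} {l : δ → List α} {b : δ → β}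
    (hs : PolyTime s) (hc : PolyTime c) (hl : PolyTime l) (hb : PolyTime b)
    (hq : ∃ q : Polynomial ℕ, ∀ c a b, encSize (s (c, a, b)) ≤ encSize b + q.eval (encSize (c, a))) :
    PolyTime (fun x => (l x).foldl (fun b a => s (c x, a, b)) (b x)) := by
  refine (PolyTime.foldl_aux hs ?_).comp (hc.pair (hl.pair hb))
  obtain ⟨q, hq⟩ := hq
  refine ⟨Polynomial.X + Polynomial.X * q, fun c l b => ?_⟩
  have key : ∀ (l : List α) (b : β) (N : ℕ), encSize (c, l) ≤ N →
      encSize (l.foldl (fun b a => s (c, a, b)) b) ≤ encSize b + l.length * q.eval N := by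
    intro l
    induction l with
    | nil => intro b N _; simp
    | cons a l ih =>
      intro b N h
      simp only [encSize_prod, encSize_cons] at h
      have h₁ := ih (s (c, a, b)) N (by simp only [encSize_prod]; omega)
      have h₂ := hq c a b
      have h₃ := polynomial_eval_mono q (show encSize (c, a) ≤ N by
        simp only [encSize_prod]; omega)
      simp only [List.foldl_cons, List.length_cons, add_mul, one_mul] at *
      omega
  have h₁ := key l b (encSize (c, l, b)) (by simp; omega)
  have h₂ : l.length * q.eval (encSize (c, l, b)) ≤
      encSize (c, l, b) * q.eval (encSize (c, l, b)) := by
    refine Nat.mul_le_mul_right _ ?_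
    have := length_lt_encSize l
    simp; omega
  simp only [Polynomial.eval_add, Polynomial.eval_mul, Polynomial.eval_X]
  simp only [encSize_prod] at *
  omega

/-! ### Lists and unary arithmetic in polynomial time -/

theorem PolyTime.reverse {l : δ → List α} (hl : PolyTime l) :
    PolyTime (fun x => (l x).reverse) := by
  have := PolyTime.foldl (s := fun x : Unit × α × List α => x.2.1 :: x.2.2)
    (.cons (.fst (.snd .id)) (.snd (.snd .id))) (.const ()) hl (.const [])
    ⟨Polynomial.C 1 + Polynomial.X, fun c a b => by simp; omega⟩
  simpa using this

theorem PolyTime.map {l : δ → List α} {f : δ → α → β} (hl : PolyTime l)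
    (hf : PolyTime (fun p : δ × α => f p.1 p.2)) : PolyTime (fun x => (l x).map (f x)) := by
  obtain ⟨T, hT⟩ := hf.size_le
  have := PolyTime.foldl (s := fun x : δ × α × List β => f x.1 x.2.1 :: x.2.2)
    (.cons (hf.comp (.pair (.fst .id) (.fst (.snd .id)))) (.snd (.snd .id))) .id hl (.const [])
    ⟨Polynomial.C 1 + T, fun c a b => by
      have := hT (c, a)
      simp at *; omega⟩
  refine this.reverse.of_eq fun x => ?_
  have : ∀ (l : List α) (acc : List β), l.foldl (fun b a => f x a :: b) acc =
      (l.map (f x)).reverse ++ acc := by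
    intro l
    induction l with
    | nil => simp
    | cons a l ih => simp [ih]
  simp [this]

theorem PolyTime.append {l m : δ → List α} (hl : PolyTime l) (hm : PolyTime m) :
    PolyTime (fun x => l x ++ m x) := by
  have := PolyTime.foldl (s := fun x : Unit × α × List α => x.2.1 :: x.2.2)
    (.cons (.fst (.snd .id)) (.snd (.snd .id))) (.const ()) hl.reverse hm
    ⟨Polynomial.C 1 + Polynomial.X, fun c a b => by simp; omega⟩
  simpa using this

theorem PolyTime.flatMap {l : δ → List α} {f : δ → α → List β} (hl : PolyTime l)
    (hf : PolyTime (fun p : δ × α => f p.1 p.2)) : PolyTime (fun x => (l x).flatMap (f x)) := by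
  obtain ⟨T, hT⟩ := hf.size_le
  have := PolyTime.foldl (s := fun x : δ × α × List β => f x.1 x.2.1 ++ x.2.2)
    (.append (hf.comp (.pair (.fst .id) (.fst (.snd .id)))) (.snd (.snd .id))) .id hl.reverse
    (.const [])
    ⟨T, fun c a b => by
      have := hT (c, a)
      have := encSize_append (f c a) b
      simp at *; omega⟩
  refine this.of_eq fun x => ?_
  simp only [List.foldl_reverse]
  induction l x with
  | nil => simp
  | cons a l ih => simp [ih]

theorem PolyTime.any {l : δ → List α} {f : δ → α → Bool} (hl : PolyTime l)
    (hf : PolyTime (fun p : δ × α => f p.1 p.2)) : PolyTime (fun x => (l x).any (f x)) := by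
  have := PolyTime.foldl (s := fun x : δ × α × Bool => x.2.2 || f x.1 x.2.1)
    (.or (.snd (.snd .id)) (hf.comp (.pair (.fst .id) (.fst (.snd .id))))) .id hl (.const false)
    ⟨Polynomial.C 3, fun c a b => by
      have := encSize_bool (b || f c a)
      simp; omega⟩
  refine this.of_eq fun x => ?_
  have : ∀ (l : List α) (acc : Bool), l.foldl (fun b a => b || f x a) acc =
      (acc || l.any (f x)) := by
    intro l
    induction l with
    | nil => simp
    | cons a l ih => simp [ih, Bool.or_assoc]
  simp [this]

theorem PolyTime.all {l : δ → List α} {f : δ → α → Bool} (hl : PolyTime l)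
    (hf : PolyTime (fun p : δ × α => f p.1 p.2)) : PolyTime (fun x => (l x).all (f x)) := by
  simpa [← List.not_all_eq_any_not] using (hl.any (f := fun x a => !f x a) hf.not).not

theorem PolyTime.filter {l : δ → List α} {f : δ → α → Bool} (hl : PolyTime l)
    (hf : PolyTime (fun p : δ × α => f p.1 p.2)) : PolyTime (fun x => (l x).filter (f x)) := by
  have := hl.flatMap (f := fun x a => if f x a then [a] else [])
    (hf.cond (.cons (.snd .id) (.const [])) (.const []))
  refine this.of_eq fun x => ?_
  induction l x with
  | nil => simp
  | cons a l ih => cases h : f x a <;> simp [ih, h]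

theorem PolyTime.length {l : δ → List α} (hl : PolyTime l) : PolyTime (fun x => (l x).length) := by
  have h : PolyTime (fun l : List Unit => l.length) := .of_enc_eq fun l => by
    induction l with
    | nil => rfl
    | cons a l ih => exact congrArg (Data.node .nil) ih
  exact (h.comp (hl.map (f := fun _ _ => ()) (.const ()))).of_eq fun x => by simp

theorem PolyTime.add {f g : δ → ℕ} (hf : PolyTime f) (hg : PolyTime g) :
    PolyTime (fun x => f x + g x) :=
  (hf.replicate.append hg.replicate).length.of_eq fun x => by simp

theorem PolyTime.mul {f g : δ → ℕ} (hf : PolyTime f) (hg : PolyTime g) :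
    PolyTime (fun x => f x * g x) :=
  (hf.replicate.flatMap (f := fun x _ => List.replicate (g x) ())
    (hg.replicate.comp (.fst .id))).length.of_eq fun x => by simp

theorem PolyTime.pow {f : δ → ℕ} (hf : PolyTime f) (m : ℕ) : PolyTime (fun x => f x ^ m) := by
  induction m with
  | zero => exact .of_eq (.const 1) fun x => by simp
  | succ m ih => exact (ih.mul hf).of_eq fun x => by simp [pow_succ]

theorem PolyTime.sub {f g : δ → ℕ} (hf : PolyTime f) (hg : PolyTime g) :
    PolyTime (fun x => f x - g x) := by
  have := PolyTime.foldl (s := fun x : Unit × Unit × ℕ => x.2.2 - 1)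
    (.pred (.snd (.snd .id))) (.const ()) hg.replicate hf
    ⟨Polynomial.X, fun c a b => by simp only [encSize_nat]; omega⟩
  refine this.of_eq fun x => ?_
  induction g x with
  | zero => simp
  | succ m ih => rw [List.replicate_succ', List.foldl_append, ih]; simp; omega

theorem PolyTime.ltNat {f g : δ → ℕ} (hf : PolyTime f) (hg : PolyTime g) :
    PolyTime (fun x => decide (f x < g x)) :=
  (hg.sub hf).ne_zero.of_eq fun x => by
    rw [Bool.eq_iff_iff]; simp; omega

theorem PolyTime.beqNat {f g : δ → ℕ} (hf : PolyTime f) (hg : PolyTime g) :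
    PolyTime (fun x => f x == g x) :=
  ((hf.ltNat hg).or (hg.ltNat hf)).not.of_eq fun x => by
    rw [Bool.eq_iff_iff]; simp; omega

/-- The entries pushed come from the counter inside the accumulator, so `PolyTime.foldl` does not
apply. The fold is evaluated in closed form instead and its size bounded quadratically. -/
theorem PolyTime.range {f : δ → ℕ} (hf : PolyTime f) : PolyTime (fun x => List.range (f x)) := by
  let s : Unit × Unit × List ℕ × ℕ → List ℕ × ℕ := fun x => (x.2.2.2 :: x.2.2.1, x.2.2.2 + 1)
  have hs : PolyTime s :=
    .pair (.cons (.snd (.snd (.snd .id))) (.fst (.snd (.snd .id)))) (.succ (.snd (.snd (.snd .id))))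
  have key : ∀ (l : List Unit) (b : List ℕ × ℕ), (l.foldl (fun b a => s ((), a, b)) b) =
      (((List.range l.length).map (b.2 + ·)).reverse ++ b.1, b.2 + l.length) := by
    intro l
    induction l with
    | nil => simp
    | cons a l ih =>
      intro b
      simp only [List.foldl_cons, ih, s, List.length_cons]
      rw [List.range_succ_eq_map]
      simp [Function.comp_def, add_assoc, add_comm 1]
  have := (PolyTime.foldl_aux hs ⟨Polynomial.C 10 * (Polynomial.X + Polynomial.C 1) ^ 2, ?_⟩).comp
    ((PolyTime.const ()).pair (hf.replicate.pair (.const ([], 0))))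
  · refine this.fst.reverse.of_eq fun x => ?_
    simp [key]
  · rintro ⟨⟩ l ⟨b, m⟩
    rw [key]
    have h₁ : ∀ k, encSize ((List.range k).map (m + ·)).reverse ≤ 1 + k * (2 * (m + k) + 2) := by
      intro k
      induction k with
      | zero => simp
      | succ k ih =>
        rw [List.range_succ]
        simp only [List.map_append, List.map_cons, List.map_nil, List.reverse_append,
          List.reverse_cons, List.reverse_nil, List.nil_append, List.cons_append, encSize_cons,
          encSize_nat]
        nlinarith
    have h₂ := h₁ l.length
    have h₃ := length_lt_encSize l
    have h₄ := encSize_append (((List.range l.length).map (m + ·)).reverse) b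
    have h₅ := encSize_pos ()
    simp only [Polynomial.eval_add, Polynomial.eval_mul, Polynomial.eval_C, Polynomial.eval_X,
      Polynomial.eval_pow, encSize_prod, encSize_nat] at *
    generalize encSize l = L at *
    generalize l.length = k at *
    generalize encSize b = B at *
    generalize encSize () = u at *
    have h₆ : k * (2 * (m + k) + 2) ≤ L * (2 * (m + L) + 2) :=
      Nat.mul_le_mul (by omega) (by omega)
    nlinarith

theorem PolyTime.contains {l : δ → List ℕ} {f : δ → ℕ} (hf : PolyTime f) (hl : PolyTime l) :
    PolyTime (fun x => decide (f x ∈ l x)) :=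
  (hl.any (f := fun x a => f x == a) ((hf.comp (.fst .id)).beqNat (.snd .id))).of_eq fun x => by
    rw [Bool.eq_iff_iff]; simp

end

/-! ### The kernelization as a function on lists -/

/-- An instance as lists: number of vertices, parameter, edges, black edges. -/
abbrev RawInst := ℕ × ℕ × List (List ℕ) × List (List ℕ)

/-- `e` does not separate `x` and `y`. -/
def agrees (e : List ℕ) (x y : ℕ) : Bool := decide (x ∈ e) == decide (y ∈ e)

def unseparated (L : List (List ℕ)) (x y : ℕ) : Bool := L.all fun e => agrees e x y

def sameSet (e f : List ℕ) : Bool := e.all (fun x => decide (x ∈ f)) && f.all fun x => decide (x ∈ e)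

def hasSet (L : List (List ℕ)) (e : List ℕ) : Bool := L.any fun f => sameSet f e

def diffSet (L K : List (List ℕ)) : List (List ℕ) := L.filter fun e => !hasSet K e

def covers (L : List (List ℕ)) (x : ℕ) : Bool := L.any fun e => decide (x ∈ e)

def isCover (n : ℕ) (L : List (List ℕ)) : Bool :=
  (List.range n).all fun x => (List.range n).all fun y => (x == y) || !unseparated L x y

/-- The edges that are not black and can be removed one at a time. -/
def whiteEdges (n : ℕ) (L B : List (List ℕ)) : List (List ℕ) :=
  L.filter fun e => !hasSet B e && isCover n (diffSet L [e])

/-- The edge `e` contains a vertex that lies in no other edge. -/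
def hasPendant (L : List (List ℕ)) (e : List ℕ) : Bool :=
  e.any fun x => !covers (diffSet L [e]) x

def adjacent (L : List (List ℕ)) (x y : ℕ) : Bool :=
  L.any fun e => decide (x ∈ e) && decide (y ∈ e)

/-- Every pair of adjacent vertices that `e` separates is also separated by an edge of `R`. -/
def isFar (n : ℕ) (L R : List (List ℕ)) (e : List ℕ) : Bool :=
  e.all fun x => (List.range n).all fun y =>
    decide (y ∈ e) || !adjacent L x y || !unseparated R x y

/-- The first stage: if some removable edge with a pendant vertex is far from the other removable
edges, spend one unit of the parameter on it and add an isolated vertex. -/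
def addIsolated (I : RawInst) : RawInst :=
  let W := whiteEdges I.1 I.2.2.1 I.2.2.2
  let R := diffSet I.2.2.1 (W.filter fun e => !hasPendant I.2.2.1 e)
  if W.any fun e => hasPendant I.2.2.1 e && isFar I.1 I.2.2.1 (diffSet R [e]) e then
    (I.1 + 1, I.2.1 - 1, I.2.2)
  else I

/-- The vertices that are not separated from `x` by `P`. -/
def classOf (n : ℕ) (P : List (List ℕ)) (x : ℕ) : List ℕ :=
  (List.range n).filter (unseparated P x)

def isKept (n : ℕ) (P W : List (List ℕ)) (x : ℕ) : Bool :=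
  !covers P x || (classOf n P x).any (covers W)

/-- The least vertices of those classes of `P` that meet `W`. -/
def representatives (n : ℕ) (P W : List (List ℕ)) : List ℕ :=
  (List.range n).filter fun x => covers P x && isKept n P W x &&
    (List.range x).all fun y => !unseparated P x y

/-- Vertex `x` is copied to `5 * x`, which leaves `5 * x + 1, …, 5 * x + 4` for the gadget of the
class represented by `x`. A class of size `r` gets no gadget, as its edge has no room for a further
vertex. -/
def gadgetVertices (r c x : ℕ) : List ℕ :=
  if decide (c < r) then
    if r == 2 then [5 * x + 1, 5 * x + 2] else [5 * x + 1, 5 * x + 2, 5 * x + 3, 5 * x + 4]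
  else []

/-- The side edges are chosen so that every edge listed is the only separator of some pair. Edges
with three vertices are not available for `r = 2`; there an isolated vertex helps out. -/
def gadgetEdges (r x : ℕ) (C : List ℕ) : List (List ℕ) :=
  if decide (C.length < r) then
    if r == 2 then [(5 * x + 1) :: C.map (5 * ·), [5 * x + 1, 5 * x + 2]]
    else [(5 * x + 1) :: C.map (5 * ·), [5 * x + 1, 5 * x + 2, 5 * x + 3], [5 * x + 3, 5 * x + 4]]
  else [C.map (5 * ·)]

def newVertices (r n : ℕ) (P W : List (List ℕ)) : List ℕ :=
  ((List.range n).filter (isKept n P W)).map (5 * ·) ++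
    (representatives n P W).flatMap fun x => gadgetVertices r (classOf n P x).length x

def newBlack (r n : ℕ) (P W : List (List ℕ)) : List (List ℕ) :=
  (representatives n P W).flatMap fun x => gadgetEdges r x (classOf n P x)

def newWhite (W : List (List ℕ)) : List (List ℕ) := W.map fun e => e.map (5 * ·)

/-- On the members of a duplicate-free list this is the order-preserving renaming by `0, …, l.length
- 1`. -/
def rank (l : List ℕ) (v : ℕ) : ℕ := (l.filter fun a => decide (a < v)).length

def relabel (l : List ℕ) (L : List (List ℕ)) : List (List ℕ) := L.map fun e => e.map (rank l)

/-- The number of removable edges that guarantees a solution. -/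
def whiteBound (r k : ℕ) : ℕ := 10 * r ^ 6 * ((k - 1) * k ^ 5)

def shrink (r : ℕ) (I : RawInst) : RawInst :=
  let W := whiteEdges I.1 I.2.2.1 I.2.2.2
  let P := diffSet I.2.2.1 W
  -- With this many removable edges a solution exists, so the empty instance with parameter `0`, a
  -- Yes-instance, is returned.
  if decide (whiteBound r I.2.1 < W.length) then (0, 0, [], [])
  else
    let l := newVertices r I.1 P W
    let G := newBlack r I.1 P W
    (l.length, I.2.1, relabel l (newWhite W ++ G), relabel l G)

def kernelize (r : ℕ) (I : RawInst) : RawInst := shrink r (addIsolated I)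

/-! ### Polynomial running time of the kernelization -/

section

variable {δ : Type} [Enc δ]

open PolyTime

theorem PolyTime.agrees {e : δ → List ℕ} {x y : δ → ℕ} (he : PolyTime e) (hx : PolyTime x)
    (hy : PolyTime y) : PolyTime (fun d => agrees (e d) (x d) (y d)) :=
  (hx.contains he).beqBool (hy.contains he)

theorem PolyTime.unseparated {L : δ → List (List ℕ)} {x y : δ → ℕ} (hL : PolyTime L)
    (hx : PolyTime x) (hy : PolyTime y) : PolyTime (fun d => unseparated (L d) (x d) (y d)) :=
  hL.all (f := fun d e => TestCoverKernel.agrees e (x d) (y d))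
    (.agrees (.snd .id) (hx.comp (.fst .id)) (hy.comp (.fst .id)))

theorem PolyTime.sameSet {e f : δ → List ℕ} (he : PolyTime e) (hf : PolyTime f) :
    PolyTime (fun d => sameSet (e d) (f d)) :=
  (he.all (f := fun d x => decide (x ∈ f d)) (.contains (.snd .id) (hf.comp (.fst .id)))).and
    (hf.all (f := fun d x => decide (x ∈ e d)) (.contains (.snd .id) (he.comp (.fst .id))))

theorem PolyTime.hasSet {L : δ → List (List ℕ)} {e : δ → List ℕ} (hL : PolyTime L)
    (he : PolyTime e) : PolyTime (fun d => hasSet (L d) (e d)) :=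
  hL.any (f := fun d f => TestCoverKernel.sameSet f (e d)) (.sameSet (.snd .id) (he.comp (.fst .id)))

theorem PolyTime.diffSet {L K : δ → List (List ℕ)} (hL : PolyTime L) (hK : PolyTime K) :
    PolyTime (fun d => diffSet (L d) (K d)) :=
  hL.filter (f := fun d e => !TestCoverKernel.hasSet (K d) e)
    (.not (.hasSet (hK.comp (.fst .id)) (.snd .id)))

theorem PolyTime.covers {L : δ → List (List ℕ)} {x : δ → ℕ} (hL : PolyTime L) (hx : PolyTime x) :
    PolyTime (fun d => covers (L d) (x d)) :=
  hL.any (f := fun d e => decide (x d ∈ e)) (.contains (hx.comp (.fst .id)) (.snd .id))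

theorem PolyTime.isCover {n : δ → ℕ} {L : δ → List (List ℕ)} (hn : PolyTime n) (hL : PolyTime L) :
    PolyTime (fun d => isCover (n d) (L d)) :=
  hn.range.all (f := fun d x => (List.range (n d)).all fun y =>
      (x == y) || !TestCoverKernel.unseparated (L d) x y) <|
    (hn.comp (.fst .id)).range.all (f := fun p y =>
      (p.2 == y) || !TestCoverKernel.unseparated (L p.1) p.2 y) <|
    .or (.beqNat (.snd (.fst .id)) (.snd .id)) <|
    .not (.unseparated (hL.comp (.fst (.fst .id))) (.snd (.fst .id)) (.snd .id))

theorem PolyTime.whiteEdges {n : δ → ℕ} {L B : δ → List (List ℕ)} (hn : PolyTime n)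
    (hL : PolyTime L) (hB : PolyTime B) : PolyTime (fun d => whiteEdges (n d) (L d) (B d)) :=
  hL.filter (f := fun d e => !TestCoverKernel.hasSet (B d) e &&
      TestCoverKernel.isCover (n d) (TestCoverKernel.diffSet (L d) [e])) <|
    .and (.not (.hasSet (hB.comp (.fst .id)) (.snd .id))) <|
    .isCover (hn.comp (.fst .id)) (.diffSet (hL.comp (.fst .id)) (.cons (.snd .id) (.const [])))

theorem PolyTime.hasPendant {L : δ → List (List ℕ)} {e : δ → List ℕ} (hL : PolyTime L)
    (he : PolyTime e) : PolyTime (fun d => hasPendant (L d) (e d)) :=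
  he.any (f := fun d x => !TestCoverKernel.covers (TestCoverKernel.diffSet (L d) [e d]) x) <|
    .not (.covers (.diffSet (hL.comp (.fst .id)) (.cons (he.comp (.fst .id)) (.const []))) (.snd .id))

theorem PolyTime.adjacent {L : δ → List (List ℕ)} {x y : δ → ℕ} (hL : PolyTime L)
    (hx : PolyTime x) (hy : PolyTime y) : PolyTime (fun d => adjacent (L d) (x d) (y d)) :=
  hL.any (f := fun d e => decide (x d ∈ e) && decide (y d ∈ e)) <|
    .and (.contains (hx.comp (.fst .id)) (.snd .id)) (.contains (hy.comp (.fst .id)) (.snd .id))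

theorem PolyTime.isFar {n : δ → ℕ} {L R : δ → List (List ℕ)} {e : δ → List ℕ} (hn : PolyTime n)
    (hL : PolyTime L) (hR : PolyTime R) (he : PolyTime e) :
    PolyTime (fun d => isFar (n d) (L d) (R d) (e d)) :=
  he.all (f := fun d x => (List.range (n d)).all fun y => decide (y ∈ e d) ||
      !TestCoverKernel.adjacent (L d) x y || !TestCoverKernel.unseparated (R d) x y) <|
    (hn.comp (.fst .id)).range.all (f := fun p y => decide (y ∈ e p.1) ||
      !TestCoverKernel.adjacent (L p.1) p.2 y || !TestCoverKernel.unseparated (R p.1) p.2 y) <|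
    .or (.or (.contains (.snd .id) (he.comp (.fst (.fst .id))))
      (.not (.adjacent (hL.comp (.fst (.fst .id))) (.snd (.fst .id)) (.snd .id))))
      (.not (.unseparated (hR.comp (.fst (.fst .id))) (.snd (.fst .id)) (.snd .id)))

theorem polyTime_addIsolated : PolyTime addIsolated := by
  have hn : PolyTime (fun I : RawInst => I.1) := .fst .id
  have hL : PolyTime (fun I : RawInst => I.2.2.1) := .fst (.snd (.snd .id))
  have hB : PolyTime (fun I : RawInst => I.2.2.2) := .snd (.snd (.snd .id))
  have hW : PolyTime (fun I : RawInst => whiteEdges I.1 I.2.2.1 I.2.2.2) := .whiteEdges hn hL hB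
  have hR : PolyTime (fun I : RawInst => diffSet I.2.2.1
      ((whiteEdges I.1 I.2.2.1 I.2.2.2).filter fun e => !hasPendant I.2.2.1 e)) :=
    .diffSet hL (hW.filter (f := fun I e => !hasPendant I.2.2.1 e)
      (.not (.hasPendant (hL.comp (.fst .id)) (.snd .id))))
  refine .cond (hW.any (f := fun I e => hasPendant I.2.2.1 e && isFar I.1 I.2.2.1
      (diffSet (diffSet I.2.2.1
        ((whiteEdges I.1 I.2.2.1 I.2.2.2).filter fun e => !hasPendant I.2.2.1 e)) [e]) e) ?_)
    (.pair hn.succ (.pair (.pred (.fst (.snd .id))) (.snd (.snd .id)))) .id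
  exact .and (.hasPendant (hL.comp (.fst .id)) (.snd .id)) <|
    .isFar (hn.comp (.fst .id)) (hL.comp (.fst .id))
      (.diffSet (hR.comp (.fst .id)) (.cons (.snd .id) (.const []))) (.snd .id)

theorem PolyTime.classOf {n x : δ → ℕ} {P : δ → List (List ℕ)} (hn : PolyTime n) (hP : PolyTime P)
    (hx : PolyTime x) : PolyTime (fun d => classOf (n d) (P d) (x d)) :=
  hn.range.filter (f := fun d => TestCoverKernel.unseparated (P d) (x d))
    (.unseparated (hP.comp (.fst .id)) (hx.comp (.fst .id)) (.snd .id))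

theorem PolyTime.isKept {n x : δ → ℕ} {P W : δ → List (List ℕ)} (hn : PolyTime n)
    (hP : PolyTime P) (hW : PolyTime W) (hx : PolyTime x) :
    PolyTime (fun d => isKept (n d) (P d) (W d) (x d)) :=
  .or (.not (.covers hP hx)) <|
    (PolyTime.classOf hn hP hx).any (f := fun d => TestCoverKernel.covers (W d))
      (.covers (hW.comp (.fst .id)) (.snd .id))

theorem PolyTime.representatives {n : δ → ℕ} {P W : δ → List (List ℕ)} (hn : PolyTime n)
    (hP : PolyTime P) (hW : PolyTime W) :
    PolyTime (fun d => representatives (n d) (P d) (W d)) :=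
  hn.range.filter (f := fun d x => TestCoverKernel.covers (P d) x &&
      TestCoverKernel.isKept (n d) (P d) (W d) x &&
      (List.range x).all fun y => !TestCoverKernel.unseparated (P d) x y) <|
    .and (.and (.covers (hP.comp (.fst .id)) (.snd .id))
      (.isKept (hn.comp (.fst .id)) (hP.comp (.fst .id)) (hW.comp (.fst .id)) (.snd .id))) <|
    (PolyTime.range (.snd .id)).all
      (f := fun p y => !TestCoverKernel.unseparated (P p.1) p.2 y) <|
    .not (.unseparated (hP.comp (.fst (.fst .id))) (.snd (.fst .id)) (.snd .id))

theorem PolyTime.fiveMul {x : δ → ℕ} (hx : PolyTime x) : PolyTime (fun d => 5 * x d) :=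
  .mul (.const 5) hx

theorem PolyTime.mapFiveMul {l : δ → List ℕ} (hl : PolyTime l) :
    PolyTime (fun d => (l d).map (5 * ·)) :=
  hl.map (f := fun _ x => 5 * x) (.fiveMul (.snd .id))

theorem PolyTime.gadgetVertices (r : ℕ) {c x : δ → ℕ} (hc : PolyTime c) (hx : PolyTime x) :
    PolyTime (fun d => gadgetVertices r (c d) (x d)) := by
  have h : ∀ i, PolyTime (fun d => 5 * x d + i) := fun i => .add hx.fiveMul (.const i)
  refine .cond (.ltNat hc (.const r)) ?_ (.const [])
  by_cases hr : (r == 2) = true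
  · simp only [hr]
    exact .cons (h 1) (.cons (h 2) (.const []))
  · simp only [hr]
    exact .cons (h 1) (.cons (h 2) (.cons (h 3) (.cons (h 4) (.const []))))

theorem PolyTime.gadgetEdges (r : ℕ) {x : δ → ℕ} {C : δ → List ℕ} (hx : PolyTime x)
    (hC : PolyTime C) : PolyTime (fun d => gadgetEdges r (x d) (C d)) := by
  have h : ∀ i, PolyTime (fun d => 5 * x d + i) := fun i => .add hx.fiveMul (.const i)
  refine .cond (.ltNat hC.length (.const r)) ?_ (.cons hC.mapFiveMul (.const []))
  by_cases hr : (r == 2) = true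
  · simp only [hr]
    exact .cons (.cons (h 1) hC.mapFiveMul)
      (.cons (.cons (h 1) (.cons (h 2) (.const []))) (.const []))
  · simp only [hr]
    exact .cons (.cons (h 1) hC.mapFiveMul)
      (.cons (.cons (h 1) (.cons (h 2) (.cons (h 3) (.const []))))
      (.cons (.cons (h 3) (.cons (h 4) (.const []))) (.const [])))

theorem PolyTime.newVertices (r : ℕ) {n : δ → ℕ} {P W : δ → List (List ℕ)} (hn : PolyTime n)
    (hP : PolyTime P) (hW : PolyTime W) : PolyTime (fun d => newVertices r (n d) (P d) (W d)) :=
  .append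
    (.mapFiveMul (hn.range.filter (f := fun d => TestCoverKernel.isKept (n d) (P d) (W d))
      (.isKept (hn.comp (.fst .id)) (hP.comp (.fst .id)) (hW.comp (.fst .id)) (.snd .id)))) <|
    (PolyTime.representatives hn hP hW).flatMap
      (f := fun d x =>
        TestCoverKernel.gadgetVertices r (TestCoverKernel.classOf (n d) (P d) x).length x) <|
    .gadgetVertices r (.length (.classOf (hn.comp (.fst .id)) (hP.comp (.fst .id)) (.snd .id)))
      (.snd .id)

theorem PolyTime.newBlack (r : ℕ) {n : δ → ℕ} {P W : δ → List (List ℕ)} (hn : PolyTime n)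
    (hP : PolyTime P) (hW : PolyTime W) : PolyTime (fun d => newBlack r (n d) (P d) (W d)) :=
  (PolyTime.representatives hn hP hW).flatMap
      (f := fun d x => TestCoverKernel.gadgetEdges r x (TestCoverKernel.classOf (n d) (P d) x)) <|
    .gadgetEdges r (.snd .id) (.classOf (hn.comp (.fst .id)) (hP.comp (.fst .id)) (.snd .id))

theorem PolyTime.newWhite {W : δ → List (List ℕ)} (hW : PolyTime W) :
    PolyTime (fun d => newWhite (W d)) :=
  hW.map (f := fun (_ : δ) (e : List ℕ) => e.map (5 * ·)) (.mapFiveMul (.snd .id))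

theorem PolyTime.rank {l : δ → List ℕ} {v : δ → ℕ} (hl : PolyTime l) (hv : PolyTime v) :
    PolyTime (fun d => rank (l d) (v d)) :=
  .length (hl.filter (f := fun d a => decide (a < v d)) (.ltNat (.snd .id) (hv.comp (.fst .id))))

theorem PolyTime.relabel {l : δ → List ℕ} {L : δ → List (List ℕ)} (hl : PolyTime l)
    (hL : PolyTime L) : PolyTime (fun d => relabel (l d) (L d)) :=
  hL.map (f := fun d (e : List ℕ) => e.map (TestCoverKernel.rank (l d))) <|
    PolyTime.map (.snd .id) (f := fun p => TestCoverKernel.rank (l p.1))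
      (.rank (hl.comp (.fst (.fst .id))) (.snd .id))

theorem polyTime_shrink (r : ℕ) : PolyTime (shrink r) := by
  have hn : PolyTime (fun I : RawInst => I.1) := .fst .id
  have hk : PolyTime (fun I : RawInst => I.2.1) := .fst (.snd .id)
  have hL : PolyTime (fun I : RawInst => I.2.2.1) := .fst (.snd (.snd .id))
  have hB : PolyTime (fun I : RawInst => I.2.2.2) := .snd (.snd (.snd .id))
  have hW : PolyTime (fun I : RawInst => whiteEdges I.1 I.2.2.1 I.2.2.2) := .whiteEdges hn hL hB
  have hP := PolyTime.diffSet hL hW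
  have hN : PolyTime (fun I : RawInst => whiteBound r I.2.1) :=
    .mul (.const _) (.mul hk.pred (hk.pow 5))
  have hl := PolyTime.newVertices r hn hP hW
  have hG := PolyTime.newBlack r hn hP hW
  exact .cond (.ltNat hN hW.length) (.const _) <|
    .pair hl.length (.pair hk (.pair (.relabel hl (.append hW.newWhite hG)) (.relabel hl hG)))

theorem polyTime_kernelize (r : ℕ) : PolyTime (kernelize r) :=
  (polyTime_shrink r).comp polyTime_addIsolated

end

/-! ### Test covers on a finite set of vertices -/

section

set_option linter.unusedSectionVars false

variable {α : Type*} [DecidableEq α]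

/-- Exactly one of `x` and `y` lies in `e`. -/
def Splits (e : Finset α) (x y : α) : Prop := ¬(x ∈ e ↔ y ∈ e)

instance (x y : α) : DecidablePred fun e : Finset α => Splits e x y :=
  fun e => inferInstanceAs (Decidable ¬(x ∈ e ↔ y ∈ e))

theorem Splits.symm {e : Finset α} {x y : α} (h : Splits e x y) : Splits e y x :=
  fun h' => h h'.symm

theorem splits_comm {e : Finset α} {x y : α} : Splits e x y ↔ Splits e y x := ⟨.symm, .symm⟩

theorem Splits.trans_not {e : Finset α} {x y z : α} (h : Splits e x z) (h' : ¬Splits e x y) :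
    Splits e y z := by
  unfold Splits at *; tauto

/-- Every two vertices in `V` are separated by a member of `T`. -/
def CoversOn (V : Finset α) (T : Finset (Finset α)) : Prop :=
  ∀ x ∈ V, ∀ y ∈ V, x ≠ y → ∃ e ∈ T, Splits e x y

theorem CoversOn.mono {V : Finset α} {T T' : Finset (Finset α)} (h : CoversOn V T) (hT : T ⊆ T') :
    CoversOn V T' := fun x hx y hy hxy =>
  let ⟨e, he, hs⟩ := h x hx y hy hxy
  ⟨e, hT he, hs⟩

/-- There is a test cover that contains `B` and leaves out at least `k` edges. -/
def Solvable (V : Finset α) (E B : Finset (Finset α)) (k : ℕ) : Prop :=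
  ∃ T ⊆ E, B ⊆ T ∧ CoversOn V T ∧ T.card + k ≤ E.card

open Classical in
/-- The edges that are not black and can be removed one at a time. -/
noncomputable def white (V : Finset α) (E B : Finset (Finset α)) : Finset (Finset α) :=
  E.filter fun e => e ∉ B ∧ CoversOn V (E.erase e)

theorem mem_white {V : Finset α} {E B : Finset (Finset α)} {e : Finset α} :
    e ∈ white V E B ↔ e ∈ E ∧ e ∉ B ∧ CoversOn V (E.erase e) := by
  simp [white]

theorem white_subset {V : Finset α} {E B : Finset (Finset α)} : white V E B ⊆ E :=
  fun _ h => (mem_white.1 h).1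

theorem exists_ne_of_mem_white {V : Finset α} {E B : Finset (Finset α)} {e : Finset α}
    (he : e ∈ white V E B) {x y : α} (hx : x ∈ V) (hy : y ∈ V) (hxy : x ≠ y) :
    ∃ f ∈ E, f ≠ e ∧ Splits f x y := by
  obtain ⟨f, hf, hs⟩ := (mem_white.1 he).2.2 x hx y hy hxy
  exact ⟨f, Finset.mem_of_mem_erase hf, Finset.ne_of_mem_erase hf, hs⟩

/-- An edge outside a test cover `T ⊆ E` with `B ⊆ T` is removable, because `T` survives its
deletion. -/
theorem solvable_iff {V : Finset α} {E B : Finset (Finset α)} {k : ℕ} (hB : B ⊆ E) :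
    Solvable V E B k ↔ ∃ S ⊆ white V E B, CoversOn V (E \ S) ∧ k ≤ S.card := by
  constructor
  · rintro ⟨T, hT, hBT, hc, hk⟩
    refine ⟨E \ T, fun e he => ?_, ?_, ?_⟩
    · rw [Finset.mem_sdiff] at he
      refine mem_white.2 ⟨he.1, fun h => he.2 (hBT h), hc.mono fun f hf => ?_⟩
      exact Finset.mem_erase.2 ⟨fun h => he.2 (h ▸ hf), hT hf⟩
    · rwa [Finset.sdiff_sdiff_eq_self hT]
    · have := Finset.card_sdiff_add_card_eq_card hT
      omega
  · rintro ⟨S, hS, hc, hk⟩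
    refine ⟨E \ S, Finset.sdiff_subset, fun e he => ?_, hc, ?_⟩
    · exact Finset.mem_sdiff.2 ⟨hB he, fun h => (mem_white.1 (hS h)).2.1 he⟩
    · have := Finset.card_sdiff_add_card_eq_card (hS.trans white_subset)
      omega

theorem Solvable.zero {V : Finset α} {E B : Finset (Finset α)} (hB : B ⊆ E) (hE : CoversOn V E) :
    Solvable V E B 0 := ⟨E, subset_rfl, hB, hE, le_rfl⟩

/-! ### Pendant vertices and isolated vertices -/

/-- The edge `e` contains a vertex that lies in no other edge. -/
def Pendant (E : Finset (Finset α)) (e : Finset α) : Prop := ∃ x ∈ e, ∀ f ∈ E, x ∈ f → f = e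

open Classical in
/-- The removable edges without pendant vertices. -/
noncomputable def innerWhite (V : Finset α) (E B : Finset (Finset α)) : Finset (Finset α) :=
  (white V E B).filter fun e => ¬Pendant E e

theorem mem_innerWhite {V : Finset α} {E B : Finset (Finset α)} {e : Finset α} :
    e ∈ innerWhite V E B ↔ e ∈ white V E B ∧ ¬Pendant E e := by
  simp [innerWhite]

theorem innerWhite_subset {V : Finset α} {E B : Finset (Finset α)} :
    innerWhite V E B ⊆ white V E B := fun _ h => (mem_innerWhite.1 h).1

def Adjacent (E : Finset (Finset α)) (x y : α) : Prop := ∃ f ∈ E, x ∈ f ∧ y ∈ f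

theorem Adjacent.symm {E : Finset (Finset α)} {x y : α} (h : Adjacent E x y) : Adjacent E y x :=
  let ⟨f, hf, hx, hy⟩ := h
  ⟨f, hf, hy, hx⟩

/-- Every pair of adjacent vertices that `e` separates is also separated by an edge of `R`. -/
def Far (V : Finset α) (E R : Finset (Finset α)) (e : Finset α) : Prop :=
  ∀ x ∈ e, ∀ y ∈ V, y ∉ e → Adjacent E x y → ∃ f ∈ R, Splits f x y

/-- The isolated vertex `z` is separated from `x` exactly by the edges through `x`, so its presence
demands that every other vertex be covered. -/
theorem coversOn_insert_iff {V : Finset α} {T : Finset (Finset α)} {z : α} (hzV : z ∉ V)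
    (hz : ∀ e ∈ T, z ∉ e) :
    CoversOn (insert z V) T ↔ CoversOn V T ∧ ∀ x ∈ V, ∃ f ∈ T, x ∈ f := by
  constructor
  · refine fun h => ⟨fun x hx y hy => h x (by simp [hx]) y (by simp [hy]), fun x hx => ?_⟩
    obtain ⟨f, hf, hs⟩ := h x (by simp [hx]) z (by simp) (by rintro rfl; exact hzV hx)
    refine ⟨f, hf, ?_⟩
    have := hz f hf
    unfold Splits at hs
    tauto
  · rintro ⟨h, h'⟩ x hx y hy hxy
    rw [Finset.mem_insert] at hx hy
    rcases hx with rfl | hx <;> rcases hy with rfl | hy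
    · exact absurd rfl hxy
    · obtain ⟨f, hf, hyf⟩ := h' y hy
      exact ⟨f, hf, by have := hz f hf; unfold Splits; tauto⟩
    · obtain ⟨f, hf, hxf⟩ := h' x hx
      exact ⟨f, hf, by have := hz f hf; unfold Splits; tauto⟩
    · exact h x hx y hy hxy

/-- An isolated vertex rules out pendant vertices in removable edges. -/
theorem not_pendant_of_isolated {V : Finset α} {E B : Finset (Finset α)} {e : Finset α} {z : α}
    (hV : ∀ e ∈ E, e ⊆ V) (hzV : z ∈ V) (hz : ∀ f ∈ E, z ∉ f) (he : e ∈ white V E B) :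
    ¬Pendant E e := by
  rintro ⟨x, hx, h⟩
  have heE := white_subset he
  obtain ⟨f, hf, hfe, hs⟩ := exists_ne_of_mem_white he (hV e heE hx) hzV
    (by rintro rfl; exact hz e heE hx)
  have := hz f hf
  have := fun h' => hfe (h f hf h')
  unfold Splits at hs
  tauto

/-- Adding an isolated vertex costs exactly one unit of the parameter when a pendant removable
edge is far from the other ones. -/
theorem solvable_insert_iff {V : Finset α} {E B : Finset (Finset α)} {k : ℕ} {e : Finset α} {z : α}
    (hV : ∀ e ∈ E, e ⊆ V) (hE : CoversOn V E) (hB : B ⊆ E) (hz : z ∉ V) (he : e ∈ white V E B)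
    (hp : Pendant E e) (hf : Far V E ((E \ innerWhite V E B).erase e) e) :
    CoversOn (insert z V) E ∧ (Solvable V E B k ↔ Solvable (insert z V) E B (k - 1)) := by
  have hzE : ∀ f ∈ E, z ∉ f := fun f hf h => hz (hV f hf h)
  -- An isolated vertex already present would rule out the pendant vertex of `e`.
  have hiso : ∀ x ∈ V, ∃ f ∈ E, x ∈ f := by
    intro x hx
    by_contra h
    push Not at h
    exact not_pendant_of_isolated hV hx h he hp
  have hcov : CoversOn (insert z V) E := (coversOn_insert_iff hz hzE).2 ⟨hE, hiso⟩
  refine ⟨hcov, ?_⟩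
  constructor
  · rw [solvable_iff hB]
    rintro ⟨S, hS, hc, hk⟩
    -- A test cover leaves at most one vertex `u` uncovered; putting back one edge through `u` is
    -- the unit of the parameter that is lost.
    have key : ∃ S' ⊆ S, S.card ≤ S'.card + 1 ∧ ∀ x ∈ V, ∃ f ∈ E \ S', x ∈ f := by
      by_cases h : ∀ x ∈ V, ∃ f ∈ E \ S, x ∈ f
      · exact ⟨S, subset_rfl, by omega, h⟩
      · push Not at h
        obtain ⟨u, hu, hu'⟩ := h
        obtain ⟨g, hg, hug⟩ := hiso u hu
        refine ⟨S.erase g, Finset.erase_subset _ _, (by have := Finset.pred_card_le_card_erase (s := S) (a := g); omega), ?_⟩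
        intro x hx
        by_cases hxu : x = u
        · exact ⟨g, by simp [hg], hxu ▸ hug⟩
        · obtain ⟨f, hf, hs⟩ := hc x hx u hu hxu
          refine ⟨f, ?_, ?_⟩
          · simp only [Finset.mem_sdiff, Finset.mem_erase] at hf ⊢
            tauto
          · have := hu' f hf
            unfold Splits at hs
            tauto
    obtain ⟨S', hS', hcard, hx⟩ := key
    refine ⟨E \ S', Finset.sdiff_subset, fun f hf => ?_, ?_, ?_⟩
    · exact Finset.mem_sdiff.2 ⟨hB hf, fun h => (mem_white.1 (hS (hS' h))).2.1 hf⟩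
    · refine (coversOn_insert_iff hz fun f hf => hzE f (Finset.mem_sdiff.1 hf).1).2 ⟨?_, hx⟩
      exact hc.mono (Finset.sdiff_subset_sdiff subset_rfl hS')
    · have := Finset.card_sdiff_add_card_eq_card ((hS'.trans hS).trans white_subset)
      omega
  · rw [solvable_iff hB, solvable_iff hB]
    rintro ⟨S, hS, hc, hk⟩
    rw [coversOn_insert_iff hz fun f hf => hzE f (Finset.mem_sdiff.1 hf).1] at hc
    obtain ⟨hc, hx⟩ := hc
    -- Deleting an edge with a pendant vertex would leave that vertex uncovered. So `e` is not in
    -- `S`, and `Far` provides separators that `S` cannot contain.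
    have hSw : ∀ f ∈ S, f ∈ innerWhite V E B := by
      intro f hf
      have hfW := mem_white.1 (hS hf)
      refine mem_innerWhite.2 ⟨mem_white.2 ⟨hfW.1, hfW.2.1, ?_⟩, ?_⟩
      · exact fun x hx y hy => hfW.2.2 x (by simp [hx]) y (by simp [hy])
      · rintro ⟨x, hxf, h⟩
        obtain ⟨g, hg, hxg⟩ := hx x (hV f hfW.1 hxf)
        rw [Finset.mem_sdiff] at hg
        exact hg.2 (h g hg.1 hxg ▸ hf)
    have heS : e ∉ S := fun h => (mem_innerWhite.1 (hSw e h)).2 hp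
    refine ⟨insert e S, ?_, ?_, by rw [Finset.card_insert_of_notMem heS]; omega⟩
    · intro f hf
      rcases Finset.mem_insert.1 hf with rfl | hf
      · exact he
      · exact innerWhite_subset (hSw f hf)
    -- Adjacent pairs are handled by `Far`; for a nonadjacent pair any surviving edge through `y`
    -- avoids `x`.
    · have main : ∀ x ∈ V, ∀ y ∈ V, x ∈ e → y ∉ e → ∃ f ∈ E \ insert e S, Splits f x y := by
        intro x hxV y hyV hxe hye
        by_cases hadj : Adjacent E x y
        · obtain ⟨f, hfR, hs⟩ := hf x hxe y hyV hye hadj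
          refine ⟨f, ?_, hs⟩
          simp only [Finset.mem_erase, Finset.mem_sdiff, Finset.mem_insert] at hfR ⊢
          exact ⟨hfR.2.1, fun h => h.elim hfR.1 fun h => hfR.2.2 (hSw f h)⟩
        · obtain ⟨f, hfE, hyf⟩ := hx y hyV
          rw [Finset.mem_sdiff] at hfE
          refine ⟨f, ?_, ?_⟩
          · simp only [Finset.mem_sdiff, Finset.mem_insert]
            exact ⟨hfE.1, fun h => h.elim (fun h => hye (h ▸ hyf)) hfE.2⟩
          · have : x ∉ f := fun h => hadj ⟨f, hfE.1, h, hyf⟩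
            unfold Splits
            tauto
      intro x hxV y hyV hxy
      by_cases hs : Splits e x y
      · by_cases hxe : x ∈ e
        · exact main x hxV y hyV hxe (by unfold Splits at hs; tauto)
        · obtain ⟨f, hf, hs⟩ := main y hyV x hxV (by unfold Splits at hs; tauto) hxe
          exact ⟨f, hf, hs.symm⟩
      · obtain ⟨f, hf, hs'⟩ := hc x hxV y hyV hxy
        refine ⟨f, ?_, hs'⟩
        simp only [Finset.mem_sdiff, Finset.mem_insert] at hf ⊢
        exact ⟨hf.1, fun h => h.elim (fun h => hs (h ▸ hs')) hf.2⟩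

/-! ### The number of removable edges -/

/-- If `x` lies in at most `s + 1` edges, their union contains all its neighbours. Otherwise fix `s
+ 1` edges through `x`: each of them separates `x` from every vertex outside their union. -/
theorem exists_bounded_neighbourhood {E : Finset (Finset α)} {r : ℕ} (hr : ∀ e ∈ E, e.card ≤ r)
    (x : α) (s : ℕ) : ∃ Y : Finset α, Y.card ≤ (s + 1) * r ∧ ∀ y, Adjacent E x y →
      (E.filter fun f => Splits f x y).card ≤ s → y ∈ Y := by
  have key : ∀ A ⊆ E, A.card ≤ s + 1 → (A.biUnion id).card ≤ (s + 1) * r := fun A hA hs =>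
    (Finset.card_biUnion_le_card_mul A id r fun e he => hr e (hA he)).trans
      (Nat.mul_le_mul_right _ hs)
  by_cases h : (E.filter fun f => x ∈ f).card ≤ s + 1
  · refine ⟨_, key _ (Finset.filter_subset _ _) h, ?_⟩
    rintro y ⟨f, hf, hx, hy⟩ _
    exact Finset.mem_biUnion.2 ⟨f, by simp [hf, hx], hy⟩
  · obtain ⟨A, hA, hAs⟩ := Finset.exists_subset_card_eq (Nat.le_of_not_le h)
    refine ⟨_, key A (hA.trans (Finset.filter_subset _ _)) hAs.le, fun y _ hy => ?_⟩
    by_contra hn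
    have : A ⊆ E.filter fun f => Splits f x y := by
      intro f hf
      have hfx := Finset.mem_filter.1 (hA hf)
      have : y ∉ f := fun h => hn (Finset.mem_biUnion.2 ⟨f, hf, h⟩)
      exact Finset.mem_filter.2 ⟨hfx.1, by unfold Splits; tauto⟩
    have := Finset.card_le_card this
    omega

/-- A large set with a relation of bounded degree has a large independent subset. -/
theorem exists_independent {β : Type*} [DecidableEq β] {R : β → β → Prop}
    (hR : ∀ a b, R a b → R b a) {D : ℕ} (k : ℕ) (A : Finset β)
    (hD : ∀ a ∈ A, ∃ C : Finset β, C.card ≤ D ∧ a ∈ C ∧ ∀ b ∈ A, R a b → b ∈ C)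
    (hA : k * D < A.card) :
    ∃ S ⊆ A, S.card = k + 1 ∧ ∀ a ∈ S, ∀ b ∈ S, a ≠ b → ¬R a b := by
  induction k generalizing A with
  | zero =>
    obtain ⟨a, ha⟩ := Finset.card_pos.1 (by simpa using hA : 0 < A.card)
    exact ⟨{a}, by simpa using ha, by simp, by simp⟩
  | succ k ih =>
    obtain ⟨a, ha⟩ := Finset.card_pos.1 (by omega : 0 < A.card)
    -- Greedy choice: take `a`, discard its closed neighbourhood `C`, and continue in the rest.
    obtain ⟨C, hC, haC, hb⟩ := hD a ha
    have h₁ := Finset.le_card_sdiff C A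
    obtain ⟨S, hS, hcard, hi⟩ := ih (A \ C) (fun b hbA => by
      obtain ⟨C', h₁, h₂, h₃⟩ := hD b (Finset.mem_sdiff.1 hbA).1
      exact ⟨C', h₁, h₂, fun c hc => h₃ c (Finset.mem_sdiff.1 hc).1⟩) (by
      rw [add_mul, one_mul] at hA; omega)
    have haS : a ∉ S := fun h => (Finset.mem_sdiff.1 (hS h)).2 haC
    have hnR : ∀ b ∈ S, ¬R a b := fun b hbS h =>
      (Finset.mem_sdiff.1 (hS hbS)).2 (hb b (Finset.mem_sdiff.1 (hS hbS)).1 h)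
    refine ⟨insert a S, ?_, by rw [Finset.card_insert_of_notMem haS, hcard], ?_⟩
    · exact Finset.insert_subset ha (hS.trans Finset.sdiff_subset)
    · intro b hb c hc hbc
      rcases Finset.mem_insert.1 hb with rfl | hbS <;> rcases Finset.mem_insert.1 hc with rfl | hcS
      · exact absurd rfl hbc
      · exact hnR c hcS
      · exact fun h => hnR b hbS (hR _ _ h)
      · exact hi b hbS c hcS hbc

/-- Two edges conflict if removing both of them, together with at most `k - 2` further edges,
might leave two vertices unseparated. -/
def Conflict (E : Finset (Finset α)) (k : ℕ) (e f : Finset α) : Prop :=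
  (∃ x y, Adjacent E x y ∧ (E.filter fun g => Splits g x y).card ≤ k ∧
    Splits e x y ∧ Splits f x y) ∨
  ∃ x, x ∈ e ∧ x ∈ f ∧ (E.filter fun g => x ∈ g).card ≤ k

theorem Conflict.symm {E : Finset (Finset α)} {k : ℕ} {e f : Finset α} (h : Conflict E k e f) :
    Conflict E k f e := by
  rcases h with ⟨x, y, h₁, h₂, h₃, h₄⟩ | ⟨x, h₁, h₂, h₃⟩
  · exact .inl ⟨x, y, h₁, h₂, h₄, h₃⟩
  · exact .inr ⟨x, h₂, h₁, h₃⟩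

/-- In a conflict of the first kind one end of the pair lies in `e`: `r` choices for it, `(k + 1) *
r` for the other end, `k` for the separating edge. The second kind adds at most `k` edges for each
vertex of `e`, and the final `1` is `e` itself. -/
theorem exists_bounded_conflict {E : Finset (Finset α)} {r : ℕ} (hr : ∀ e ∈ E, e.card ≤ r) (k : ℕ)
    {e : Finset α} (he : e ∈ E) : ∃ C : Finset (Finset α),
      C.card ≤ r * ((k + 1) * r * k + k) + 1 ∧ e ∈ C ∧ ∀ f ∈ E, Conflict E k e f → f ∈ C := by
  choose Y hYc hY using fun x => exists_bounded_neighbourhood hr x k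
  -- Replacing the set by `∅` when it is too large makes the cardinality bound unconditional.
  let F : α → α → Finset (Finset α) := fun x y =>
    if (E.filter fun g => Splits g x y).card ≤ k then E.filter fun g => Splits g x y else ∅
  let G : α → Finset (Finset α) := fun x =>
    if (E.filter fun g => x ∈ g).card ≤ k then E.filter fun g => x ∈ g else ∅
  have hF : ∀ x y, (F x y).card ≤ k := by
    intro x y; dsimp only [F]; split_ifs with h
    · exact h
    · simp
  have hG : ∀ x, (G x).card ≤ k := by
    intro x; simp only [G]; split_ifs <;> simp [*]
  refine ⟨insert e (e.biUnion fun x => (Y x).biUnion (F x) ∪ G x), ?_, by simp, ?_⟩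
  · refine (Finset.card_insert_le _ _).trans (Nat.add_le_add_right ?_ 1)
    refine (Finset.card_biUnion_le_card_mul _ _ _ fun x _ => ?_).trans
      (Nat.mul_le_mul_right _ (hr e he))
    refine (Finset.card_union_le _ _).trans (Nat.add_le_add ?_ (hG x))
    exact (Finset.card_biUnion_le_card_mul _ _ _ fun y _ => hF x y).trans
      (Nat.mul_le_mul_right _ (hYc x))
  · intro f hf h
    refine Finset.mem_insert_of_mem (Finset.mem_biUnion.2 ?_)
    rcases h with ⟨x, y, h₁, h₂, h₃, h₄⟩ | ⟨x, h₁, h₂, h₃⟩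
    · have main : ∀ x y, Adjacent E x y → (E.filter fun g => Splits g x y).card ≤ k →
          Splits f x y → f ∈ (Y x).biUnion (F x) ∪ G x := by
        intro x y h₁ h₂ h₄
        refine Finset.mem_union_left _ (Finset.mem_biUnion.2 ⟨y, hY x y h₁ h₂, ?_⟩)
        simp only [F, h₂, if_true]
        exact Finset.mem_filter.2 ⟨hf, h₄⟩
      by_cases hxe : x ∈ e
      · exact ⟨x, hxe, main x y h₁ h₂ h₄⟩
      · refine ⟨y, by unfold Splits at h₃; tauto, main y x h₁.symm ?_ h₄.symm⟩
        simpa only [splits_comm (x := y)] using h₂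
    · refine ⟨x, h₁, Finset.mem_union_right _ ?_⟩
      simp only [G, h₃, if_true]
      exact Finset.mem_filter.2 ⟨hf, h₂⟩

/-- Otherwise there are `k` pairwise conflict-free edges, and deleting them all is harmless. Suppose
every separator of `x, y` were deleted. There are at most `k` of them, and at least two since each
is removable. If `x, y` are adjacent, two of these conflict. If not, let `p` be the end lying in a
separator `e`. Every edge through `p` separates the pair, so `p` has degree at most `k`; as `p` is
not pendant in `e`, another edge through `p` conflicts with `e`. -/
theorem card_innerWhite_le {V : Finset α} {E B : Finset (Finset α)} {r k : ℕ}
    (hr : ∀ e ∈ E, e.card ≤ r) (hE : CoversOn V E) (hB : B ⊆ E) (h : ¬Solvable V E B k) :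
    (innerWhite V E B).card ≤ (k - 1) * (r * ((k + 1) * r * k + k) + 1) := by
  by_contra hlt
  obtain _ | k := k
  · exact h (.zero hB hE)
  have hsub : innerWhite V E B ⊆ white V E B := innerWhite_subset
  obtain ⟨S, hS, hcard, hi⟩ := exists_independent (R := Conflict E (k + 1)) (fun _ _ => .symm) k
    (innerWhite V E B) (fun e he => by
      obtain ⟨C, h₁, h₂, h₃⟩ := exists_bounded_conflict hr (k + 1) (white_subset (hsub he))
      exact ⟨C, h₁, h₂, fun f hf => h₃ f (white_subset (hsub hf))⟩) (by simpa using hlt)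
  refine h ((solvable_iff hB).2 ⟨S, hS.trans hsub, ?_, hcard.ge⟩)
  intro x hx y hy hxy
  by_contra hn
  push Not at hn
  have hsep : (E.filter fun g => Splits g x y) ⊆ S := by
    intro g hg
    rw [Finset.mem_filter] at hg
    by_contra hgS
    exact hn g (Finset.mem_sdiff.2 ⟨hg.1, hgS⟩) hg.2
  have hsepc : (E.filter fun g => Splits g x y).card ≤ k + 1 := hcard ▸ Finset.card_le_card hsep
  obtain ⟨e, he, hes⟩ := hE x hx y hy hxy
  have heS : e ∈ S := hsep (Finset.mem_filter.2 ⟨he, hes⟩)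
  obtain ⟨f, hf, hfe, hfs⟩ := exists_ne_of_mem_white (hsub (hS heS)) hx hy hxy
  by_cases hadj : Adjacent E x y
  · exact hi e heS f (hsep (Finset.mem_filter.2 ⟨hf, hfs⟩)) hfe.symm
      (.inl ⟨x, y, hadj, hsepc, hes, hfs⟩)
  · have main : ∀ p, p ∈ e → (∀ g ∈ E, p ∈ g → Splits g x y) → False := by
      intro p hp hps
      have hnp := (mem_innerWhite.1 (hS heS)).2
      have : ∃ g ∈ E, p ∈ g ∧ g ≠ e := by
        by_contra hcon
        push Not at hcon
        exact hnp ⟨p, hp, hcon⟩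
      obtain ⟨g, hg, hpg, hge⟩ := this
      refine hi e heS g (hsep (Finset.mem_filter.2 ⟨hg, hps g hg hpg⟩)) hge.symm
        (.inr ⟨p, hp, hpg, le_trans (Finset.card_le_card fun g hg => ?_) hsepc⟩)
      rw [Finset.mem_filter] at hg ⊢
      exact ⟨hg.1, hps g hg.1 hg.2⟩
    have hnot : ∀ g ∈ E, ¬(x ∈ g ∧ y ∈ g) := fun g hg h => hadj ⟨g, hg, h⟩
    by_cases hxe : x ∈ e
    · exact main x hxe fun g hg hxg => by have := hnot g hg; unfold Splits; tauto
    · exact main y (by unfold Splits at hes; tauto) fun g hg hxg => by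
        have := hnot g hg; unfold Splits; tauto

/-- A pendant removable `e` that is not far separates an adjacent pair all of whose other separators
lie in `W₀`, the set of inner edges. Since `e` is removable, such a separator `e₀ ∈ W₀` exists. So
`e` is the only separator outside `W₀`, and it is determined by `e₀`, the end of the pair in `e₀`,
and one of at most `(W₀.card + 2) * r` partners of that end. -/
theorem card_white_le_of_not_far {V : Finset α} {E B : Finset (Finset α)} {r : ℕ}
    (hr : ∀ e ∈ E, e.card ≤ r) (hV : ∀ e ∈ E, e ⊆ V)
    (hf : ∀ e ∈ white V E B, Pendant E e → ¬Far V E ((E \ innerWhite V E B).erase e) e) :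
    (white V E B).card ≤ (innerWhite V E B).card +
      (innerWhite V E B).card * (r * (((innerWhite V E B).card + 2) * r)) := by
  classical
  set W₀ := innerWhite V E B with hW₀
  have hsub : W₀ ⊆ white V E B := innerWhite_subset
  choose Y hYc hY using fun x => exists_bounded_neighbourhood hr x (W₀.card + 1)
  let F : α → α → Finset (Finset α) := fun x y =>
    if ((E \ W₀).filter fun g => g ∈ white V E B ∧ Splits g x y).card ≤ 1 then
      (E \ W₀).filter fun g => g ∈ white V E B ∧ Splits g x y else ∅
  have hF : ∀ x y, (F x y).card ≤ 1 := by
    intro x y; dsimp only [F]; split_ifs with h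
    · exact h
    · simp
  have hcover : white V E B ⊆ W₀ ∪ W₀.biUnion fun e₀ => e₀.biUnion fun p => (Y p).biUnion (F p) := by
    intro e he
    by_cases hp : Pendant E e
    swap
    · exact Finset.mem_union_left _ (mem_innerWhite.2 ⟨he, hp⟩)
    have heW₀ : e ∉ W₀ := fun h => (mem_innerWhite.1 h).2 hp
    have hnf := hf e he hp
    unfold Far at hnf
    push Not at hnf
    obtain ⟨x, hxe, y, hyV, hye, hadj, hns⟩ := hnf
    have hxV := hV e (white_subset he) hxe
    have hse : Splits e x y := by unfold Splits; tauto
    have hsep : ∀ g ∈ E, Splits g x y → g ∈ insert e W₀ := by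
      intro g hg hgs
      by_contra hn
      rw [Finset.mem_insert, not_or] at hn
      exact hns g (Finset.mem_erase.2 ⟨hn.1, Finset.mem_sdiff.2 ⟨hg, hn.2⟩⟩) hgs
    have hsepc : (E.filter fun g => Splits g x y).card ≤ W₀.card + 1 := by
      refine (Finset.card_le_card fun g hg => ?_).trans (Finset.card_insert_le e W₀)
      rw [Finset.mem_filter] at hg
      exact hsep g hg.1 hg.2
    obtain ⟨e₀, he₀, hne, hs₀⟩ := exists_ne_of_mem_white he hxV hyV
      (by rintro rfl; exact hye hxe)
    have he₀W : e₀ ∈ W₀ := by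
      rcases Finset.mem_insert.1 (hsep e₀ he₀ hs₀) with h | h
      · exact absurd h hne
      · exact h
    refine Finset.mem_union_right _ (Finset.mem_biUnion.2 ⟨e₀, he₀W, Finset.mem_biUnion.2 ?_⟩)
    have main : ∀ p q, Adjacent E p q → Splits e p q →
        (∀ g, Splits g p q ↔ Splits g x y) → e ∈ (Y p).biUnion (F p) := by
      intro p q hadj hes hiff
      refine Finset.mem_biUnion.2 ⟨q, hY p q hadj (by simpa only [hiff] using hsepc), ?_⟩
      have hone : ((E \ W₀).filter fun g => g ∈ white V E B ∧ Splits g p q).card ≤ 1 := by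
        rw [Finset.card_le_one_iff_subset_singleton]
        refine ⟨e, fun g hg => ?_⟩
        rw [Finset.mem_filter, Finset.mem_sdiff, hiff] at hg
        have := hsep g hg.1.1 hg.2.2
        rw [Finset.mem_insert] at this
        simp only [Finset.mem_singleton]
        tauto
      simp only [F, hone, if_true]
      exact Finset.mem_filter.2 ⟨Finset.mem_sdiff.2 ⟨white_subset he, heW₀⟩, he, hes⟩
    by_cases hx₀ : x ∈ e₀
    · exact ⟨x, hx₀, main x y hadj hse fun _ => Iff.rfl⟩
    · exact ⟨y, by unfold Splits at hs₀; tauto, main y x hadj.symm hse.symm fun _ => splits_comm⟩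
  refine (Finset.card_le_card hcover).trans ((Finset.card_union_le _ _).trans ?_)
  refine Nat.add_le_add_left (Finset.card_biUnion_le_card_mul _ _ _ fun e₀ he₀ => ?_) _
  refine (Finset.card_biUnion_le_card_mul _ _ _ fun p _ => ?_).trans
    (Nat.mul_le_mul_right _ (hr e₀ (white_subset (hsub he₀))))
  refine (Finset.card_biUnion_le_card_mul _ _ _ fun q _ => hF p q).trans ?_
  rw [mul_one]
  exact hYc p

/-- Without a solution there are `w ≤ 3 * (k - 1) * r ^ 2 * k ^ 2` inner edges and at most `w + w *
r ^ 2 * (w + 2)` removable ones. In units of `r ^ 6 * (k - 1) * k ^ 5` the two summands contribute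
`1` and `9`, hence the factor 10 in `whiteBound`. -/
theorem solvable_of_whiteBound_lt {V : Finset α} {E B : Finset (Finset α)} {r k : ℕ} (hr₂ : 2 ≤ r)
    (hr : ∀ e ∈ E, e.card ≤ r) (hV : ∀ e ∈ E, e ⊆ V) (hE : CoversOn V E) (hB : B ⊆ E)
    (hf : ∀ e ∈ white V E B, Pendant E e → ¬Far V E ((E \ innerWhite V E B).erase e) e)
    (h : whiteBound r k < (white V E B).card) : Solvable V E B k := by
  by_contra hn
  have h₁ := card_innerWhite_le hr hE hB hn
  have h₂ := card_white_le_of_not_far hr hV hf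
  refine absurd h (not_lt.2 (h₂.trans ?_))
  generalize (innerWhite V E B).card = w at *
  unfold whiteBound
  obtain _ | j := k
  · simp at h₁
    simp [h₁]
  simp only [Nat.add_sub_cancel] at *
  have hD : r * ((j + 1 + 1) * r * (j + 1) + (j + 1)) + 1 ≤ 3 * (r ^ 2 * (j + 1) ^ 2) := by
    generalize hk : j + 1 = k at *
    have hk1 : 1 ≤ k := by omega
    have a₁ : r * k ≤ (r * k) ^ 2 := Nat.le_self_pow two_ne_zero _
    have a₂ : 2 ≤ r * k := by nlinarith
    have a₃ : r * r * k ≤ r * r * (k * k) := Nat.mul_le_mul_left _ (by nlinarith)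
    nlinarith
  set k := j + 1 with hk
  have hw : w ≤ j * (3 * (r ^ 2 * k ^ 2)) := h₁.trans (Nat.mul_le_mul_left _ hD)
  have hrk : 1 ≤ r ^ 2 * k ^ 2 := Nat.pos_of_ne_zero (by positivity)
  have hw2 : w + 2 ≤ 3 * (r ^ 2 * k ^ 3) := by
    have : 3 * (r ^ 2 * k ^ 3) = j * (3 * (r ^ 2 * k ^ 2)) + 3 * (r ^ 2 * k ^ 2) := by
      rw [hk]; ring
    omega
  have hk3 : 1 ≤ k ^ 3 := Nat.one_le_pow _ _ (by omega)
  have hr4 : 16 ≤ r ^ 4 := by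
    calc 16 = 2 ^ 4 := by norm_num
      _ ≤ r ^ 4 := Nat.pow_le_pow_left hr₂ 4
  have b₁ : w ≤ r ^ 6 * (j * k ^ 5) := by
    refine hw.trans ?_
    calc j * (3 * (r ^ 2 * k ^ 2)) = (3 * 1) * (j * r ^ 2 * k ^ 2) := by ring
      _ ≤ (r ^ 4 * k ^ 3) * (j * r ^ 2 * k ^ 2) :=
        Nat.mul_le_mul_right _ (Nat.mul_le_mul (by omega) hk3)
      _ = _ := by ring
  have b₂ : w * (r * ((w + 2) * r)) ≤ 9 * (r ^ 6 * (j * k ^ 5)) := by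
    calc w * (r * ((w + 2) * r))
        ≤ (j * (3 * (r ^ 2 * k ^ 2))) * (r * ((3 * (r ^ 2 * k ^ 3)) * r)) := by gcongr
      _ = _ := by ring
  calc w + w * (r * ((w + 2) * r)) ≤ r ^ 6 * (j * k ^ 5) + 9 * (r ^ 6 * (j * k ^ 5)) :=
        Nat.add_le_add b₁ b₂
    _ = _ := by ring

end

/-! ### The reduced instance -/

section

def Unsep (P : Finset (Finset ℕ)) (x y : ℕ) : Prop := ∀ e ∈ P, ¬Splits e x y

def Covered (P : Finset (Finset ℕ)) (x : ℕ) : Prop := ∃ e ∈ P, x ∈ e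

/-- This is a property of the class of `x`. By `kept_of_unsep` every class with at least two
vertices has it when `P = E \ W`, so a dropped class is a singleton already separated from all else
by `P`. -/
def Kept (V : Finset ℕ) (P W : Finset (Finset ℕ)) (x : ℕ) : Prop :=
  ¬Covered P x ∨ ∃ y ∈ V, Unsep P x y ∧ Covered W y

def IsRep (V : Finset ℕ) (P W : Finset (Finset ℕ)) (x : ℕ) : Prop :=
  x ∈ V ∧ Covered P x ∧ Kept V P W x ∧ ∀ y ∈ V, y < x → ¬Unsep P x y

open Classical in
noncomputable def classFinset (V : Finset ℕ) (P : Finset (Finset ℕ)) (x : ℕ) : Finset ℕ :=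
  V.filter (Unsep P x)

open Classical in
noncomputable def keptFinset (V : Finset ℕ) (P W : Finset (Finset ℕ)) : Finset ℕ :=
  V.filter (Kept V P W)

open Classical in
noncomputable def repFinset (V : Finset ℕ) (P W : Finset (Finset ℕ)) : Finset ℕ :=
  V.filter (IsRep V P W)

/-- The copy of a set of vertices. -/
def hat (e : Finset ℕ) : Finset ℕ := e.image (5 * ·)

def mainEdge (r x : ℕ) (C : Finset ℕ) : Finset ℕ :=
  if C.card < r then insert (5 * x + 1) (hat C) else hat C

def sideEdges (r x : ℕ) (C : Finset ℕ) : Finset (Finset ℕ) :=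
  if C.card < r then
    if r = 2 then {{5 * x + 1, 5 * x + 2}}
    else {{5 * x + 1, 5 * x + 2, 5 * x + 3}, {5 * x + 3, 5 * x + 4}}
  else ∅

def sideVertices (r c x : ℕ) : Finset ℕ :=
  if c < r then
    if r = 2 then {5 * x + 1, 5 * x + 2} else {5 * x + 1, 5 * x + 2, 5 * x + 3, 5 * x + 4}
  else ∅

noncomputable def redVertices (r : ℕ) (V : Finset ℕ) (P W : Finset (Finset ℕ)) : Finset ℕ :=
  hat (keptFinset V P W) ∪
    (repFinset V P W).biUnion fun x => sideVertices r (classFinset V P x).card x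

noncomputable def redBlack (r : ℕ) (V : Finset ℕ) (P W : Finset (Finset ℕ)) :
    Finset (Finset ℕ) :=
  (repFinset V P W).biUnion fun x =>
    insert (mainEdge r x (classFinset V P x)) (sideEdges r x (classFinset V P x))

def redWhite (W : Finset (Finset ℕ)) : Finset (Finset ℕ) := W.image hat

/-! ### Classes of vertices not separated by `P` -/

theorem Unsep.refl (P : Finset (Finset ℕ)) (x : ℕ) : Unsep P x x := fun _ _ h => h Iff.rfl

theorem Unsep.symm {P : Finset (Finset ℕ)} {x y : ℕ} (h : Unsep P x y) : Unsep P y x :=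
  fun e he hs => h e he hs.symm

theorem Unsep.trans {P : Finset (Finset ℕ)} {x y z : ℕ} (h : Unsep P x y) (h' : Unsep P y z) :
    Unsep P x z := fun e he hs => h' e he (hs.trans_not (h e he))

theorem Unsep.mem_iff {P : Finset (Finset ℕ)} {x y : ℕ} (h : Unsep P x y) {e : Finset ℕ}
    (he : e ∈ P) : x ∈ e ↔ y ∈ e := not_not.1 (h e he)

theorem Unsep.covered {P : Finset (Finset ℕ)} {x y : ℕ} (h : Unsep P x y) (hx : Covered P x) :
    Covered P y :=
  let ⟨e, he, hxe⟩ := hx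
  ⟨e, he, (h.mem_iff he).1 hxe⟩

theorem Unsep.of_not_covered {P : Finset (Finset ℕ)} {x y : ℕ} (hx : ¬Covered P x)
    (hy : ¬Covered P y) : Unsep P x y := fun e he hs =>
  hs ⟨fun h => absurd ⟨e, he, h⟩ hx, fun h => absurd ⟨e, he, h⟩ hy⟩

theorem Unsep.kept {V : Finset ℕ} {P W : Finset (Finset ℕ)} {x y : ℕ} (h : Unsep P x y)
    (hx : Kept V P W x) : Kept V P W y := by
  rcases hx with hx | ⟨z, hz, hxz, hW⟩
  · exact .inl fun hy => hx (h.symm.covered hy)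
  · exact .inr ⟨z, hz, h.symm.trans hxz, hW⟩

theorem mem_classFinset {V : Finset ℕ} {P : Finset (Finset ℕ)} {x y : ℕ} :
    y ∈ classFinset V P x ↔ y ∈ V ∧ Unsep P x y := by
  simp [classFinset]

theorem mem_keptFinset {V : Finset ℕ} {P W : Finset (Finset ℕ)} {x : ℕ} :
    x ∈ keptFinset V P W ↔ x ∈ V ∧ Kept V P W x := by
  simp [keptFinset]

theorem mem_repFinset {V : Finset ℕ} {P W : Finset (Finset ℕ)} {x : ℕ} :
    x ∈ repFinset V P W ↔ IsRep V P W x := by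
  simp only [repFinset, Finset.mem_filter, and_iff_right_iff_imp]
  exact fun h => h.1

/-! ### Copies of vertices, and gadgets -/

@[simp] theorem five_mul_mem_hat {e : Finset ℕ} {x : ℕ} : 5 * x ∈ hat e ↔ x ∈ e := by
  simp [hat]

theorem mem_hat {e : Finset ℕ} {v : ℕ} : v ∈ hat e ↔ ∃ x ∈ e, 5 * x = v := by
  simp [hat]

@[simp] theorem five_mul_add_notMem_hat {e : Finset ℕ} {x i : ℕ} (h₀ : 0 < i) (h₅ : i < 5) :
    5 * x + i ∉ hat e := by
  rw [mem_hat]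
  rintro ⟨y, _, h⟩
  omega

theorem hat_injective : Function.Injective hat :=
  Finset.image_injective fun a b (h : 5 * a = 5 * b) => by omega

theorem card_hat (e : Finset ℕ) : (hat e).card = e.card :=
  Finset.card_image_of_injective _ fun a b (h : 5 * a = 5 * b) => by omega

theorem hat_mem_redWhite {W : Finset (Finset ℕ)} {e : Finset ℕ} : hat e ∈ redWhite W ↔ e ∈ W :=
  hat_injective.mem_finset_image

theorem splits_hat {e : Finset ℕ} {x y : ℕ} : Splits (hat e) (5 * x) (5 * y) ↔ Splits e x y := by
  simp [Splits]

@[simp] theorem five_mul_mem_mainEdge {r x y : ℕ} {C : Finset ℕ} :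
    5 * y ∈ mainEdge r x C ↔ y ∈ C := by
  unfold mainEdge
  split_ifs
  · simp only [Finset.mem_insert, five_mul_mem_hat, or_iff_right_iff_imp]
    omega
  · simp

theorem five_mul_add_mem_mainEdge {r x y i : ℕ} {C : Finset ℕ} (h₀ : 0 < i) (h₅ : i < 5) :
    5 * y + i ∈ mainEdge r x C ↔ C.card < r ∧ y = x ∧ i = 1 := by
  unfold mainEdge
  split_ifs with h
  · simp only [Finset.mem_insert, five_mul_add_notMem_hat h₀ h₅, or_false, h, true_and]
    omega
  · simp [five_mul_add_notMem_hat h₀ h₅, h]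

theorem mem_sideEdges_two {r x : ℕ} {C e : Finset ℕ} (hr : r = 2) :
    e ∈ sideEdges r x C ↔ C.card < r ∧ e = {5 * x + 1, 5 * x + 2} := by
  unfold sideEdges; split_ifs with h <;> simp [h]

theorem mem_sideEdges {r x : ℕ} {C e : Finset ℕ} (hr : r ≠ 2) :
    e ∈ sideEdges r x C ↔ C.card < r ∧
      (e = {5 * x + 1, 5 * x + 2, 5 * x + 3} ∨ e = {5 * x + 3, 5 * x + 4}) := by
  unfold sideEdges; split_ifs with h <;> simp [h]

theorem five_mul_notMem_of_mem_sideEdges {r x y : ℕ} {C e : Finset ℕ} (he : e ∈ sideEdges r x C) :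
    5 * y ∉ e := by
  by_cases hr : r = 2
  · obtain ⟨-, rfl⟩ := (mem_sideEdges_two hr).1 he
    simp; omega
  · obtain ⟨-, rfl | rfl⟩ := (mem_sideEdges hr).1 he <;> simp <;> omega

theorem mem_sideVertices {r c x v : ℕ} : v ∈ sideVertices r c x →
    c < r ∧ ∃ i, 0 < i ∧ i < 5 ∧ (r = 2 → i < 3) ∧ v = 5 * x + i := by
  unfold sideVertices
  split_ifs with h h₂ <;> intro hv
  · simp only [Finset.mem_insert, Finset.mem_singleton] at hv
    rcases hv with rfl | rfl
    · exact ⟨h, 1, by simp⟩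
    · exact ⟨h, 2, by simp⟩
  · simp only [Finset.mem_insert, Finset.mem_singleton] at hv
    rcases hv with rfl | rfl | rfl | rfl
    · exact ⟨h, 1, by simp [h₂]⟩
    · exact ⟨h, 2, by simp [h₂]⟩
    · exact ⟨h, 3, by simp [h₂]⟩
    · exact ⟨h, 4, by simp [h₂]⟩
  · simp at hv

theorem mem_redVertices {r : ℕ} {V : Finset ℕ} {P W : Finset (Finset ℕ)} {v : ℕ} :
    v ∈ redVertices r V P W ↔ (∃ x ∈ V, Kept V P W x ∧ 5 * x = v) ∨
      ∃ x, IsRep V P W x ∧ v ∈ sideVertices r (classFinset V P x).card x := by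
  simp only [redVertices, Finset.mem_union, mem_hat, mem_keptFinset, Finset.mem_biUnion,
    mem_repFinset, and_assoc]

theorem mem_redBlack {r : ℕ} {V : Finset ℕ} {P W : Finset (Finset ℕ)} {e : Finset ℕ} :
    e ∈ redBlack r V P W ↔ ∃ x, IsRep V P W x ∧
      (e = mainEdge r x (classFinset V P x) ∨ e ∈ sideEdges r x (classFinset V P x)) := by
  simp only [redBlack, Finset.mem_biUnion, mem_repFinset, Finset.mem_insert]

theorem IsRep.eq_of_unsep {V : Finset ℕ} {P W : Finset (Finset ℕ)} {x y : ℕ} (hx : IsRep V P W x)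
    (hy : IsRep V P W y) (h : Unsep P x y) : x = y := by
  rcases lt_trichotomy x y with hlt | rfl | hlt
  · exact absurd h.symm (hy.2.2.2 x hx.1 hlt)
  · rfl
  · exact absurd h (hx.2.2.2 y hy.1 hlt)

theorem exists_isRep {V : Finset ℕ} {P W : Finset (Finset ℕ)} {x : ℕ} (hx : x ∈ V)
    (hP : Covered P x) (hk : Kept V P W x) : ∃ y, IsRep V P W y ∧ Unsep P x y := by
  have hne : (classFinset V P x).Nonempty := ⟨x, mem_classFinset.2 ⟨hx, .refl P x⟩⟩
  have hy := mem_classFinset.1 (Finset.min'_mem _ hne)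
  refine ⟨_, ⟨hy.1, hy.2.covered hP, hy.2.kept hk, fun z hz hlt hu => ?_⟩, hy.2⟩
  have := Finset.min'_le _ z (mem_classFinset.2 ⟨hz, hy.2.trans hu⟩)
  omega

theorem IsRep.card_class_le {V : Finset ℕ} {P W : Finset (Finset ℕ)} {x r : ℕ}
    (hx : IsRep V P W x) (hr : ∀ e ∈ P, e.card ≤ r) : (classFinset V P x).card ≤ r := by
  obtain ⟨e, he, hxe⟩ := hx.2.1
  refine (Finset.card_le_card fun y hy => ?_).trans (hr e he)
  exact ((mem_classFinset.1 hy).2.mem_iff he).1 hxe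

theorem IsRep.exists_white {V : Finset ℕ} {P W : Finset (Finset ℕ)} {x : ℕ}
    (hx : IsRep V P W x) : ∃ y ∈ V, Unsep P x y ∧ Covered W y :=
  hx.2.2.1.resolve_left fun h => h hx.2.1

/-- Black edges do not separate copies of vertices of the same class. -/
theorem not_splits_redBlack {r : ℕ} {V : Finset ℕ} {P W : Finset (Finset ℕ)} {e : Finset ℕ}
    (he : e ∈ redBlack r V P W) {x y : ℕ} (hx : x ∈ V) (hy : y ∈ V) (h : Unsep P x y) :
    ¬Splits e (5 * x) (5 * y) := by
  obtain ⟨z, hz, rfl | he⟩ := mem_redBlack.1 he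
  · unfold Splits
    rw [five_mul_mem_mainEdge, five_mul_mem_mainEdge, mem_classFinset, mem_classFinset]
    exact not_not.2 ⟨fun h' => ⟨hy, h'.2.trans h⟩, fun h' => ⟨hx, h'.2.trans h.symm⟩⟩
  · have h₁ := five_mul_notMem_of_mem_sideEdges (y := x) he
    have h₂ := five_mul_notMem_of_mem_sideEdges (y := y) he
    unfold Splits
    tauto

/-- Of two different classes at least one is covered by `P`, and the trace of its main edge on the
copies is exactly that class. -/
theorem exists_redBlack_splits {r : ℕ} {V : Finset ℕ} {P W : Finset (Finset ℕ)} {x y : ℕ}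
    (hx : x ∈ V) (hy : y ∈ V) (hkx : Kept V P W x) (hky : Kept V P W y) (h : ¬Unsep P x y) :
    ∃ e ∈ redBlack r V P W, Splits e (5 * x) (5 * y) := by
  have main : ∀ x ∈ V, ∀ y ∈ V, Kept V P W x → ¬Unsep P x y → Covered P x →
      ∃ e ∈ redBlack r V P W, Splits e (5 * x) (5 * y) := by
    intro x hx y hy hk h hc
    obtain ⟨z, hz, hxz⟩ := exists_isRep hx hc hk
    refine ⟨_, mem_redBlack.2 ⟨z, hz, .inl rfl⟩, ?_⟩
    unfold Splits
    rw [five_mul_mem_mainEdge, five_mul_mem_mainEdge, mem_classFinset, mem_classFinset]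
    exact fun h' => h (hxz.trans (h'.1 ⟨hx, hxz.symm⟩).2)
  by_cases hc : Covered P x
  · exact main x hx y hy hkx h hc
  · by_cases hc' : Covered P y
    · obtain ⟨e, he, hs⟩ := main y hy x hx hky (fun h' => h h'.symm) hc'
      exact ⟨e, he, hs.symm⟩
    · exact absurd (.of_not_covered hc hc') h

/-- The black edges separate a side vertex from all other vertices. -/
theorem exists_redBlack_splits_side {r : ℕ} {V : Finset ℕ} {P W : Finset (Finset ℕ)} {x v w : ℕ}
    (hx : IsRep V P W x) (hv : v ∈ sideVertices r (classFinset V P x).card x)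
    (hw : w ∈ redVertices r V P W) (hvw : v ≠ w) : ∃ e ∈ redBlack r V P W, Splits e v w := by
  obtain ⟨hlt, i, hi₀, hi₅, hi, rfl⟩ := mem_sideVertices hv
  have hmain : mainEdge r x (classFinset V P x) ∈ redBlack r V P W :=
    mem_redBlack.2 ⟨x, hx, .inl rfl⟩
  by_cases hr : r = 2
  · have he : ({5 * x + 1, 5 * x + 2} : Finset ℕ) ∈ redBlack r V P W :=
      mem_redBlack.2 ⟨x, hx, .inr ((mem_sideEdges_two hr).2 ⟨hlt, rfl⟩)⟩
    have := hi hr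
    by_cases hwe : w = 5 * x + 1 ∨ w = 5 * x + 2
    · refine ⟨_, hmain, ?_⟩
      unfold Splits
      rw [five_mul_add_mem_mainEdge hi₀ hi₅]
      rcases hwe with rfl | rfl <;> rw [five_mul_add_mem_mainEdge (by omega) (by omega)] <;> omega
    · refine ⟨_, he, ?_⟩
      unfold Splits
      simp only [Finset.mem_insert, Finset.mem_singleton]
      omega
  · have he₁ : ({5 * x + 1, 5 * x + 2, 5 * x + 3} : Finset ℕ) ∈ redBlack r V P W :=
      mem_redBlack.2 ⟨x, hx, .inr ((mem_sideEdges hr).2 ⟨hlt, .inl rfl⟩)⟩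
    have he₂ : ({5 * x + 3, 5 * x + 4} : Finset ℕ) ∈ redBlack r V P W :=
      mem_redBlack.2 ⟨x, hx, .inr ((mem_sideEdges hr).2 ⟨hlt, .inr rfl⟩)⟩
    by_contra hcon
    push Not at hcon
    have h₁ := hcon _ he₁
    have h₂ := hcon _ he₂
    unfold Splits at h₁ h₂
    simp only [Finset.mem_insert, Finset.mem_singleton] at h₁ h₂
    have h₃ := hcon _ hmain
    -- If no side edge separates `v` and `w`, then `w` is in the same gadget, and the two can only
    -- be `5 * x + 1` and `5 * x + 2`, which the main edge separates.
    obtain ⟨j, hj₀, hj₅, rfl⟩ : ∃ j, 0 < j ∧ j < 5 ∧ w = 5 * x + j := ⟨w - 5 * x, by omega⟩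
    unfold Splits at h₃
    rw [five_mul_add_mem_mainEdge hi₀ hi₅, five_mul_add_mem_mainEdge hj₀ hj₅] at h₃
    omega

/-- An edge with a gadget vertex is not a copy of anything. A black edge without one comes from a
class of size `r`, which fills the edge of `P` containing it; so it copies a member of `P`. -/
theorem redBlack_disjoint {r : ℕ} {V : Finset ℕ} {P W : Finset (Finset ℕ)}
    (hPW : ∀ e ∈ P, e ∉ W) (hr : ∀ e ∈ P, e.card ≤ r) {e : Finset ℕ}
    (he : e ∈ redBlack r V P W) : e ∉ redWhite W := by
  intro hw
  obtain ⟨f, hf, rfl⟩ := Finset.mem_image.1 hw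
  obtain ⟨x, hx, h | h⟩ := mem_redBlack.1 he
  · by_cases hlt : (classFinset V P x).card < r
    · have := (five_mul_add_mem_mainEdge (r := r) (x := x) (y := x) (i := 1) (by omega) (by omega)
        (C := classFinset V P x)).2 ⟨hlt, rfl, rfl⟩
      rw [← h] at this
      exact five_mul_add_notMem_hat (by omega) (by omega) this
    · rw [mainEdge, if_neg hlt] at h
      obtain ⟨e, he, hxe⟩ := hx.2.1
      have hsub : classFinset V P x ⊆ e := fun y hy =>
        ((mem_classFinset.1 hy).2.mem_iff he).1 hxe
      have := Finset.eq_of_subset_of_card_le hsub (by have := hr e he; omega)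
      exact hPW e he (this ▸ hat_injective h ▸ hf)
  · by_cases hr : r = 2
    · obtain ⟨-, h⟩ := (mem_sideEdges_two hr).1 h
      have : 5 * x + 1 ∈ hat f := by rw [h]; simp
      exact five_mul_add_notMem_hat (by omega) (by omega) this
    · obtain ⟨-, h | h⟩ := (mem_sideEdges hr).1 h <;>
      · have : 5 * x + 3 ∈ hat f := by rw [h]; simp
        exact five_mul_add_notMem_hat (by omega) (by omega) this

/-- Only edges of `W` separate the pair, and one of the two vertices lies in such an edge. -/
theorem kept_of_unsep {V : Finset ℕ} {E W : Finset (Finset ℕ)} (hE : CoversOn V E) {x y : ℕ}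
    (hx : x ∈ V) (hy : y ∈ V) (hxy : x ≠ y) (h : Unsep (E \ W) x y) :
    Kept V (E \ W) W x := by
  obtain ⟨e, he, hs⟩ := hE x hx y hy hxy
  have heW : e ∈ W := by
    by_contra hn
    exact h e (Finset.mem_sdiff.2 ⟨he, hn⟩) hs
  by_cases hxe : x ∈ e
  · exact .inr ⟨x, hx, .refl _ _, e, heW, hxe⟩
  · exact .inr ⟨y, hy, h, e, heW, by unfold Splits at hs; tauto⟩

/-- The new black edges induce on the copies of kept vertices the same partition as `E \ W`, and
they isolate all gadget vertices. What remains is to separate vertices of a common class; these are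
kept, and the edges of `W` do it in both instances alike. -/
theorem coversOn_red_iff {r : ℕ} {V : Finset ℕ} {E W S : Finset (Finset ℕ)} (hE : CoversOn V E)
    (hW : W ⊆ E) (hr : ∀ e ∈ E, e.card ≤ r) (hS : S ⊆ W) :
    CoversOn (redVertices r V (E \ W) W)
        ((redWhite W ∪ redBlack r V (E \ W) W) \ redWhite S) ↔ CoversOn V (E \ S) := by
  have hdisj : ∀ e ∈ redBlack r V (E \ W) W, e ∉ redWhite S := fun e he h =>
    redBlack_disjoint (fun e he => (Finset.mem_sdiff.1 he).2)
      (fun e he => hr e (Finset.mem_sdiff.1 he).1) he (Finset.image_subset_image hS h)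
  constructor
  · intro h x hx y hy hxy
    by_cases hu : Unsep (E \ W) x y
    · have hkx := kept_of_unsep hE hx hy hxy hu
      obtain ⟨e, he, hs⟩ := h (5 * x) (mem_redVertices.2 (.inl ⟨x, hx, hkx, rfl⟩)) (5 * y)
        (mem_redVertices.2 (.inl ⟨y, hy, hu.kept hkx, rfl⟩)) (by omega)
      rw [Finset.mem_sdiff, Finset.mem_union] at he
      obtain ⟨he | he, heS⟩ := he
      · obtain ⟨f, hf, rfl⟩ := Finset.mem_image.1 he
        rw [hat_mem_redWhite] at heS
        exact ⟨f, Finset.mem_sdiff.2 ⟨hW hf, heS⟩, splits_hat.1 hs⟩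
      · exact absurd hs (not_splits_redBlack he hx hy hu)
    · unfold Unsep at hu
      push Not at hu
      obtain ⟨e, he, hs⟩ := hu
      rw [Finset.mem_sdiff] at he
      exact ⟨e, Finset.mem_sdiff.2 ⟨he.1, fun h => he.2 (hS h)⟩, hs⟩
  · intro h v hv w hw hvw
    have hblack : ∀ e ∈ redBlack r V (E \ W) W,
        e ∈ (redWhite W ∪ redBlack r V (E \ W) W) \ redWhite S := fun e he =>
      Finset.mem_sdiff.2 ⟨Finset.mem_union_right _ he, hdisj e he⟩
    rcases mem_redVertices.1 hv with ⟨x, hx, hkx, rfl⟩ | ⟨x, hx, hvx⟩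
    swap
    · obtain ⟨e, he, hs⟩ := exists_redBlack_splits_side hx hvx hw hvw
      exact ⟨e, hblack e he, hs⟩
    rcases mem_redVertices.1 hw with ⟨y, hy, hky, rfl⟩ | ⟨y, hy, hwy⟩
    swap
    · obtain ⟨e, he, hs⟩ := exists_redBlack_splits_side hy hwy hv hvw.symm
      exact ⟨e, hblack e he, hs.symm⟩
    by_cases hu : Unsep (E \ W) x y
    · obtain ⟨e, he, hs⟩ := h x hx y hy (by rintro rfl; exact hvw rfl)
      rw [Finset.mem_sdiff] at he
      have heW : e ∈ W := by
        by_contra hn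
        exact hu e (Finset.mem_sdiff.2 ⟨he.1, hn⟩) hs
      refine ⟨hat e, Finset.mem_sdiff.2 ⟨Finset.mem_union_left _ (hat_mem_redWhite.2 heW), ?_⟩,
        splits_hat.2 hs⟩
      rw [hat_mem_redWhite]
      exact he.2
    · obtain ⟨e, he, hs⟩ := exists_redBlack_splits hx hy hkx hky hu
      exact ⟨e, hblack e he, hs⟩

theorem coversOn_red {r : ℕ} {V : Finset ℕ} {E W : Finset (Finset ℕ)} (hE : CoversOn V E)
    (hW : W ⊆ E) (hr : ∀ e ∈ E, e.card ≤ r) :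
    CoversOn (redVertices r V (E \ W) W) (redWhite W ∪ redBlack r V (E \ W) W) := by
  have := (coversOn_red_iff hE hW hr (Finset.empty_subset W)).2 (by simpa using hE)
  simpa [redWhite] using this

theorem solvable_red_iff {r k : ℕ} {V : Finset ℕ} {E B : Finset (Finset ℕ)} (hE : CoversOn V E)
    (hB : B ⊆ E) (hr : ∀ e ∈ E, e.card ≤ r) {W : Finset (Finset ℕ)} (hWB : W = white V E B) :
    Solvable V E B k ↔ Solvable (redVertices r V (E \ W) W)
      (redWhite W ∪ redBlack r V (E \ W) W) (redBlack r V (E \ W) W) k := by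
  have hW : W ⊆ E := hWB ▸ white_subset
  have hdisj : ∀ e ∈ redBlack r V (E \ W) W, e ∉ redWhite W := fun e he =>
    redBlack_disjoint (fun e he => (Finset.mem_sdiff.1 he).2)
      (fun e he => hr e (Finset.mem_sdiff.1 he).1) he
  rw [solvable_iff hB, ← hWB]
  constructor
  · rintro ⟨S, hS, hc, hk⟩
    have hsub : redWhite S ⊆ redWhite W := Finset.image_subset_image hS
    refine ⟨_, Finset.sdiff_subset, fun e he => ?_, (coversOn_red_iff hE hW hr hS).2 hc, ?_⟩
    · exact Finset.mem_sdiff.2 ⟨Finset.mem_union_right _ he, fun h => hdisj e he (hsub h)⟩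
    · have := Finset.card_sdiff_add_card_eq_card
        (hsub.trans (Finset.subset_union_left (s₂ := redBlack r V (E \ W) W)))
      have : (redWhite S).card = S.card := Finset.card_image_of_injective _ hat_injective
      omega
  · rintro ⟨T, hT, hBT, hc, hk⟩
    -- As `T` contains all black edges, it is determined by the copies it omits.
    let S := W.filter fun e => hat e ∉ T
    have hS : S ⊆ W := Finset.filter_subset _ _
    have hTS : T = (redWhite W ∪ redBlack r V (E \ W) W) \ redWhite S := by
      ext e
      rw [Finset.mem_sdiff, Finset.mem_union]
      constructor
      · intro he
        refine ⟨Finset.mem_union.1 (hT he), fun h => ?_⟩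
        obtain ⟨f, hf, rfl⟩ := Finset.mem_image.1 h
        exact (Finset.mem_filter.1 hf).2 he
      · rintro ⟨he | he, hn⟩
        · obtain ⟨f, hf, rfl⟩ := Finset.mem_image.1 he
          rw [hat_mem_redWhite, Finset.mem_filter] at hn
          tauto
        · exact hBT he
    refine ⟨S, hS, (coversOn_red_iff hE hW hr hS).1 (hTS ▸ hc), ?_⟩
    have hsub : redWhite S ⊆ redWhite W ∪ redBlack r V (E \ W) W :=
      (Finset.image_subset_image hS).trans Finset.subset_union_left
    have h₁ := Finset.card_sdiff_add_card_eq_card hsub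
    rw [← hTS] at h₁
    have : (redWhite S).card = S.card := Finset.card_image_of_injective _ hat_injective
    omega

/-! ### Shape and size of the reduced instance -/

theorem red_edge_subset {r : ℕ} {V : Finset ℕ} {E W : Finset (Finset ℕ)} (hV : ∀ e ∈ E, e ⊆ V)
    (hW : W ⊆ E) {e : Finset ℕ} (he : e ∈ redWhite W ∪ redBlack r V (E \ W) W) :
    e ⊆ redVertices r V (E \ W) W := by
  intro v hv
  rcases Finset.mem_union.1 he with he | he
  · obtain ⟨f, hf, rfl⟩ := Finset.mem_image.1 he
    obtain ⟨x, hx, rfl⟩ := mem_hat.1 hv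
    have hxV := hV f (hW hf) hx
    exact mem_redVertices.2 (.inl ⟨x, hxV, .inr ⟨x, hxV, .refl _ _, f, hf, hx⟩, rfl⟩)
  · obtain ⟨x, hx, rfl | he⟩ := mem_redBlack.1 he
    · have key : ∀ v ∈ hat (classFinset V (E \ W) x), v ∈ redVertices r V (E \ W) W := by
        intro v hv
        obtain ⟨y, hy, rfl⟩ := mem_hat.1 hv
        rw [mem_classFinset] at hy
        exact mem_redVertices.2 (.inl ⟨y, hy.1, hy.2.kept hx.2.2.1, rfl⟩)
      unfold mainEdge at hv
      split_ifs at hv with h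
      · rcases Finset.mem_insert.1 hv with rfl | hv
        · refine mem_redVertices.2 (.inr ⟨x, hx, ?_⟩)
          rw [sideVertices, if_pos h]
          split_ifs <;> simp
        · exact key v hv
      · exact key v hv
    · refine mem_redVertices.2 (.inr ⟨x, hx, ?_⟩)
      by_cases hr : r = 2
      · obtain ⟨h, rfl⟩ := (mem_sideEdges_two hr).1 he
        rwa [sideVertices, if_pos h, if_pos hr]
      · obtain ⟨h, rfl | rfl⟩ := (mem_sideEdges hr).1 he <;>
        · rw [sideVertices, if_pos h, if_neg hr]
          simp only [Finset.mem_insert, Finset.mem_singleton] at hv ⊢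
          tauto

theorem card_red_edge_le {r : ℕ} (hr₂ : 2 ≤ r) {V : Finset ℕ} {E W : Finset (Finset ℕ)}
    (hr : ∀ e ∈ E, e.card ≤ r) (hW : W ⊆ E) {e : Finset ℕ}
    (he : e ∈ redWhite W ∪ redBlack r V (E \ W) W) : e.card ≤ r := by
  rcases Finset.mem_union.1 he with he | he
  · obtain ⟨f, hf, rfl⟩ := Finset.mem_image.1 he
    rw [card_hat]
    exact hr f (hW hf)
  · obtain ⟨x, hx, rfl | he⟩ := mem_redBlack.1 he
    · unfold mainEdge
      split_ifs with h
      · have := Finset.card_insert_le (5 * x + 1) (hat (classFinset V (E \ W) x))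
        rw [card_hat] at this
        omega
      · rw [card_hat]
        exact hx.card_class_le fun e he => hr e (Finset.mem_sdiff.1 he).1
    · by_cases h2 : r = 2
      · obtain ⟨-, rfl⟩ := (mem_sideEdges_two h2).1 he
        exact Finset.card_le_two.trans hr₂
      · obtain ⟨-, rfl | rfl⟩ := (mem_sideEdges h2).1 he
        · exact Finset.card_le_three.trans (by omega)
        · exact Finset.card_le_two.trans hr₂

theorem card_biUnion_white_le {r : ℕ} {W : Finset (Finset ℕ)} (hr : ∀ e ∈ W, e.card ≤ r) :
    (W.biUnion id).card ≤ r * W.card := by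
  rw [mul_comm]
  exact Finset.card_biUnion_le_card_mul _ _ _ hr

theorem covered_iff_mem_biUnion {W : Finset (Finset ℕ)} {x : ℕ} :
    Covered W x ↔ x ∈ W.biUnion id := by
  simp [Covered]

/-- Two vertices of one class outside `U` would not be separated by any edge. So outside `U` there
is at most one kept vertex not covered by `E \ W` (the set `I`), and the others (`K`) are mapped
injectively to a vertex of `U` in their class. -/
theorem card_keptFinset_le {V : Finset ℕ} {E W : Finset (Finset ℕ)} (hE : CoversOn V E) :
    (keptFinset V (E \ W) W).card ≤ 1 + 2 * (W.biUnion id).card := by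
  classical
  set U := W.biUnion id with hU
  have hsplit : ∀ x ∈ V, ∀ y ∈ V, x ∉ U → y ∉ U → Unsep (E \ W) x y → x = y := by
    intro x hx y hy hxU hyU h
    by_contra hne
    obtain ⟨e, he, hs⟩ := hE x hx y hy hne
    have heW : e ∈ W := by
      by_contra hn
      exact h e (Finset.mem_sdiff.2 ⟨he, hn⟩) hs
    have h₁ : x ∉ e := fun h => hxU (Finset.mem_biUnion.2 ⟨e, heW, h⟩)
    have h₂ : y ∉ e := fun h => hyU (Finset.mem_biUnion.2 ⟨e, heW, h⟩)
    unfold Splits at hs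
    tauto
  let I := V.filter fun x => x ∉ U ∧ ¬Covered (E \ W) x
  let K := V.filter fun x => x ∉ U ∧ ∃ y ∈ V, Unsep (E \ W) x y ∧ Covered W y
  have hI : I.card ≤ 1 := by
    refine Finset.card_le_one.2 fun x hx y hy => ?_
    rw [Finset.mem_filter] at hx hy
    exact hsplit x hx.1 y hy.1 hx.2.1 hy.2.1 (.of_not_covered hx.2.2 hy.2.2)
  have hK : K.card ≤ U.card := by
    have : ∀ x, ∃ y, x ∈ K → Unsep (E \ W) x y ∧ Covered W y := by
      intro x
      by_cases hx : x ∈ K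
      · obtain ⟨y, _, h⟩ := (Finset.mem_filter.1 hx).2.2
        exact ⟨y, fun _ => h⟩
      · exact ⟨0, fun h => absurd h hx⟩
    choose f hf using this
    refine Finset.card_le_card_of_injOn f (fun x hx => covered_iff_mem_biUnion.1 (hf x hx).2) ?_
    intro x hx y hy hxy
    have h₁ := (hf x hx).1
    have h₂ := (hf y hy).1
    rw [Finset.mem_coe, Finset.mem_filter] at hx hy
    refine hsplit x hx.1 y hy.1 hx.2.1 hy.2.1 (h₁.trans ?_)
    rw [hxy]
    exact h₂.symm
  have hsub : keptFinset V (E \ W) W ⊆ (I ∪ U) ∪ K := by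
    intro x hx
    rw [mem_keptFinset] at hx
    by_cases hxU : x ∈ U
    · simp [hxU]
    · rcases hx with ⟨hxV, h | h⟩
      · exact Finset.mem_union_left _ (Finset.mem_union_left _ (Finset.mem_filter.2 ⟨hxV, hxU, h⟩))
      · exact Finset.mem_union_right _ (Finset.mem_filter.2 ⟨hxV, hxU, h⟩)
  have h₁ := Finset.card_le_card hsub
  have h₂ := Finset.card_union_le (I ∪ U) K
  have h₃ := Finset.card_union_le I U
  omega

/-- Send each representative to a vertex of its class in a removable edge; different representatives
have disjoint classes. -/
theorem card_repFinset_le {V : Finset ℕ} {P W : Finset (Finset ℕ)} :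
    (repFinset V P W).card ≤ (W.biUnion id).card := by
  have : ∀ x, ∃ y, IsRep V P W x → Unsep P x y ∧ Covered W y := by
    intro x
    by_cases hx : IsRep V P W x
    · obtain ⟨y, _, h⟩ := hx.exists_white
      exact ⟨y, fun _ => h⟩
    · exact ⟨0, fun h => absurd h hx⟩
  choose f hf using this
  refine Finset.card_le_card_of_injOn f
    (fun x hx => covered_iff_mem_biUnion.1 (hf x (mem_repFinset.1 hx)).2) ?_
  intro x hx y hy hxy
  rw [Finset.mem_coe, mem_repFinset] at hx hy
  refine hx.eq_of_unsep hy ((hf x hx).1.trans ?_)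
  rw [hxy]
  exact (hf y hy).1.symm

/-- Here `6 = 2 + 4`: the kept copies, and four gadget vertices for each representative. -/
theorem card_redVertices_le {r : ℕ} {V : Finset ℕ} {E W : Finset (Finset ℕ)} (hE : CoversOn V E)
    (hr : ∀ e ∈ E, e.card ≤ r) (hW : W ⊆ E) :
    (redVertices r V (E \ W) W).card ≤ 1 + 6 * (r * W.card) := by
  have h₁ := card_keptFinset_le (W := W) hE
  have h₂ := card_repFinset_le (V := V) (P := E \ W) (W := W)
  have h₃ := card_biUnion_white_le fun e he => hr e (hW he)
  have h₄ : ((repFinset V (E \ W) W).biUnion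
      fun x => sideVertices r (classFinset V (E \ W) x).card x).card ≤
      (repFinset V (E \ W) W).card * 4 := by
    refine Finset.card_biUnion_le_card_mul _ _ _ fun x _ => ?_
    unfold sideVertices
    split_ifs
    · exact Finset.card_le_two.trans (by omega)
    · exact Finset.card_le_four
    · simp
  have h₅ := Finset.card_union_le (hat (keptFinset V (E \ W) W))
    ((repFinset V (E \ W) W).biUnion fun x => sideVertices r (classFinset V (E \ W) x).card x)
  rw [card_hat] at h₅
  unfold redVertices
  omega

theorem card_redEdges_le {r : ℕ} (hr₁ : 1 ≤ r) {V : Finset ℕ} {E W : Finset (Finset ℕ)}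
    (hr : ∀ e ∈ E, e.card ≤ r) (hW : W ⊆ E) :
    (redWhite W ∪ redBlack r V (E \ W) W).card ≤ 4 * (r * W.card) := by
  have h₂ := card_repFinset_le (V := V) (P := E \ W) (W := W)
  have h₃ := card_biUnion_white_le fun e he => hr e (hW he)
  have h₄ : (redBlack r V (E \ W) W).card ≤ (repFinset V (E \ W) W).card * 3 := by
    refine Finset.card_biUnion_le_card_mul _ _ _ fun x _ => ?_
    refine (Finset.card_insert_le _ _).trans (Nat.succ_le_succ ?_)
    unfold sideEdges
    split_ifs
    · simp
    · exact Finset.card_le_two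
    · simp
  have h₅ := Finset.card_union_le (redWhite W) (redBlack r V (E \ W) W)
  have h₆ : (redWhite W).card ≤ W.card := Finset.card_image_le
  have h₇ : W.card ≤ r * W.card := Nat.le_mul_of_pos_left _ hr₁
  omega

/-! ### Black edges that cannot be removed -/

theorem not_coversOn_erase {V : Finset ℕ} {E : Finset (Finset ℕ)} {e : Finset ℕ} {p q : ℕ}
    (hp : p ∈ V) (hq : q ∈ V) (hpq : p ≠ q) (h : ∀ f ∈ E, f ≠ e → ¬Splits f p q) :
    ¬CoversOn V (E.erase e) := fun hc =>
  let ⟨f, hf, hs⟩ := hc p hp q hq hpq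
  h f (Finset.mem_of_mem_erase hf) (Finset.ne_of_mem_erase hf) hs

theorem solvable_empty_iff {V : Finset ℕ} {E G : Finset (Finset ℕ)} {k : ℕ}
    (hG : ∀ g ∈ G, ¬CoversOn V (E.erase g)) : Solvable V E ∅ k ↔ Solvable V E G k := by
  constructor
  · rintro ⟨T, hT, -, hc, hk⟩
    refine ⟨T, hT, fun g hg => ?_, hc, hk⟩
    by_contra hn
    refine hG g hg (hc.mono fun e he => Finset.mem_erase.2 ⟨?_, hT he⟩)
    rintro rfl
    exact hn he
  · rintro ⟨T, hT, -, hc, hk⟩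
    exact ⟨T, hT, Finset.empty_subset _, hc, hk⟩

/-- With no black edges, an edge can fail to be removable only by being the sole separator of a
pair; the pair is oriented so that `p` is the end in `e`. -/
theorem exists_forcing_pair {V : Finset ℕ} {E : Finset (Finset ℕ)} (hE : CoversOn V E)
    {e : Finset ℕ} (he : e ∈ E \ white V E ∅) : ∃ p ∈ V, ∃ q ∈ V, p ∈ e ∧ q ∉ e ∧
      ∀ f ∈ E, f ≠ e → (p ∈ f ↔ q ∈ f) := by
  rw [Finset.mem_sdiff, mem_white] at he
  have hn : ¬CoversOn V (E.erase e) := fun h => he.2 ⟨he.1, Finset.notMem_empty _, h⟩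
  unfold CoversOn at hn
  push Not at hn
  obtain ⟨x, hx, y, hy, hxy, h⟩ := hn
  have h' : ∀ f ∈ E, f ≠ e → (x ∈ f ↔ y ∈ f) := fun f hf hfe =>
    not_not.1 (h f (Finset.mem_erase.2 ⟨hfe, hf⟩))
  obtain ⟨f, hf, hs⟩ := hE x hx y hy hxy
  have hfe : f = e := by
    by_contra hne
    exact hs (h' f hf hne)
  subst hfe
  by_cases hxf : x ∈ f
  · exact ⟨x, hx, y, hy, hxf, by unfold Splits at hs; tauto, h'⟩
  · exact ⟨y, hy, x, hx, by unfold Splits at hs; tauto, hxf, fun g hg hne => (h' g hg hne).symm⟩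

/-- In a graph without isolated vertices, a vertex in a removable edge that is separated from all
others by unremovable edges gives rise to a far pendant edge. -/
theorem exists_far_of_graph {V : Finset ℕ} {E : Finset (Finset ℕ)} (hr : ∀ e ∈ E, e.card ≤ 2)
    (hE : CoversOn V E) (hiso : ∀ x ∈ V, Covered E x) {y : ℕ}
    (hy : ∀ b ∈ V, b ≠ y → ∃ f ∈ E \ white V E ∅, Splits f y b)
    (hyW : Covered (white V E ∅) y) (hyP : Covered (E \ white V E ∅) y) :
    ∃ f ∈ white V E ∅, Pendant E f ∧ Far V E ((E \ innerWhite V E ∅).erase f) f := by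
  obtain ⟨g, hg, hyg⟩ := hyW
  obtain ⟨e, he, hye⟩ := hyP
  obtain ⟨p, hpV, q, hqV, hpe, hqe, hpq⟩ := exists_forcing_pair hE he
  have heE := (Finset.mem_sdiff.1 he).1
  have hpair : ∀ f ∈ E, ∀ a b, a ≠ b → a ∈ f → b ∈ f → f = {a, b} := by
    intro f hf a b hab ha hb
    refine (Finset.eq_of_subset_of_card_le (fun c hc => ?_) ?_).symm
    · simp only [Finset.mem_insert, Finset.mem_singleton] at hc
      rcases hc with rfl | rfl <;> assumption
    · rw [Finset.card_pair hab]
      exact hr f hf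
  have hpq' : p ≠ q := by rintro rfl; exact hqe hpe
  -- The edge `f` at `q` must contain `p`, so `f = {p, q}` is the only edge at `q`, and only `e` and
  -- `f` pass through `p`.
  obtain ⟨f, hf, hqf⟩ := hiso q hqV
  have hfe : f ≠ e := by rintro rfl; exact hqe hqf
  have hpf := (hpq f hf hfe).2 hqf
  have hq : ∀ f' ∈ E, q ∈ f' → f' = f := by
    intro f' hf' hqf'
    have hne : f' ≠ e := by rintro rfl; exact hqe hqf'
    rw [hpair f' hf' p q hpq' ((hpq f' hf' hne).2 hqf') hqf', hpair f hf p q hpq' hpf hqf]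
  have hp : ∀ f' ∈ E, p ∈ f' → f' = e ∨ f' = f := by
    intro f' hf' hpf'
    by_cases hne : f' = e
    · exact .inl hne
    · exact .inr (hq f' hf' ((hpq f' hf' hne).1 hpf'))
  have heW : e ∉ white V E ∅ := (Finset.mem_sdiff.1 he).2
  by_cases hfW : f ∈ white V E ∅
  -- `q` is pendant in `f`. An adjacent pair split by `f` consists of `p` and another vertex of `e`,
  -- so it contains `y`, which unremovable edges separate from everything.
  · refine ⟨f, hfW, ⟨q, hqf, hq⟩, ?_⟩
    have hsub : ∀ g ∈ E \ white V E ∅, g ∈ (E \ innerWhite V E ∅).erase f := by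
      intro g hg
      rw [Finset.mem_sdiff] at hg
      refine Finset.mem_erase.2 ⟨by rintro rfl; exact hg.2 hfW, Finset.mem_sdiff.2 ⟨hg.1, ?_⟩⟩
      exact fun h => hg.2 (innerWhite_subset h)
    rintro a haf b hbV hbf ⟨f', hf', haf', hbf'⟩
    have hap : a = p := by
      rw [hpair f hf p q hpq' hpf hqf] at haf
      simp only [Finset.mem_insert, Finset.mem_singleton] at haf
      rcases haf with rfl | rfl
      · rfl
      · exact absurd (hq f' hf' haf' ▸ hbf') hbf
    subst hap
    have hbe : b ∈ e := by
      rcases hp f' hf' haf' with rfl | rfl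
      · exact hbf'
      · exact absurd hbf' hbf
    by_cases hay : a = y
    · obtain ⟨g, hg, hs⟩ := hy b hbV (by rintro rfl; exact hbf (hay ▸ haf))
      exact ⟨g, hsub g hg, hay ▸ hs⟩
    · have hby : b = y := by
        rw [hpair e heE a y hay hpe hye] at hbe
        simp only [Finset.mem_insert, Finset.mem_singleton] at hbe
        rcases hbe with rfl | rfl
        · exact absurd haf hbf
        · rfl
      obtain ⟨g, hg, hs⟩ := hy a hpV hay
      exact ⟨g, hsub g hg, hby ▸ hs.symm⟩
  -- If `f` were unremovable too, its forcing pair would have to be `p, y`; but `g` contains `y` and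
  -- not `p`.
  · exfalso
    have hgf : g ≠ f := by rintro rfl; exact hfW hg
    have hge : g ≠ e := by rintro rfl; exact heW hg
    have hpg : p ∉ g := fun h => (hp g (white_subset hg) h).elim hge hgf
    have hpy : p ≠ y := by rintro rfl; exact hpg hyg
    obtain ⟨p₂, -, q₂, hq₂V, hp₂f, hq₂f, h₂⟩ :=
      exists_forcing_pair hE (Finset.mem_sdiff.2 ⟨hf, hfW⟩)
    obtain ⟨f₃, hf₃, hq₂f₃⟩ := hiso q₂ hq₂V
    have hne : f₃ ≠ f := by rintro rfl; exact hq₂f hq₂f₃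
    have hp₂f₃ := (h₂ f₃ hf₃ hne).2 hq₂f₃
    rw [hpair f hf p q hpq' hpf hqf] at hp₂f
    simp only [Finset.mem_insert, Finset.mem_singleton] at hp₂f
    rcases hp₂f with rfl | rfl
    · have := (hp f₃ hf₃ hp₂f₃).resolve_right hne
      subst this
      rw [hpair f₃ hf₃ p₂ y hpy hpe hye] at hq₂f₃
      simp only [Finset.mem_insert, Finset.mem_singleton] at hq₂f₃
      rcases hq₂f₃ with rfl | rfl
      · exact hq₂f hpf
      · exact hpg ((h₂ g (white_subset hg) hgf).2 hyg)
    · exact hne (hq f₃ hf₃ hp₂f₃)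

/-- A pair with no other separator is exhibited for each black edge. A class of size `r` is an edge
of `E \ W`, and the copy of that edge's forcing pair works. Otherwise write `uᵢ` for `5 * x + i`.
The main edge is forced by `u₁, u₂`. For `r ≠ 2` the side edges `{u₁, u₂, u₃}` and `{u₃, u₄}` are
forced by `u₃, u₄` and `u₃, u₂`. For `r = 2` the side edge is forced by `u₂` and the copy of an
isolated vertex. -/
theorem not_coversOn_erase_redBlack {r : ℕ} {V : Finset ℕ} {E : Finset (Finset ℕ)}
    (hr : ∀ e ∈ E, e.card ≤ r) (hE : CoversOn V E)
    (hf : ∀ e ∈ white V E ∅, Pendant E e → ¬Far V E ((E \ innerWhite V E ∅).erase e) e)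
    {W : Finset (Finset ℕ)} (hW : W = white V E ∅) {g : Finset ℕ}
    (hg : g ∈ redBlack r V (E \ W) W) :
    ¬CoversOn (redVertices r V (E \ W) W)
      ((redWhite W ∪ redBlack r V (E \ W) W).erase g) := by
  obtain ⟨x, hx, hgx⟩ := mem_redBlack.1 hg
  set C := classFinset V (E \ W) x with hC
  by_cases hlt : C.card < r
  swap
  · have hg' : g = hat C := by
      rcases hgx with rfl | h
      · rw [mainEdge, if_neg hlt]
      · rw [sideEdges, if_neg hlt] at h
        exact absurd h (Finset.notMem_empty _)
    obtain ⟨e, he, hxe⟩ := hx.2.1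
    have hcls : ∀ f ∈ E \ W, ∀ p ∈ C, p ∈ f → C = f := by
      intro f hfP p hp hpf
      rw [hC, mem_classFinset] at hp
      refine Finset.eq_of_subset_of_card_le (fun y hy => ?_) ?_
      · exact ((hp.2.symm.trans (mem_classFinset.1 hy).2).mem_iff hfP).1 hpf
      · have := hr f (Finset.mem_sdiff.1 hfP).1
        omega
    have hxC : x ∈ C := mem_classFinset.2 ⟨hx.1, .refl _ _⟩
    have heC := hcls e he x hxC hxe
    obtain ⟨p, hpV, q, hqV, hpe, hqe, hpq⟩ := exists_forcing_pair hE (hW ▸ he)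
    have hpC : p ∈ C := heC ▸ hpe
    -- Another unremovable edge through `q` would contain `p` and hence equal `C`. So `q` is
    -- uncovered by `E \ W`, and its copy is kept.
    have hqP : ¬Covered (E \ W) q := by
      rintro ⟨f, hfP, hqf⟩
      have hne : f ≠ e := by rintro rfl; exact hqe hqf
      have := hcls f hfP p hpC ((hpq f (Finset.mem_sdiff.1 hfP).1 hne).2 hqf)
      exact hne (this.symm.trans heC)
    have hpk := (mem_classFinset.1 hpC).2.kept hx.2.2.1
    refine not_coversOn_erase (mem_redVertices.2 (.inl ⟨p, hpV, hpk, rfl⟩))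
      (mem_redVertices.2 (.inl ⟨q, hqV, .inl hqP, rfl⟩)) (by
        intro h
        have : p = q := by omega
        exact hqe (this ▸ hpe)) ?_
    intro t ht htg
    rcases Finset.mem_union.1 ht with ht | ht
    · obtain ⟨f, hfW, rfl⟩ := Finset.mem_image.1 ht
      rw [splits_hat]
      refine not_not.2 (hpq f ((hW ▸ white_subset : W ⊆ E) hfW) ?_)
      rintro rfl
      exact (Finset.mem_sdiff.1 he).2 hfW
    · obtain ⟨y, hy, rfl | hty⟩ := mem_redBlack.1 ht
      · unfold Splits
        rw [five_mul_mem_mainEdge, five_mul_mem_mainEdge, mem_classFinset, mem_classFinset]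
        refine not_not.2 ⟨fun h => ?_, fun h => absurd (h.2.covered hy.2.1) hqP⟩
        have := hx.eq_of_unsep hy ((mem_classFinset.1 hpC).2.trans h.2.symm)
        subst this
        rw [mainEdge, if_neg hlt] at htg
        exact absurd hg'.symm htg
      · have h₁ := five_mul_notMem_of_mem_sideEdges (y := p) hty
        have h₂ := five_mul_notMem_of_mem_sideEdges (y := q) hty
        unfold Splits
        tauto
  have hside : ∀ i, 0 < i → i < 5 → ∀ t ∈ redWhite W ∪ redBlack r V (E \ W) W, 5 * x + i ∈ t →
      t = mainEdge r x C ∧ i = 1 ∨ t ∈ sideEdges r x C := by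
    intro i hi₀ hi₅ t ht hit
    rcases Finset.mem_union.1 ht with ht | ht
    · obtain ⟨f, -, rfl⟩ := Finset.mem_image.1 ht
      exact absurd hit (five_mul_add_notMem_hat hi₀ hi₅)
    · obtain ⟨y, hy, rfl | hty⟩ := mem_redBlack.1 ht
      · rw [five_mul_add_mem_mainEdge hi₀ hi₅] at hit
        obtain ⟨-, rfl, hi⟩ := hit
        exact .inl ⟨rfl, hi⟩
      · have hxy : x = y := by
          by_cases h2 : r = 2
          · obtain ⟨-, rfl⟩ := (mem_sideEdges_two h2).1 hty
            simp at hit; omega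
          · obtain ⟨-, rfl | rfl⟩ := (mem_sideEdges h2).1 hty <;> simp at hit <;> omega
        subst hxy
        exact .inr hty
  have hmain : ∀ i, 0 < i → i < 5 → (5 * x + i ∈ mainEdge r x C ↔ i = 1) := fun i h₀ h₅ => by
    rw [five_mul_add_mem_mainEdge h₀ h₅]
    simp [hlt]
  by_cases h2 : r = 2
  -- For `r = 2` the class is the single vertex `y`; without an isolated vertex
  -- `exists_far_of_graph` would contradict `hf`.
  · have hiso : ∃ z ∈ V, ¬Covered E z := by
      by_contra hcon
      push Not at hcon
      obtain ⟨y, hyV, hxy, hyW⟩ := hx.exists_white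
      have hCone : ∀ b ∈ C, b = y := by
        have h1 : C.card ≤ 1 := by omega
        exact fun b hb => Finset.card_le_one.1 h1 b hb y (mem_classFinset.2 ⟨hyV, hxy⟩)
      obtain ⟨f, h₁, h₂, h₃⟩ := exists_far_of_graph (V := V) (E := E) (h2 ▸ hr) hE hcon (y := y)
        (fun b hb hby => by
          by_contra hn
          push Not at hn
          exact hby (hCone b (mem_classFinset.2 ⟨hb, hxy.trans (hW ▸ hn)⟩)))
        (hW ▸ hyW) (hW ▸ hxy.covered hx.2.1)
      exact hf f h₁ h₂ h₃
    obtain ⟨z, hzV, hz⟩ := hiso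
    have hzP : ¬Covered (E \ W) z := fun ⟨f, hf, hzf⟩ => hz ⟨f, (Finset.mem_sdiff.1 hf).1, hzf⟩
    have hzt : ∀ t ∈ redWhite W ∪ redBlack r V (E \ W) W, 5 * z ∉ t := by
      intro t ht hzt
      rcases Finset.mem_union.1 ht with ht | ht
      · obtain ⟨f, hf, rfl⟩ := Finset.mem_image.1 ht
        rw [five_mul_mem_hat] at hzt
        exact hz ⟨f, (hW ▸ white_subset : W ⊆ E) hf, hzt⟩
      · obtain ⟨y, hy, rfl | hty⟩ := mem_redBlack.1 ht
        · rw [five_mul_mem_mainEdge, mem_classFinset] at hzt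
          exact hzP (hzt.2.covered hy.2.1)
        · exact five_mul_notMem_of_mem_sideEdges hty hzt
    have hu : ∀ i, i = 1 ∨ i = 2 → 5 * x + i ∈ redVertices r V (E \ W) W := by
      intro i hi
      refine mem_redVertices.2 (.inr ⟨x, hx, ?_⟩)
      rw [sideVertices, if_pos hlt, if_pos h2]
      rcases hi with rfl | rfl <;> simp
    have hzV' : 5 * z ∈ redVertices r V (E \ W) W :=
      mem_redVertices.2 (.inl ⟨z, hzV, .inl hzP, rfl⟩)
    rcases hgx with rfl | hgs
    · refine not_coversOn_erase (hu 1 (by simp)) (hu 2 (by simp)) (by omega) fun t ht htg hs => ?_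
      by_cases h1t : 5 * x + 1 ∈ t
      · rcases hside 1 (by omega) (by omega) t ht h1t with h | h
        · exact htg h.1
        · obtain ⟨-, rfl⟩ := (mem_sideEdges_two h2).1 h
          simp [Splits] at hs
      · have h2t : 5 * x + 2 ∈ t := by unfold Splits at hs; tauto
        rcases hside 2 (by omega) (by omega) t ht h2t with h | h
        · omega
        · obtain ⟨-, rfl⟩ := (mem_sideEdges_two h2).1 h
          simp [Splits] at hs
    · obtain ⟨-, rfl⟩ := (mem_sideEdges_two h2).1 hgs
      refine not_coversOn_erase (hu 2 (by simp)) hzV' (by omega) fun t ht htg hs => ?_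
      have h2t : 5 * x + 2 ∈ t := by have := hzt t ht; unfold Splits at hs; tauto
      rcases hside 2 (by omega) (by omega) t ht h2t with h | h
      · omega
      · exact htg ((mem_sideEdges_two h2).1 h).2
  · have hu : ∀ i, 0 < i → i < 5 → 5 * x + i ∈ redVertices r V (E \ W) W := by
      intro i h₀ h₅
      refine mem_redVertices.2 (.inr ⟨x, hx, ?_⟩)
      rw [sideVertices, if_pos hlt, if_neg h2]
      interval_cases i <;> simp
    have key : ∀ i j, 0 < i → i < 5 → 0 < j → j < 5 → i ≠ j →
        (mainEdge r x C ≠ g → i ≠ 1 ∧ j ≠ 1) →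
        (∀ t ∈ sideEdges r x C, t ≠ g → ¬Splits t (5 * x + i) (5 * x + j)) →
        ¬CoversOn (redVertices r V (E \ W) W)
          ((redWhite W ∪ redBlack r V (E \ W) W).erase g) := by
      intro i j hi₀ hi₅ hj₀ hj₅ hij h₁ h₂
      refine not_coversOn_erase (hu i hi₀ hi₅) (hu j hj₀ hj₅) (by omega) fun t ht htg hs => ?_
      have : t = mainEdge r x C ∧ (i = 1 ∨ j = 1) ∨ t ∈ sideEdges r x C := by
        by_cases hit : 5 * x + i ∈ t
        · have := hside i hi₀ hi₅ t ht hit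
          tauto
        · have := hside j hj₀ hj₅ t ht (by unfold Splits at hs; tauto)
          tauto
      rcases this with ⟨rfl, h⟩ | h
      · have := h₁ htg
        omega
      · exact h₂ t h htg hs
    rcases hgx with rfl | hgs
    · refine key 1 2 (by omega) (by omega) (by omega) (by omega) (by omega) (by simp) ?_
      intro t ht _
      obtain ⟨-, rfl | rfl⟩ := (mem_sideEdges h2).1 ht <;> simp [Splits]
    · have hmg : ∀ i j, i ≠ 1 → j ≠ 1 → mainEdge r x C ≠ g → i ≠ 1 ∧ j ≠ 1 :=
        fun i j hi hj _ => ⟨hi, hj⟩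
      obtain ⟨-, rfl | rfl⟩ := (mem_sideEdges h2).1 hgs
      · refine key 3 4 (by omega) (by omega) (by omega) (by omega) (by omega) (by simp) ?_
        intro t ht htg
        obtain ⟨-, rfl | rfl⟩ := (mem_sideEdges h2).1 ht
        · exact absurd rfl htg
        · simp [Splits]
      · refine key 3 2 (by omega) (by omega) (by omega) (by omega) (by omega) (by simp) ?_
        intro t ht htg
        obtain ⟨-, rfl | rfl⟩ := (mem_sideEdges h2).1 ht
        · simp [Splits]
        · exact absurd rfl htg

end

/-! ### What the list functions compute -/

section

/-- The family of sets given by a list of lists. -/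
def toFam (L : List (List ℕ)) : Finset (Finset ℕ) := (L.map List.toFinset).toFinset

theorem mem_toFam {L : List (List ℕ)} {e : Finset ℕ} : e ∈ toFam L ↔ ∃ l ∈ L, l.toFinset = e := by
  simp [toFam]

theorem toFinset_mem_toFam {L : List (List ℕ)} {l : List ℕ} (h : l ∈ L) :
    l.toFinset ∈ toFam L := mem_toFam.2 ⟨l, h, rfl⟩

theorem agrees_iff {e : List ℕ} {x y : ℕ} : agrees e x y = true ↔ ¬Splits e.toFinset x y := by
  simp [agrees, Splits]

theorem unseparated_iff {L : List (List ℕ)} {x y : ℕ} :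
    unseparated L x y = true ↔ Unsep (toFam L) x y := by
  simp [unseparated, Unsep, mem_toFam, agrees_iff]

theorem sameSet_iff {e f : List ℕ} : sameSet e f = true ↔ e.toFinset = f.toFinset := by
  simp only [sameSet, Bool.and_eq_true, List.all_eq_true, decide_eq_true_eq, Finset.ext_iff,
    List.mem_toFinset]
  exact ⟨fun h a => ⟨h.1 a, h.2 a⟩, fun h => ⟨fun a => (h a).1, fun a => (h a).2⟩⟩

theorem hasSet_iff {L : List (List ℕ)} {e : List ℕ} :
    hasSet L e = true ↔ e.toFinset ∈ toFam L := by
  simp [hasSet, sameSet_iff, mem_toFam]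

theorem mem_toFam_filter {L : List (List ℕ)} {p : List ℕ → Bool} {Q : Finset ℕ → Prop}
    (h : ∀ l, p l = true ↔ Q l.toFinset) {e : Finset ℕ} :
    e ∈ toFam (L.filter p) ↔ e ∈ toFam L ∧ Q e := by
  simp only [mem_toFam, List.mem_filter, h]
  constructor
  · rintro ⟨l, ⟨h₁, h₂⟩, rfl⟩
    exact ⟨⟨l, h₁, rfl⟩, h₂⟩
  · rintro ⟨⟨l, h₁, rfl⟩, h₂⟩
    exact ⟨l, ⟨h₁, h₂⟩, rfl⟩

theorem toFam_diffSet {L K : List (List ℕ)} : toFam (diffSet L K) = toFam L \ toFam K := by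
  ext e
  rw [diffSet, mem_toFam_filter (Q := fun e => e ∉ toFam K) fun l => by
    rw [Bool.not_eq_true', ← Bool.not_eq_true, hasSet_iff], Finset.mem_sdiff]

theorem toFam_diffSet_singleton {L : List (List ℕ)} {e : List ℕ} :
    toFam (diffSet L [e]) = (toFam L).erase e.toFinset := by
  rw [toFam_diffSet, Finset.erase_eq]
  simp [toFam]

theorem covers_iff {L : List (List ℕ)} {x : ℕ} : covers L x = true ↔ Covered (toFam L) x := by
  simp [covers, Covered, mem_toFam]

theorem isCover_iff {n : ℕ} {L : List (List ℕ)} :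
    isCover n L = true ↔ CoversOn (Finset.range n) (toFam L) := by
  simp only [isCover, List.all_eq_true, List.mem_range, Bool.or_eq_true, beq_iff_eq,
    Bool.not_eq_true', ← Bool.not_eq_true, unseparated_iff, CoversOn, Finset.mem_range, Unsep]
  push Not
  exact forall₄_congr fun x _ y _ => by tauto

theorem toFam_whiteEdges {n : ℕ} {L B : List (List ℕ)} :
    toFam (whiteEdges n L B) = white (Finset.range n) (toFam L) (toFam B) := by
  ext e
  rw [mem_white, whiteEdges, mem_toFam_filter
    (Q := fun e => e ∉ toFam B ∧ CoversOn (Finset.range n) ((toFam L).erase e))]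
  intro l
  rw [Bool.and_eq_true, Bool.not_eq_true', ← Bool.not_eq_true, hasSet_iff, isCover_iff,
    toFam_diffSet_singleton]

theorem hasPendant_iff {L : List (List ℕ)} {e : List ℕ} :
    hasPendant L e = true ↔ Pendant (toFam L) e.toFinset := by
  simp only [hasPendant, List.any_eq_true, Bool.not_eq_true', ← Bool.not_eq_true, covers_iff,
    toFam_diffSet_singleton, Covered, Pendant, List.mem_toFinset, Finset.mem_erase]
  refine exists_congr fun x => and_congr_right fun _ => ?_
  push Not
  exact forall_congr' fun f => by tauto

theorem toFam_inner {n : ℕ} {L B : List (List ℕ)} :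
    toFam ((whiteEdges n L B).filter fun e => !hasPendant L e) =
      innerWhite (Finset.range n) (toFam L) (toFam B) := by
  ext e
  rw [mem_innerWhite, mem_toFam_filter (Q := fun e => ¬Pendant (toFam L) e), toFam_whiteEdges]
  intro l
  rw [Bool.not_eq_true', ← Bool.not_eq_true, hasPendant_iff]

theorem adjacent_iff {L : List (List ℕ)} {x y : ℕ} :
    adjacent L x y = true ↔ Adjacent (toFam L) x y := by
  simp [adjacent, Adjacent, mem_toFam]

theorem isFar_iff {n : ℕ} {L R : List (List ℕ)} {e : List ℕ} :
    isFar n L R e = true ↔ Far (Finset.range n) (toFam L) (toFam R) e.toFinset := by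
  simp only [isFar, List.all_eq_true, List.mem_range, Bool.or_eq_true, decide_eq_true_eq,
    Bool.not_eq_true', ← Bool.not_eq_true, adjacent_iff, unseparated_iff, Far, Finset.mem_range,
    List.mem_toFinset, Unsep]
  push Not
  exact forall₄_congr fun x _ y _ => by tauto

theorem nodup_classOf {n x : ℕ} {P : List (List ℕ)} : (classOf n P x).Nodup :=
  List.nodup_range.filter _

theorem toFinset_classOf {n x : ℕ} {P : List (List ℕ)} :
    (classOf n P x).toFinset = classFinset (Finset.range n) (toFam P) x := by
  ext y
  simp [classOf, mem_classFinset, unseparated_iff]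

theorem length_classOf {n x : ℕ} {P : List (List ℕ)} :
    (classOf n P x).length = (classFinset (Finset.range n) (toFam P) x).card := by
  rw [← toFinset_classOf, List.toFinset_card_of_nodup nodup_classOf]

theorem isKept_iff {n x : ℕ} {P W : List (List ℕ)} :
    isKept n P W x = true ↔ Kept (Finset.range n) (toFam P) (toFam W) x := by
  simp only [isKept, Bool.or_eq_true, Bool.not_eq_true', ← Bool.not_eq_true, covers_iff,
    List.any_eq_true, ← List.mem_toFinset, toFinset_classOf, mem_classFinset, Kept, and_assoc]

theorem mem_representatives {n x : ℕ} {P W : List (List ℕ)} :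
    x ∈ representatives n P W ↔ IsRep (Finset.range n) (toFam P) (toFam W) x := by
  simp only [representatives, List.mem_filter, List.mem_range, Bool.and_eq_true, covers_iff,
    isKept_iff, List.all_eq_true, Bool.not_eq_true', ← Bool.not_eq_true, unseparated_iff, IsRep,
    Finset.mem_range, and_assoc]
  refine and_congr_right fun hx => and_congr_right fun _ => and_congr_right fun _ => ?_
  exact forall_congr' fun y => ⟨fun h _ => h, fun h hy => h (hy.trans hx) hy⟩

theorem nodup_representatives {n : ℕ} {P W : List (List ℕ)} : (representatives n P W).Nodup :=
  List.nodup_range.filter _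

theorem mem_gadgetVertices {r c x v : ℕ} :
    v ∈ gadgetVertices r c x ↔ v ∈ sideVertices r c x := by
  unfold gadgetVertices sideVertices
  simp only [decide_eq_true_eq, beq_iff_eq]
  split_ifs <;> simp

theorem nodup_gadgetVertices {r c x : ℕ} : (gadgetVertices r c x).Nodup := by
  unfold gadgetVertices
  split_ifs <;> simp

theorem toFinset_map_five {l : List ℕ} : (l.map (5 * ·)).toFinset = hat l.toFinset := by
  ext v
  simp [mem_hat]

theorem mem_toFam_gadgetEdges {r x : ℕ} {C : List ℕ} (hC : C.Nodup) {e : Finset ℕ} :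
    e ∈ toFam (gadgetEdges r x C) ↔ e = mainEdge r x C.toFinset ∨ e ∈ sideEdges r x C.toFinset := by
  have h := List.toFinset_card_of_nodup hC
  rw [mem_toFam]
  unfold gadgetEdges mainEdge sideEdges
  simp only [decide_eq_true_eq, beq_iff_eq, h]
  split_ifs <;> simp [toFinset_map_five, eq_comm (b := e)]

theorem toFinset_newVertices {r n : ℕ} {P W : List (List ℕ)} :
    (newVertices r n P W).toFinset = redVertices r (Finset.range n) (toFam P) (toFam W) := by
  ext v
  simp only [newVertices, List.mem_toFinset, List.mem_append, List.mem_map, List.mem_filter,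
    List.mem_range, isKept_iff, List.mem_flatMap, mem_representatives, mem_gadgetVertices,
    length_classOf, mem_redVertices, Finset.mem_range, and_assoc]

theorem nodup_newVertices {r n : ℕ} {P W : List (List ℕ)} : (newVertices r n P W).Nodup := by
  unfold newVertices
  refine List.Nodup.append ?_ ?_ ?_
  · exact (List.nodup_range.filter _).map fun a b (h : 5 * a = 5 * b) => by omega
  · refine List.nodup_flatMap.2 ⟨fun x _ => nodup_gadgetVertices, ?_⟩
    refine (nodup_representatives (n := n) (P := P) (W := W)).imp fun {x y} hxy v hv hv' => hxy ?_
    obtain ⟨-, i, _, _, -, h⟩ := mem_sideVertices (mem_gadgetVertices.1 hv)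
    obtain ⟨-, j, _, _, -, h'⟩ := mem_sideVertices (mem_gadgetVertices.1 hv')
    omega
  · intro v hv hv'
    obtain ⟨x, -, rfl⟩ := List.mem_map.1 hv
    obtain ⟨y, -, hy⟩ := List.mem_flatMap.1 hv'
    obtain ⟨-, j, _, _, -, h'⟩ := mem_sideVertices (mem_gadgetVertices.1 hy)
    omega

theorem toFam_newBlack {r n : ℕ} {P W : List (List ℕ)} :
    toFam (newBlack r n P W) = redBlack r (Finset.range n) (toFam P) (toFam W) := by
  ext e
  have : e ∈ toFam (newBlack r n P W) ↔
      ∃ x ∈ representatives n P W, e ∈ toFam (gadgetEdges r x (classOf n P x)) := by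
    simp only [mem_toFam, newBlack, List.mem_flatMap]
    exact ⟨fun ⟨l, ⟨x, hx, hl⟩, h⟩ => ⟨x, hx, l, hl, h⟩, fun ⟨x, hx, l, hl, h⟩ => ⟨l, ⟨x, hx, hl⟩, h⟩⟩
  rw [this, mem_redBlack]
  simp only [mem_representatives, mem_toFam_gadgetEdges nodup_classOf, toFinset_classOf]

theorem toFam_newWhite {W : List (List ℕ)} : toFam (newWhite W) = redWhite (toFam W) := by
  ext e
  simp only [newWhite, mem_toFam, List.mem_map, redWhite, Finset.mem_image]
  constructor
  · rintro ⟨_, ⟨l, hl, rfl⟩, rfl⟩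
    exact ⟨_, ⟨l, hl, rfl⟩, toFinset_map_five.symm⟩
  · rintro ⟨_, ⟨l, hl, rfl⟩, rfl⟩
    exact ⟨_, ⟨l, hl, rfl⟩, toFinset_map_five⟩

theorem toFam_append {L K : List (List ℕ)} : toFam (L ++ K) = toFam L ∪ toFam K := by
  simp [toFam]

/-- Every set is listed once, and so are its members. -/
def Simple (L : List (List ℕ)) : Prop := (∀ l ∈ L, l.Nodup) ∧ (L.map List.toFinset).Nodup

theorem Simple.nil : Simple [] := by simp [Simple]

theorem Simple.filter {L : List (List ℕ)} (h : Simple L) (p : List ℕ → Bool) :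
    Simple (L.filter p) :=
  ⟨fun l hl => h.1 l (List.mem_of_mem_filter hl), h.2.sublist (List.filter_sublist.map _)⟩

theorem Simple.card_toFam {L : List (List ℕ)} (h : Simple L) : (toFam L).card = L.length := by
  rw [toFam, List.toFinset_card_of_nodup h.2, List.length_map]

theorem Simple.append {L K : List (List ℕ)} (hL : Simple L) (hK : Simple K)
    (h : ∀ e ∈ toFam K, e ∉ toFam L) : Simple (L ++ K) := by
  refine ⟨fun l hl => (List.mem_append.1 hl).elim (hL.1 l) (hK.1 l), ?_⟩
  rw [List.map_append]
  refine hL.2.append hK.2 fun e he he' => h e ?_ ?_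
  · exact List.mem_toFinset.2 he'
  · exact List.mem_toFinset.2 he

theorem simple_newWhite {W : List (List ℕ)} (h : Simple W) : Simple (newWhite W) := by
  refine ⟨fun l hl => ?_, ?_⟩
  · obtain ⟨m, hm, rfl⟩ := List.mem_map.1 hl
    exact (h.1 m hm).map fun a b (h : 5 * a = 5 * b) => by omega
  · have : (newWhite W).map List.toFinset = (W.map List.toFinset).map hat := by
      simp [newWhite, toFinset_map_five]
    rw [this]
    exact h.2.map hat_injective

theorem simple_gadgetEdges {r x : ℕ} {C : List ℕ} (hC : C.Nodup) (hx : x ∈ C) :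
    Simple (gadgetEdges r x C) := by
  have hC' : (C.map (5 * ·)).Nodup := hC.map fun a b (h : 5 * a = 5 * b) => by omega
  have hn : 5 * x + 1 ∉ C.map (5 * ·) := by
    intro h
    obtain ⟨y, -, h⟩ := List.mem_map.1 h
    replace h : 5 * y = 5 * x + 1 := h
    omega
  have hne : ∀ s : Finset ℕ, 5 * x ∉ s → insert (5 * x + 1) (hat C.toFinset) ≠ s := by
    rintro s hs rfl
    exact hs (Finset.mem_insert_of_mem (five_mul_mem_hat.2 (List.mem_toFinset.2 hx)))
  unfold gadgetEdges
  split_ifs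
  · refine ⟨fun l hl => ?_, ?_⟩
    · simp only [List.mem_cons, List.not_mem_nil, or_false] at hl
      rcases hl with rfl | rfl
      · exact List.nodup_cons.2 ⟨hn, hC'⟩
      · simp
    · have := hne {5 * x + 1, 5 * x + 2} (by simp)
      simpa [toFinset_map_five] using this
  · refine ⟨fun l hl => ?_, ?_⟩
    · simp only [List.mem_cons, List.not_mem_nil, or_false] at hl
      rcases hl with rfl | rfl | rfl
      · exact List.nodup_cons.2 ⟨hn, hC'⟩
      · simp
      · simp
    · have h₁ := hne {5 * x + 1, 5 * x + 2, 5 * x + 3} (by simp)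
      have h₂ := hne {5 * x + 3, 5 * x + 4} (by simp)
      have h₃ : ({5 * x + 1, 5 * x + 2, 5 * x + 3} : Finset ℕ) ≠ {5 * x + 3, 5 * x + 4} := by
        intro h
        have : 5 * x + 1 ∈ ({5 * x + 3, 5 * x + 4} : Finset ℕ) := h ▸ by simp
        simp at this
      simp [toFinset_map_five, h₁, h₂, h₃]
  · simp [Simple, hC']

theorem simple_newBlack {r n : ℕ} {P W : List (List ℕ)} : Simple (newBlack r n P W) := by
  have hmem : ∀ x ∈ representatives n P W, x ∈ classOf n P x := fun x hx => by
    rw [← List.mem_toFinset, toFinset_classOf, mem_classFinset]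
    exact ⟨(mem_representatives.1 hx).1, .refl _ _⟩
  refine ⟨fun l hl => ?_, ?_⟩
  · obtain ⟨x, hx, hl⟩ := List.mem_flatMap.1 hl
    exact (simple_gadgetEdges nodup_classOf (hmem x hx)).1 l hl
  · rw [newBlack, List.map_flatMap]
    refine List.nodup_flatMap.2
      ⟨fun x hx => (simple_gadgetEdges nodup_classOf (hmem x hx)).2, ?_⟩
    refine List.Pairwise.imp_of_mem ?_ nodup_representatives
    intro x y hx hy hxy e he he'
    have h₁ := (mem_toFam_gadgetEdges nodup_classOf).1 (List.mem_toFinset.2 he)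
    have h₂ := (mem_toFam_gadgetEdges nodup_classOf).1 (List.mem_toFinset.2 he')
    have hX := mem_representatives.1 hx
    have hY := mem_representatives.1 hy
    rw [toFinset_classOf] at h₁ h₂
    have hxx : x ∈ classFinset (Finset.range n) (toFam P) x := mem_classFinset.2 ⟨hX.1, .refl _ _⟩
    have hyy : y ∈ classFinset (Finset.range n) (toFam P) y := mem_classFinset.2 ⟨hY.1, .refl _ _⟩
    rcases h₁ with rfl | h₁ <;> rcases h₂ with h₂ | h₂
    · have : 5 * x ∈ mainEdge r y (classFinset (Finset.range n) (toFam P) y) := by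
        rw [← h₂, five_mul_mem_mainEdge]
        exact hxx
      rw [five_mul_mem_mainEdge, mem_classFinset] at this
      exact hxy (hX.eq_of_unsep hY this.2.symm)
    · exact five_mul_notMem_of_mem_sideEdges h₂ (five_mul_mem_mainEdge.2 hxx)
    · rw [h₂] at h₁
      exact five_mul_notMem_of_mem_sideEdges h₁ (five_mul_mem_mainEdge.2 hyy)
    · by_cases h2 : r = 2
      · obtain ⟨-, rfl⟩ := (mem_sideEdges_two h2).1 h₁
        obtain ⟨-, h⟩ := (mem_sideEdges_two h2).1 h₂
        have : 5 * x + 1 ∈ ({5 * y + 1, 5 * y + 2} : Finset ℕ) := h ▸ by simp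
        simp at this
        omega
      -- Both side edges contain `5 * x + 3`, which identifies `x`.
      · have key : 5 * x + 3 ∈ e := by
          obtain ⟨-, rfl | rfl⟩ := (mem_sideEdges h2).1 h₁ <;> simp
        obtain ⟨-, rfl | rfl⟩ := (mem_sideEdges h2).1 h₂ <;> simp at key <;> omega

/-! ### Renaming vertices by rank -/

theorem rank_eq {l : List ℕ} (hl : l.Nodup) (v : ℕ) :
    rank l v = (l.toFinset.filter (· < v)).card := by
  rw [rank, ← List.toFinset_card_of_nodup (hl.filter _), List.toFinset_filter]
  simp

theorem rank_lt {l : List ℕ} (hl : l.Nodup) {v : ℕ} (hv : v ∈ l) : rank l v < l.length := by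
  rw [rank_eq hl, ← List.toFinset_card_of_nodup hl]
  refine Finset.card_lt_card (Finset.filter_ssubset.2 ⟨v, List.mem_toFinset.2 hv, by simp⟩)

theorem rank_strictMono {l : List ℕ} (hl : l.Nodup) {v w : ℕ} (hv : v ∈ l) (hvw : v < w) :
    rank l v < rank l w := by
  rw [rank_eq hl, rank_eq hl]
  refine Finset.card_lt_card (Finset.ssubset_iff_of_subset ?_ |>.2 ⟨v, ?_, ?_⟩)
  · intro a ha
    rw [Finset.mem_filter] at ha ⊢
    exact ⟨ha.1, ha.2.trans hvw⟩
  · simp [hv, hvw]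
  · simp

theorem rank_injOn {l : List ℕ} (hl : l.Nodup) : Set.InjOn (rank l) (l.toFinset : Set ℕ) := by
  intro v hv w hw h
  rw [Finset.mem_coe, List.mem_toFinset] at hv hw
  rcases lt_trichotomy v w with hlt | rfl | hlt
  · exact absurd h (rank_strictMono hl hv hlt).ne
  · rfl
  · exact absurd h.symm (rank_strictMono hl hw hlt).ne

theorem image_rank {l : List ℕ} (hl : l.Nodup) :
    l.toFinset.image (rank l) = Finset.range l.length := by
  refine Finset.eq_of_subset_of_card_le (fun v hv => ?_) ?_
  · obtain ⟨w, hw, rfl⟩ := Finset.mem_image.1 hv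
    exact Finset.mem_range.2 (rank_lt hl (List.mem_toFinset.1 hw))
  · rw [Finset.card_range, Finset.card_image_of_injOn (rank_injOn hl),
      List.toFinset_card_of_nodup hl]

theorem toFam_relabel {l : List ℕ} {L : List (List ℕ)} :
    toFam (relabel l L) = (toFam L).image (Finset.image (rank l)) := by
  ext e
  simp only [relabel, mem_toFam, List.mem_map, Finset.mem_image]
  constructor
  · rintro ⟨_, ⟨m, hm, rfl⟩, rfl⟩
    exact ⟨_, ⟨m, hm, rfl⟩, by ext; simp⟩
  · rintro ⟨_, ⟨m, hm, rfl⟩, rfl⟩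
    exact ⟨_, ⟨m, hm, rfl⟩, by ext; simp⟩

end

/-! ### Relabelling -/

section

variable {α β : Type*} [DecidableEq β] {f : α → β} {V : Finset α}

theorem mem_image_iff_of_injOn (hf : Set.InjOn f V) {e : Finset α} (he : e ⊆ V) {x : α}
    (hx : x ∈ V) : f x ∈ e.image f ↔ x ∈ e := by
  rw [Finset.mem_image]
  constructor
  · rintro ⟨y, hy, h⟩
    rwa [← hf (he hy) hx h]
  · exact fun h => ⟨x, h, rfl⟩

theorem image_injOn_powerset (hf : Set.InjOn f V) {e e' : Finset α} (he : e ⊆ V) (he' : e' ⊆ V)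
    (h : e.image f = e'.image f) : e = e' := by
  ext x
  constructor
  · intro hx
    rw [← mem_image_iff_of_injOn hf he' (he hx), ← h]
    exact Finset.mem_image_of_mem f hx
  · intro hx
    rw [← mem_image_iff_of_injOn hf he (he' hx), h]
    exact Finset.mem_image_of_mem f hx

theorem coversOn_image_iff (hf : Set.InjOn f V) {T : Finset (Finset α)} (hT : ∀ e ∈ T, e ⊆ V) :
    CoversOn (V.image f) (T.image (Finset.image f)) ↔ CoversOn V T := by
  have key : ∀ e ∈ T, ∀ x ∈ V, ∀ y ∈ V, Splits (e.image f) (f x) (f y) ↔ Splits e x y := by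
    intro e he x hx y hy
    unfold Splits
    rw [mem_image_iff_of_injOn hf (hT e he) hx, mem_image_iff_of_injOn hf (hT e he) hy]
  constructor
  · intro h x hx y hy hxy
    obtain ⟨e, he, hs⟩ := h (f x) (Finset.mem_image_of_mem f hx) (f y)
      (Finset.mem_image_of_mem f hy) fun h => hxy (hf hx hy h)
    obtain ⟨e, heT, rfl⟩ := Finset.mem_image.1 he
    exact ⟨e, heT, (key e heT x hx y hy).1 hs⟩
  · intro h x hx y hy hxy
    obtain ⟨x, hxV, rfl⟩ := Finset.mem_image.1 hx
    obtain ⟨y, hyV, rfl⟩ := Finset.mem_image.1 hy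
    obtain ⟨e, he, hs⟩ := h x hxV y hyV fun h => hxy (h ▸ rfl)
    exact ⟨_, Finset.mem_image_of_mem _ he, (key e he x hxV y hyV).2 hs⟩

theorem card_image_image (hf : Set.InjOn f V) {T : Finset (Finset α)} (hT : ∀ e ∈ T, e ⊆ V) :
    (T.image (Finset.image f)).card = T.card :=
  Finset.card_image_of_injOn fun _ he _ he' h => image_injOn_powerset hf (hT _ he) (hT _ he') h

theorem solvable_image_iff (hf : Set.InjOn f V) {E B : Finset (Finset α)} (hE : ∀ e ∈ E, e ⊆ V)
    (hB : B ⊆ E) {k : ℕ} :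
    Solvable (V.image f) (E.image (Finset.image f)) (B.image (Finset.image f)) k ↔
      Solvable V E B k := by
  constructor
  · rintro ⟨T, hT, hBT, hc, hk⟩
    obtain ⟨T, hTE, rfl⟩ := Finset.subset_image_iff.1 hT
    have hTV : ∀ e ∈ T, e ⊆ V := fun e he => hE e (hTE he)
    refine ⟨T, hTE, fun e he => ?_, (coversOn_image_iff hf hTV).1 hc, ?_⟩
    · obtain ⟨e', he', h⟩ := Finset.mem_image.1 (hBT (Finset.mem_image_of_mem _ he))
      rwa [← image_injOn_powerset hf (hTV e' he') (hE e (hB he)) h]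
    · rwa [card_image_image hf hTV, card_image_image hf hE] at hk
  · rintro ⟨T, hTE, hBT, hc, hk⟩
    have hTV : ∀ e ∈ T, e ⊆ V := fun e he => hE e (hTE he)
    refine ⟨_, Finset.image_subset_image hTE, Finset.image_subset_image hBT,
      (coversOn_image_iff hf hTV).2 hc, ?_⟩
    rwa [card_image_image hf hTV, card_image_image hf hE]

end

open Enc

/-! ### Correctness of the kernelization on lists -/

section

/-- The lists describe an instance. -/
structure Valid (r : ℕ) (I : RawInst) : Prop where
  simple_edges : Simple I.2.2.1
  simple_black : Simple I.2.2.2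
  lt : ∀ l ∈ I.2.2.1, ∀ v ∈ l, v < I.1
  black_subset : toFam I.2.2.2 ⊆ toFam I.2.2.1
  card_le : ∀ e ∈ toFam I.2.2.1, e.card ≤ r
  covers : CoversOn (Finset.range I.1) (toFam I.2.2.1)

theorem Valid.edge_subset {r : ℕ} {I : RawInst} (h : Valid r I) :
    ∀ e ∈ toFam I.2.2.1, e ⊆ Finset.range I.1 := by
  intro e he v hv
  obtain ⟨l, hl, rfl⟩ := mem_toFam.1 he
  exact Finset.mem_range.2 (h.lt l hl v (List.mem_toFinset.1 hv))

def RawYes (I : RawInst) : Prop :=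
  Solvable (Finset.range I.1) (toFam I.2.2.1) (toFam I.2.2.2) I.2.1

/-- No removable edge with a pendant vertex is far from the other removable edges. -/
def NoFar (V : Finset ℕ) (E B : Finset (Finset ℕ)) : Prop :=
  ∀ e ∈ white V E B, Pendant E e → ¬Far V E ((E \ innerWhite V E B).erase e) e

/-- One application suffices: once there is an isolated vertex, no removable edge has a pendant
vertex and `NoFar` holds vacuously. -/
theorem addIsolated_spec {r : ℕ} {I : RawInst} (h : Valid r I) :
    Valid r (addIsolated I) ∧ (RawYes I ↔ RawYes (addIsolated I)) ∧
      (addIsolated I).2.1 ≤ I.2.1 ∧ (addIsolated I).2.2.2 = I.2.2.2 ∧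
      NoFar (Finset.range (addIsolated I).1) (toFam (addIsolated I).2.2.1)
        (toFam (addIsolated I).2.2.2) := by
  obtain ⟨n, k, L, B⟩ := I
  have hV := h.edge_subset
  simp only at hV
  have hany : (((whiteEdges n L B).any fun e => hasPendant L e && isFar n L
      (diffSet (diffSet L ((whiteEdges n L B).filter fun e => !hasPendant L e)) [e]) e) = true) ↔
      ∃ e ∈ white (Finset.range n) (toFam L) (toFam B), Pendant (toFam L) e ∧
        Far (Finset.range n) (toFam L)
          ((toFam L \ innerWhite (Finset.range n) (toFam L) (toFam B)).erase e) e := by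
    simp only [List.any_eq_true, Bool.and_eq_true, hasPendant_iff, isFar_iff,
      toFam_diffSet_singleton]
    simp only [toFam_diffSet, toFam_inner]
    rw [← toFam_whiteEdges]
    constructor
    · rintro ⟨l, hl, h₁⟩
      exact ⟨_, toFinset_mem_toFam hl, h₁⟩
    · rintro ⟨e, he, h₁⟩
      obtain ⟨l, hl, rfl⟩ := mem_toFam.1 he
      exact ⟨l, hl, h₁⟩
  unfold addIsolated
  dsimp only
  split_ifs with hc
  · obtain ⟨e, he, hp, hf⟩ := hany.1 hc
    have hz : n ∉ Finset.range n := by simp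
    obtain ⟨h₁, h₂⟩ := solvable_insert_iff (k := k) hV h.covers h.black_subset hz he hp hf
    rw [← Finset.range_add_one] at h₁ h₂
    refine ⟨⟨h.simple_edges, h.simple_black, fun l hl v hv => (h.lt l hl v hv).trans n.lt_succ_self,
      h.black_subset, h.card_le, h₁⟩, h₂, Nat.sub_le _ _, rfl, fun e he hp => ?_⟩
    refine absurd hp (not_pendant_of_isolated (z := n) (fun f hf v hv => ?_) (by simp) ?_ he)
    · have := Finset.mem_range.1 (hV f hf hv)
      exact Finset.mem_range.2 (by omega)
    · exact fun f hf hn => hz (hV f hf hn)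
  · exact ⟨h, Iff.rfl, le_rfl, rfl, fun e he hp hf => hc (hany.2 ⟨e, he, hp, hf⟩)⟩

theorem solvable_of_nil {V : Finset ℕ} {B : Finset (Finset ℕ)} (h : B ⊆ ∅) (hV : V = ∅) :
    Solvable V ∅ B 0 :=
  ⟨∅, subset_rfl, h, by simp [CoversOn, hV], by simp⟩

/-- The third conclusion is for the problem without black edges: if the input has none, the black
marks of the output may be erased. -/
theorem shrink_spec {r : ℕ} (hr₂ : 2 ≤ r) {I : RawInst} (h : Valid r I)
    (hf : NoFar (Finset.range I.1) (toFam I.2.2.1) (toFam I.2.2.2)) :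
    Valid r (shrink r I) ∧ (RawYes I ↔ RawYes (shrink r I)) ∧
      (I.2.2.2 = [] → (RawYes I ↔ RawYes
        ((shrink r I).1, (shrink r I).2.1, (shrink r I).2.2.1, []))) ∧
      (shrink r I).1 ≤ 1 + 6 * (r * whiteBound r I.2.1) ∧ (shrink r I).2.1 ≤ I.2.1 ∧
      (shrink r I).2.2.1.length ≤ 4 * (r * whiteBound r I.2.1) := by
  obtain ⟨n, k, L, B⟩ := I
  have hV := h.edge_subset
  have hE := h.covers
  have hB := h.black_subset
  have hr := h.card_le
  simp only at hV hE hB hr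
  set V := Finset.range n with hVn
  have hWs : Simple (whiteEdges n L B) := h.simple_edges.filter _
  have hWw : toFam (whiteEdges n L B) = white V (toFam L) (toFam B) := toFam_whiteEdges
  unfold shrink
  dsimp only
  split_ifs with hc
  · rw [decide_eq_true_eq, ← hWs.card_toFam, hWw] at hc
    have hyes := solvable_of_whiteBound_lt hr₂ hr hV hE hB hf hc
    have htriv : RawYes (0, 0, [], []) := solvable_of_nil (by simp [toFam]) (by simp)
    have hyes' : RawYes (n, k, L, B) := hyes
    refine ⟨⟨.nil, .nil, by simp, by simp, by simp [toFam], by simp [CoversOn]⟩,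
      iff_of_true hyes' htriv, fun _ => iff_of_true hyes' htriv, by simp, by simp, by simp⟩
  · rw [decide_eq_true_eq, not_lt, ← hWs.card_toFam] at hc
    set W := toFam (whiteEdges n L B) with hW
    have hWE : W ⊆ toFam L := hWw ▸ white_subset
    have hP : toFam (diffSet L (whiteEdges n L B)) = toFam L \ W := toFam_diffSet
    set l := newVertices r n (diffSet L (whiteEdges n L B)) (whiteEdges n L B) with hl
    set G := newBlack r n (diffSet L (whiteEdges n L B)) (whiteEdges n L B) with hG
    have hlV : l.toFinset = redVertices r V (toFam L \ W) W := by
      rw [hl, toFinset_newVertices, hP]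
    have hln : l.Nodup := nodup_newVertices
    have hGf : toFam G = redBlack r V (toFam L \ W) W := by rw [hG, toFam_newBlack, hP]
    have hEf : toFam (newWhite (whiteEdges n L B) ++ G) =
        redWhite W ∪ redBlack r V (toFam L \ W) W := by
      rw [toFam_append, toFam_newWhite, hGf]
    have hdisj : ∀ e ∈ toFam G, e ∉ toFam (newWhite (whiteEdges n L B)) := by
      rw [hGf, toFam_newWhite]
      exact fun e he => redBlack_disjoint (fun e he => (Finset.mem_sdiff.1 he).2)
        (fun e he => hr e (Finset.mem_sdiff.1 he).1) he
    have hEs : Simple (newWhite (whiteEdges n L B) ++ G) :=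
      (simple_newWhite hWs).append simple_newBlack hdisj
    have hsub : ∀ e ∈ redWhite W ∪ redBlack r V (toFam L \ W) W,
        e ⊆ redVertices r V (toFam L \ W) W := fun e he => red_edge_subset hV hWE he
    have hinj : Set.InjOn (rank l) (redVertices r V (toFam L \ W) W : Finset ℕ) :=
      hlV ▸ rank_injOn hln
    have himg : (redVertices r V (toFam L \ W) W).image (rank l) = Finset.range l.length :=
      hlV ▸ image_rank hln
    have hrel : ∀ K : List (List ℕ), Simple K → (∀ e ∈ toFam K,
        e ⊆ redVertices r V (toFam L \ W) W) → Simple (relabel l K) := by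
      intro K hK hKV
      have hmem : ∀ m ∈ K, ∀ v ∈ m, v ∈ (redVertices r V (toFam L \ W) W) :=
        fun m hm v hv => hKV _ (toFinset_mem_toFam hm) (List.mem_toFinset.2 hv)
      refine ⟨fun m hm => ?_, ?_⟩
      · obtain ⟨m, hmK, rfl⟩ := List.mem_map.1 hm
        exact (hK.1 m hmK).map_on fun v hv w hw h => hinj (hmem m hmK v hv) (hmem m hmK w hw) h
      · have : (relabel l K).map List.toFinset =
            (K.map List.toFinset).map (Finset.image (rank l)) := by
          simp only [relabel, List.map_map]
          refine List.map_congr_left fun m _ => ?_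
          ext; simp
        rw [this]
        refine hK.2.map_on fun e he e' he' h => ?_
        exact image_injOn_powerset hinj (hKV e (List.mem_toFinset.2 he))
          (hKV e' (List.mem_toFinset.2 he')) h
    have hlen : l.length = (redVertices r V (toFam L \ W) W).card := by
      rw [← hlV, List.toFinset_card_of_nodup hln]
    have hcov := coversOn_red (r := r) hE hWE hr
    -- Stated for arbitrary `G'` because it is used both for the new black edges and for `∅`.
    have hsolve : ∀ G' ⊆ redWhite W ∪ redBlack r V (toFam L \ W) W,
        (Solvable (Finset.range l.length) (toFam (relabel l (newWhite (whiteEdges n L B) ++ G)))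
          (G'.image (Finset.image (rank l))) k ↔ Solvable (redVertices r V (toFam L \ W) W)
            (redWhite W ∪ redBlack r V (toFam L \ W) W) G' k) := by
      intro G' hG'
      rw [← himg, toFam_relabel, hEf]
      exact solvable_image_iff hinj hsub hG'
    have hmain := solvable_red_iff (k := k) hE hB hr hWw
    refine ⟨⟨hrel _ hEs (hEf ▸ hsub), hrel _ simple_newBlack
      (hGf ▸ fun e he => hsub e (Finset.mem_union_right _ he)), ?_, ?_, ?_, ?_⟩, ?_, ?_, ?_,
      le_rfl, ?_⟩
    · intro m hm v hv
      obtain ⟨m, hmK, rfl⟩ := List.mem_map.1 hm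
      obtain ⟨v, hvm, rfl⟩ := List.mem_map.1 hv
      refine rank_lt hln ?_
      rw [← List.mem_toFinset, hlV]
      exact hsub _ (hEf ▸ toFinset_mem_toFam hmK) (List.mem_toFinset.2 hvm)
    · dsimp only
      rw [toFam_relabel, toFam_relabel, toFam_append]
      exact Finset.image_subset_image Finset.subset_union_right
    · dsimp only
      rw [toFam_relabel, hEf]
      intro e he
      obtain ⟨e, he', rfl⟩ := Finset.mem_image.1 he
      exact Finset.card_image_le.trans (card_red_edge_le hr₂ hr hWE he')
    · dsimp only
      rw [toFam_relabel, hEf, ← himg]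
      exact (coversOn_image_iff hinj hsub).2 hcov
    · refine Iff.trans hmain (Iff.trans (hsolve _ Finset.subset_union_right).symm ?_)
      unfold RawYes
      dsimp only
      rw [toFam_relabel (L := G), hGf]
    · intro hnil
      subst hnil
      have hforce : ∀ g ∈ redBlack r V (toFam L \ W) W, _ := fun g hg =>
        not_coversOn_erase_redBlack hr hE hf hWw hg
      refine Iff.trans hmain (Iff.trans (solvable_empty_iff hforce).symm ?_)
      refine Iff.trans (hsolve ∅ (Finset.empty_subset _)).symm ?_
      unfold RawYes
      dsimp only
      rw [Finset.image_empty]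
      rfl
    · dsimp only
      rw [hlen]
      refine (card_redVertices_le hE hr hWE).trans ?_
      gcongr
    · have : (relabel l (newWhite (whiteEdges n L B) ++ G)).length =
          (redWhite W ∪ redBlack r V (toFam L \ W) W).card := by
        rw [← hEf, hEs.card_toFam, relabel, List.length_map]
      dsimp only
      rw [this]
      refine (card_redEdges_le (by omega) hr hWE).trans ?_
      gcongr

theorem whiteBound_mono (r : ℕ) : Monotone (whiteBound r) := by
  intro a b h
  unfold whiteBound
  gcongr

theorem kernelize_spec {r : ℕ} (hr₂ : 2 ≤ r) {I : RawInst} (h : Valid r I) :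
    Valid r (kernelize r I) ∧ (RawYes I ↔ RawYes (kernelize r I)) ∧
      (I.2.2.2 = [] → (RawYes I ↔ RawYes
        ((kernelize r I).1, (kernelize r I).2.1, (kernelize r I).2.2.1, []))) ∧
      (kernelize r I).1 ≤ 1 + 6 * (r * whiteBound r I.2.1) ∧ (kernelize r I).2.1 ≤ I.2.1 ∧
      (kernelize r I).2.2.1.length ≤ 4 * (r * whiteBound r I.2.1) := by
  obtain ⟨h₁, h₂, h₃, h₄, h₅⟩ := addIsolated_spec h
  obtain ⟨g₁, g₂, g₃, g₄, g₅, g₆⟩ := shrink_spec hr₂ h₁ h₅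
  have hb := whiteBound_mono r h₃
  exact ⟨g₁, h₂.trans g₂, fun hB => h₂.trans (g₃ (h₄.trans hB)), g₄.trans (by gcongr),
    g₅.trans h₃, g₆.trans (by gcongr)⟩

/-! ### Encoded instances and lists -/

/-- Distinctness matters: if `x = y` lies in `e`, then `{x, y} ∩ e` has one element although `e`
splits nothing. -/
theorem separates_iff {V : Type*} [DecidableEq V] {e : Finset V} {x y : V} (hxy : x ≠ y) :
    Separates e x y ↔ Splits e x y := by
  unfold Separates Splits
  by_cases hx : x ∈ e <;> by_cases hy : y ∈ e
  · rw [Finset.inter_eq_left.2 (by simp [Finset.insert_subset_iff, hx, hy]), Finset.card_pair hxy]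
    simp [hx, hy]
  · simp [Finset.insert_inter_of_mem hx, Finset.singleton_inter_of_notMem hy, hx, hy]
  · simp [Finset.insert_inter_of_notMem hx, Finset.singleton_inter_of_mem hy, hx, hy]
  · simp [Finset.insert_inter_of_notMem hx, Finset.singleton_inter_of_notMem hy, hx, hy]

theorem isTestCover_iff {V : Type*} [DecidableEq V] [Fintype V] {T : Finset (Finset V)} :
    IsTestCover T ↔ CoversOn Finset.univ T :=
  ⟨fun h x _ y _ hxy =>
      let ⟨e, he, hs⟩ := h x y hxy
      ⟨e, he, (separates_iff hxy).1 hs⟩,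
    fun h x y hxy =>
      let ⟨e, he, hs⟩ := h x (Finset.mem_univ x) y (Finset.mem_univ y) hxy
      ⟨e, he, (separates_iff hxy).2 hs⟩⟩

theorem SubsetInstance.yes_iff {r : ℕ} (I : SubsetInstance r) :
    I.Yes ↔ Solvable Finset.univ I.edges I.black I.k := by
  unfold SubsetInstance.Yes Solvable
  simp only [isTestCover_iff]

theorem TestInstance.yes_iff {r : ℕ} (I : TestInstance r) :
    I.Yes ↔ Solvable Finset.univ I.edges ∅ I.k := by
  unfold TestInstance.Yes Solvable
  simp only [isTestCover_iff, Finset.empty_subset, true_and]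

theorem image_val_univ (n : ℕ) : (Finset.univ : Finset (Fin n)).image Fin.val = Finset.range n := by
  ext v
  simp only [Finset.mem_image, Finset.mem_univ, true_and, Finset.mem_range]
  exact ⟨fun ⟨a, h⟩ => h ▸ a.2, fun h => ⟨⟨v, h⟩, rfl⟩⟩

theorem injOn_val (n : ℕ) :
    Set.InjOn (Fin.val : Fin n → ℕ) ((Finset.univ : Finset (Fin n)) : Set (Fin n)) :=
  Fin.val_injective.injOn

/-- The family of sets of natural numbers that corresponds to a family of sets of vertices. -/
def valFam {n : ℕ} (E : Finset (Finset (Fin n))) : Finset (Finset ℕ) :=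
  E.image (Finset.image Fin.val)

theorem card_valFam {n : ℕ} (E : Finset (Finset (Fin n))) : (valFam E).card = E.card :=
  Finset.card_image_of_injective _ (Finset.image_injective Fin.val_injective)

theorem valFam_subset_iff {n : ℕ} {E B : Finset (Finset (Fin n))} : valFam B ⊆ valFam E ↔ B ⊆ E :=
  Finset.image_subset_image_iff (Finset.image_injective Fin.val_injective)

theorem solvable_valFam {n k : ℕ} {E B : Finset (Finset (Fin n))} (hB : B ⊆ E) :
    Solvable (Finset.range n) (valFam E) (valFam B) k ↔ Solvable Finset.univ E B k := by
  rw [← image_val_univ]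
  exact solvable_image_iff (injOn_val n) (fun e _ => Finset.subset_univ e) hB

theorem coversOn_valFam {n : ℕ} {E : Finset (Finset (Fin n))} :
    CoversOn (Finset.range n) (valFam E) ↔ IsTestCover E := by
  rw [← image_val_univ, isTestCover_iff]
  exact coversOn_image_iff (injOn_val n) fun e _ => Finset.subset_univ e

theorem card_le_valFam {n r : ℕ} {E : Finset (Finset (Fin n))} :
    (∀ e ∈ valFam E, e.card ≤ r) ↔ ∀ e ∈ E, e.card ≤ r := by
  unfold valFam
  rw [Finset.forall_mem_image]
  simp only [Finset.card_image_of_injective _ Fin.val_injective]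

theorem toFinset_map_val {n : ℕ} (l : List (Fin n)) :
    (l.map Fin.val).toFinset = l.toFinset.image Fin.val := by
  ext; simp

theorem map_toFinset_map_val {n : ℕ} (L : List (List (Fin n))) :
    (L.map (List.map Fin.val)).map List.toFinset =
      (L.map List.toFinset).map (Finset.image Fin.val) := by
  simp only [List.map_map]
  exact List.map_congr_left fun l _ => toFinset_map_val l

theorem toFam_map_val {n : ℕ} (L : List (List (Fin n))) {E : Finset (Finset (Fin n))}
    (hE : ∀ e, e ∈ E ↔ e ∈ L.map List.toFinset) : toFam (L.map (List.map Fin.val)) = valFam E := by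
  ext e
  rw [toFam, map_toFinset_map_val, List.mem_toFinset, List.mem_map, valFam, Finset.mem_image]
  simp only [hE]

theorem enc_map_val {n : ℕ} (L : List (List (Fin n))) :
    enc (L.map (List.map Fin.val)) = encList (L.map fun l => encList (l.map fun v => encNat v.val)) := by
  simp [enc, Function.comp_def]

/-- Whatever order an encoding uses, it is the encoding of some duplicate-free list, and the list
functions are correct for all of these. -/
theorem EncodesEdges.exists_list {n : ℕ} {E : Finset (Finset (Fin n))} {d : Data}
    (h : EncodesEdges E d) : ∃ L : List (List ℕ), enc L = d ∧ Simple L ∧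
      (∀ l ∈ L, ∀ v ∈ l, v < n) ∧ toFam L = valFam E := by
  obtain ⟨L, h₁, h₂, h₃, rfl⟩ := h
  refine ⟨L.map (List.map Fin.val), enc_map_val L, ⟨fun l hl => ?_, ?_⟩, fun l hl v hv => ?_,
    toFam_map_val L h₃⟩
  · obtain ⟨l, hlL, rfl⟩ := List.mem_map.1 hl
    exact (h₁ l hlL).map Fin.val_injective
  · rw [map_toFinset_map_val]
    exact h₂.map (Finset.image_injective Fin.val_injective)
  · obtain ⟨l, hl, rfl⟩ := List.mem_map.1 hl
    obtain ⟨a, _, rfl⟩ := List.mem_map.1 hv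
    exact a.2

theorem exists_encodesEdges {n : ℕ} {L : List (List ℕ)} (hL : Simple L)
    (hn : ∀ l ∈ L, ∀ v ∈ l, v < n) :
    ∃ E : Finset (Finset (Fin n)), EncodesEdges E (enc L) ∧ toFam L = valFam E := by
  have h₁ : ∀ l : List ℕ, (∀ v ∈ l, v < n) → ∃ m : List (Fin n), m.map Fin.val = l := fun l hl =>
    ⟨l.pmap Fin.mk hl, by simp [List.map_pmap]⟩
  obtain ⟨M, rfl⟩ : ∃ M : List (List (Fin n)), M.map (List.map Fin.val) = L := by
    clear hL
    induction L with
    | nil => exact ⟨[], rfl⟩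
    | cons l L ih =>
      obtain ⟨M, hM⟩ := ih fun l hl => hn l (List.mem_cons_of_mem _ hl)
      obtain ⟨m, hm⟩ := h₁ l (hn l List.mem_cons_self)
      exact ⟨m :: M, by simp [hM, hm]⟩
  have hE : ∀ e, e ∈ (M.map List.toFinset).toFinset ↔ e ∈ M.map List.toFinset :=
    fun e => List.mem_toFinset
  refine ⟨(M.map List.toFinset).toFinset, ⟨M, fun l hl => ?_, ?_, hE, enc_map_val M⟩,
    toFam_map_val M hE⟩
  · exact (hL.1 _ (List.mem_map_of_mem hl)).of_map
  · have := hL.2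
    rw [map_toFinset_map_val] at this
    exact this.of_map

theorem SubsetInstance.Encodes.exists_raw {r : ℕ} {I : SubsetInstance r} {d : Data}
    (h : I.Encodes d) : ∃ R : RawInst, enc R = d ∧ R.2.1 = I.k ∧ Valid r R ∧ (I.Yes ↔ RawYes R) := by
  obtain ⟨dE, dB, hE, hB, rfl⟩ := h
  obtain ⟨L, rfl, hL, hlt, hLE⟩ := hE.exists_list
  obtain ⟨K, rfl, hK, -, hKB⟩ := hB.exists_list
  refine ⟨(I.n, I.k, L, K), rfl, rfl, ⟨hL, hK, hlt, ?_, ?_, ?_⟩, ?_⟩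
  · exact hLE ▸ hKB ▸ valFam_subset_iff.2 I.black_subset
  · exact hLE ▸ card_le_valFam.2 I.card_le
  · exact hLE ▸ coversOn_valFam.2 I.isTestCover
  · rw [I.yes_iff, ← solvable_valFam I.black_subset, ← hLE, ← hKB]
    rfl

theorem Valid.exists_subsetInstance {r : ℕ} {R : RawInst} (h : Valid r R) :
    ∃ I : SubsetInstance r, I.Encodes (enc R) ∧ I.n = R.1 ∧ I.k = R.2.1 ∧
      I.edges.card = R.2.2.1.length ∧ (I.Yes ↔ RawYes R) := by
  obtain ⟨n, k, L, K⟩ := R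
  obtain ⟨E, hE, hLE⟩ := exists_encodesEdges h.simple_edges h.lt
  obtain ⟨B, hB, hKB⟩ := exists_encodesEdges (n := n) h.simple_black (by
    intro l hl v hv
    have := h.edge_subset _ (h.black_subset (toFinset_mem_toFam hl)) (List.mem_toFinset.2 hv)
    exact Finset.mem_range.1 this)
  dsimp only at hE hLE hB hKB
  have hc := h.card_le
  have hcov := h.covers
  have hsub := h.black_subset
  dsimp only at hc hcov hsub
  rw [hLE] at hc hcov hsub
  rw [hKB] at hsub
  let I : SubsetInstance r := ⟨n, E, B, k, card_le_valFam.1 hc, coversOn_valFam.1 hcov,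
    valFam_subset_iff.1 hsub⟩
  refine ⟨I, ⟨_, _, hE, hB, rfl⟩, rfl, rfl, ?_, ?_⟩
  · rw [← h.simple_edges.card_toFam, ← card_valFam]
    exact congrArg _ hLE.symm
  · rw [I.yes_iff, ← solvable_valFam I.black_subset]
    unfold RawYes
    dsimp only
    rw [hLE, hKB]

theorem TestInstance.Encodes.exists_raw {r : ℕ} {I : TestInstance r} {d : Data}
    (h : I.Encodes d) : ∃ (n k : ℕ) (L : List (List ℕ)), enc (n, k, L) = d ∧ k = I.k ∧
      Valid r (n, k, L, []) ∧ (I.Yes ↔ RawYes (n, k, L, [])) := by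
  obtain ⟨dE, hE, rfl⟩ := h
  obtain ⟨L, rfl, hL, hlt, hLE⟩ := hE.exists_list
  refine ⟨I.n, I.k, L, rfl, rfl, ⟨hL, .nil, hlt, by simp [toFam], ?_, ?_⟩, ?_⟩
  · exact hLE ▸ card_le_valFam.2 I.card_le
  · exact hLE ▸ coversOn_valFam.2 I.isTestCover
  · rw [I.yes_iff, ← solvable_valFam (Finset.empty_subset _), ← hLE]
    rfl

theorem Valid.exists_testInstance {r n k : ℕ} {L K : List (List ℕ)} (h : Valid r (n, k, L, K)) :
    ∃ I : TestInstance r, I.Encodes (enc (n, k, L)) ∧ I.n = n ∧ I.k = k ∧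
      I.edges.card = L.length ∧ (I.Yes ↔ RawYes (n, k, L, [])) := by
  obtain ⟨E, hE, hLE⟩ := exists_encodesEdges h.simple_edges h.lt
  dsimp only at hE hLE
  have hc := h.card_le
  have hcov := h.covers
  dsimp only at hc hcov
  rw [hLE] at hc hcov
  let I : TestInstance r := ⟨n, E, k, card_le_valFam.1 hc, coversOn_valFam.1 hcov⟩
  refine ⟨I, ⟨_, hE, rfl⟩, rfl, rfl, ?_, ?_⟩
  · rw [← h.simple_edges.card_toFam, ← card_valFam]
    exact congrArg _ hLE.symm
  · rw [I.yes_iff, ← solvable_valFam (Finset.empty_subset _)]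
    unfold RawYes
    dsimp only
    rw [hLE]
    rfl

/-! ### The size of the kernel -/

theorem encSize_list_le {α : Type} [Enc α] {l : List α} {b : ℕ} (h : ∀ a ∈ l, encSize a ≤ b) :
    encSize l ≤ 1 + l.length * (1 + b) := by
  induction l with
  | nil => simp
  | cons a l ih =>
    have h₁ := ih fun a ha => h a (List.mem_cons_of_mem _ ha)
    have h₂ := h a List.mem_cons_self
    simp only [encSize_cons, List.length_cons, add_mul, one_mul]
    omega

theorem encSize_edges_le {n r : ℕ} {L : List (List ℕ)} (hL : Simple L)
    (hn : ∀ l ∈ L, ∀ v ∈ l, v < n) (hr : ∀ e ∈ toFam L, e.card ≤ r) :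
    encSize L ≤ 1 + L.length * (2 + r * (2 * n + 2)) := by
  refine (encSize_list_le (b := 1 + r * (2 * n + 2)) fun l hl => ?_).trans (by
    rw [← add_assoc])
  refine (encSize_list_le (b := 2 * n + 1) fun v hv => ?_).trans ?_
  · have := hn l hl v hv
    rw [encSize_nat]
    omega
  · have := hr _ (toFinset_mem_toFam hl)
    rw [List.toFinset_card_of_nodup (hL.1 l hl)] at this
    have := Nat.mul_le_mul_right (1 + (2 * n + 1)) this
    have h₂ : 1 + (2 * n + 1) = 2 * n + 2 := by ring
    rw [h₂] at this ⊢
    omega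

theorem Valid.encSize_le {r b c : ℕ} {n k : ℕ} {L K : List (List ℕ)} (h : Valid r (n, k, L, K))
    (hn : n ≤ b) (hL : L.length ≤ c) :
    encSize n + encSize k + encSize L + encSize K ≤
      2 * b + 2 * k + 4 + 2 * (c * (2 + r * (2 * b + 2))) := by
  have hK : K.length ≤ L.length := by
    rw [← h.simple_edges.card_toFam, ← h.simple_black.card_toFam]
    exact Finset.card_le_card h.black_subset
  have h₁ := encSize_edges_le h.simple_edges h.lt h.card_le
  have h₂ := encSize_edges_le (n := n) (r := r) h.simple_black (by
    intro l hl v hv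
    have := h.edge_subset _ (h.black_subset (toFinset_mem_toFam hl)) (List.mem_toFinset.2 hv)
    exact Finset.mem_range.1 this) fun e he => h.card_le e (h.black_subset he)
  dsimp only at h₁ h₂
  have h₃ : ∀ m ≤ c, m * (2 + r * (2 * n + 2)) ≤ c * (2 + r * (2 * b + 2)) := by
    intro m hm
    gcongr
  have h₄ := h₃ _ hL
  have h₅ := h₃ _ (hK.trans hL)
  rw [encSize_nat, encSize_nat]
  omega

/-- A polynomial bound for the size of the kernel together with the parameter. -/
noncomputable def sizeBound (r : ℕ) : Polynomial ℕ :=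
  let N : Polynomial ℕ := Polynomial.C (10 * r ^ 7) * Polynomial.X ^ 6
  2 * (1 + 6 * N) + 3 * Polynomial.X + 7 + 2 * (4 * N * (2 + Polynomial.C r * (2 * (1 + 6 * N) + 2)))

/-- `b` and `c` bound the numbers of vertices and edges, with `k - 1` relaxed to `k` to obtain a
polynomial. In `3 * k + 7`, one `k` is the output parameter and `3` of the `7` counts the pairing
nodes of a quadruple. -/
theorem sizeBound_spec {r k : ℕ} : ∃ b c, 1 + 6 * (r * whiteBound r k) ≤ b ∧
    4 * (r * whiteBound r k) ≤ c ∧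
    (sizeBound r).eval k = 2 * b + 3 * k + 7 + 2 * (c * (2 + r * (2 * b + 2))) := by
  have h : r * whiteBound r k ≤ 10 * r ^ 7 * k ^ 6 := by
    unfold whiteBound
    calc r * (10 * r ^ 6 * ((k - 1) * k ^ 5)) ≤ r * (10 * r ^ 6 * (k * k ^ 5)) := by
          gcongr; omega
      _ = _ := by ring
  refine ⟨1 + 6 * (10 * r ^ 7 * k ^ 6), 4 * (10 * r ^ 7 * k ^ 6), by omega, by omega, ?_⟩
  simp [sizeBound]

/-- `r * whiteBound r k` contains only `r ^ 7`; the spare `r ^ 9 ≥ 512` absorbs the constant `10 * c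
≤ 60`. At `k = 0` truncated and integer subtraction agree, since `k ^ 5 = 0`. -/
theorem cast_bound {r k m c : ℕ} (hr : 2 ≤ r) (hc : c ≤ 6) :
    m ≤ c * (r * whiteBound r k) → (m : ℤ) ≤ ((k : ℤ) - 1) * (k : ℤ) ^ 5 * (r : ℤ) ^ 16 := by
  intro h
  have h₉ : 512 ≤ r ^ 9 := by
    calc 512 = 2 ^ 9 := by norm_num
      _ ≤ r ^ 9 := Nat.pow_le_pow_left hr 9
  have h₁ : m ≤ (k - 1) * k ^ 5 * r ^ 16 := by
    refine h.trans ?_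
    unfold whiteBound
    calc c * (r * (10 * r ^ 6 * ((k - 1) * k ^ 5))) = (c * 10) * (r ^ 7 * ((k - 1) * k ^ 5)) := by
          ring
      _ ≤ r ^ 9 * (r ^ 7 * ((k - 1) * k ^ 5)) := Nat.mul_le_mul_right _ (by omega)
      _ = _ := by ring
  obtain _ | k := k
  · simp at h₁
    simp [h₁]
  · have : ((m : ℕ) : ℤ) ≤ (((k + 1 - 1) * (k + 1) ^ 5 * r ^ 16 : ℕ) : ℤ) := by exact_mod_cast h₁
    simpa using this

end

/-! ### The two kernels -/

theorem subsetTestCover_hasPolyKernel (r : ℕ) (hr : 2 ≤ r) :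
    HasPolyKernel (subsetTestCover r)
      (fun (k : ℕ) (I' : SubsetInstance r) =>
        (I'.n : ℤ) ≤ ((k : ℤ) - 1) * (k : ℤ) ^ 5 * (r : ℤ) ^ 16 + 1 ∧
        (I'.edges.card : ℤ) ≤ ((k : ℤ) - 1) * (k : ℤ) ^ 5 * (r : ℤ) ^ 16 + (k : ℤ)) := by
  obtain ⟨p, T, hp⟩ := polyTime_kernelize r
  refine ⟨p, T, sizeBound r, fun (I : SubsetInstance r) d hd => ?_⟩
  obtain ⟨R, rfl, hk, hv, hy⟩ := SubsetInstance.Encodes.exists_raw hd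
  obtain ⟨t, ht, hrun⟩ := hp R
  obtain ⟨h₁, h₂, -, h₃, h₄, h₅⟩ := kernelize_spec hr hv
  generalize kernelize r R = K at *
  obtain ⟨n', k', L', B'⟩ := K
  dsimp only at h₃ h₄ h₅
  obtain ⟨I', hI', hn', hk', hE', hy'⟩ := h₁.exists_subsetInstance
  dsimp only at hn' hk' hE'
  refine ⟨I', _, t, hrun, ht, hI', hy.trans (h₂.trans hy'.symm), ?_, ?_, ?_⟩
  · change encSize (n', k', L', B') + I'.k ≤ (sizeBound r).eval I.k
    obtain ⟨b, c, hb, hc, hs⟩ := sizeBound_spec (r := r) (k := I.k)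
    rw [hk] at h₃ h₄ h₅
    have := h₁.encSize_le (h₃.trans hb) (h₅.trans hc)
    rw [hs, hk']
    simp only [encSize_prod]
    omega
  · change (I'.n : ℤ) ≤ ((I.k : ℤ) - 1) * (I.k : ℤ) ^ 5 * (r : ℤ) ^ 16 + 1
    rw [hk, ← hn'] at h₃
    -- The additive `1` in the vertex bound is split off first.
    have := cast_bound (k := I.k) (m := I'.n - 1) hr (by omega : 6 ≤ 6) (by omega)
    omega
  · change (I'.edges.card : ℤ) ≤ ((I.k : ℤ) - 1) * (I.k : ℤ) ^ 5 * (r : ℤ) ^ 16 + I.k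
    rw [hk, ← hE'] at h₅
    have := cast_bound (k := I.k) hr (by omega : 4 ≤ 6) h₅
    omega

theorem testCover_hasPolyKernel (r : ℕ) (hr : 2 ≤ r) :
    HasPolyKernel (testCover r)
      (fun (k : ℕ) (I' : TestInstance r) =>
        (I'.n : ℤ) ≤ 5 * (((k : ℤ) - 1) * (k : ℤ) ^ 5 * (r : ℤ) ^ 16) + 4 * (k : ℤ) + 1 ∧
        (I'.edges.card : ℤ) ≤ 3 * (((k : ℤ) - 1) * (k : ℤ) ^ 5 * (r : ℤ) ^ 16) + 3 * (k : ℤ)) := by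
  -- The input is given an empty black list, and the black list of the output is discarded.
  have hpt : PolyTime (fun x : ℕ × ℕ × List (List ℕ) => (x.1, x.2.1, x.2.2, ([] : List (List ℕ)))) :=
    .pair (.fst .id) (.pair (.fst (.snd .id)) (.pair (.snd (.snd .id)) (.const [])))
  have hpt' : PolyTime (fun x : RawInst => (x.1, x.2.1, x.2.2.1)) :=
    .pair (.fst .id) (.pair (.fst (.snd .id)) (.fst (.snd (.snd .id))))
  obtain ⟨p, T, hp⟩ := hpt'.comp ((polyTime_kernelize r).comp hpt)
  refine ⟨p, T, sizeBound r, fun (I : TestInstance r) d hd => ?_⟩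
  obtain ⟨n, k, L, rfl, rfl, hv, hy⟩ := TestInstance.Encodes.exists_raw hd
  obtain ⟨t, ht, hrun⟩ := hp (n, I.k, L)
  obtain ⟨h₁, -, h₂, h₃, h₄, h₅⟩ := kernelize_spec hr hv
  dsimp only at hrun
  generalize kernelize r (n, I.k, L, []) = K at *
  obtain ⟨n', k', L', B'⟩ := K
  dsimp only at hrun h₃ h₄ h₅
  obtain ⟨I', hI', hn', hk', hE', hy'⟩ := h₁.exists_testInstance
  refine ⟨I', _, t, hrun, ht, hI', hy.trans ((h₂ rfl).trans hy'.symm), ?_, ?_, ?_⟩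
  · change encSize (n', k', L') + I'.k ≤ (sizeBound r).eval I.k
    obtain ⟨b, c, hb, hc, hs⟩ := sizeBound_spec (r := r) (k := I.k)
    have := h₁.encSize_le (h₃.trans hb) (h₅.trans hc)
    rw [hs, hk']
    simp only [encSize_prod]
    omega
  · change (I'.n : ℤ) ≤ 5 * (((I.k : ℤ) - 1) * (I.k : ℤ) ^ 5 * (r : ℤ) ^ 16) + 4 * I.k + 1
    rw [← hn'] at h₃
    have := cast_bound (k := I.k) (m := I'.n - 1) hr (by omega : 6 ≤ 6) (by omega)
    -- The case `m = 0` says that the main term is nonnegative, so its larger multiple is a weaker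
    -- bound.
    have := cast_bound (k := I.k) (m := 0) hr (by omega : 6 ≤ 6) (by omega)
    omega
  · change (I'.edges.card : ℤ) ≤ 3 * (((I.k : ℤ) - 1) * (I.k : ℤ) ^ 5 * (r : ℤ) ^ 16) + 3 * I.k
    rw [← hE'] at h₅
    have := cast_bound (k := I.k) hr (by omega : 4 ≤ 6) h₅
    have := cast_bound (k := I.k) (m := 0) hr (by omega : 6 ≤ 6) (by omega)
    omega

end TestCoverKernel

theorem mainTheorem4 (r : ℕ) (hr : 2 ≤ r) :
    TestCoverKernel.HasPolyKernel (TestCoverKernel.subsetTestCover r)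
      (fun (k : ℕ) (I' : TestCoverKernel.SubsetInstance r) =>
        (I'.n : ℤ) ≤ ((k : ℤ) - 1) * (k : ℤ) ^ 5 * (r : ℤ) ^ 16 + 1 ∧
        (I'.edges.card : ℤ) ≤ ((k : ℤ) - 1) * (k : ℤ) ^ 5 * (r : ℤ) ^ 16 + (k : ℤ)) ∧
    TestCoverKernel.HasPolyKernel (TestCoverKernel.testCover r)
      (fun (k : ℕ) (I' : TestCoverKernel.TestInstance r) =>
        (I'.n : ℤ) ≤ 5 * (((k : ℤ) - 1) * (k : ℤ) ^ 5 * (r : ℤ) ^ 16) + 4 * (k : ℤ) + 1 ∧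
        (I'.edges.card : ℤ) ≤ 3 * (((k : ℤ) - 1) * (k : ℤ) ^ 5 * (r : ℤ) ^ 16) + 3 * (k : ℤ)) :=
  ⟨TestCoverKernel.subsetTestCover_hasPolyKernel r hr, TestCoverKernel.testCover_hasPolyKernel r hr⟩
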